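/- **Setting.** Let $\varphi$ be a real function that is real analytic near $0$, with $\varphi(0)=0$ and $\varphi'(0)\ne0$, and let $g(y)=\int_0^y\varphi(\eta)\,d\eta$. For $\rho>0$ and $\theta\in(0,1)$ let $\mathcal G_{\rho,\theta}$ be the space of sequences $u=(u_a)_{a\in\mathbb Z}$ of complex numbers with $\|u\|_{\rho,\theta}^2=\sum_{a}e^{2\rho|a|^\theta}|u_a|^2<\infty$, identified with the functions $u(x)=\sum_a u_ae^{iax}$ on $\mathbb T=\mathbb R/2\pi\mathbb Z$, and let $B_{\rho,\theta}(R)$ be its open ball of radius $R$ about $0$. The phase space consists of the points $z=(u,\bar u)$, $u\in\mathcal G_{\rho,\theta}$, which are identified with $u$ (so that $\|z\|_{\rho,\theta}=\|u\|_{\rho,\theta}$ and differentials are real-linear), with symplectic form $-i\sum_a du_a\wedge d\bar u_a$; the Hamiltonian vector field $X_F$ of a real function $F$ has the $u_a$-components $-i\,\partial F/\partial\bar u_a$. A canonical transformation is a smooth diffeomorphism onto an open image that preserves the symplectic form. Put $z_j=u_a$ for $j=(1,a)$ and $z_j=\bar u_a$ for $j=(-1,a)$, and $z_{\boldsymbol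 j}=z_{j_1}\cdots z_{j_{2l}}$ for $\boldsymbol j=(\delta_i,a_i)_{i=1}^{2l}\in(\{\pm1\}\times\mathbb Z)^{2l}$. Let $\mathcal R_{2l}$ be the set of those $\boldsymbol j$ with $\sum_i\delta_i=\sum_i\delta_ia_i=\sum_i\delta_ia_i^2=0$, and $\mathcal I_{2l}$ the set of those $\boldsymbol j\in\mathcal R_{2l}$ for which there is a permutation $\sigma$ with $\delta_i=-\delta_{\sigma(i)}$ and $a_i=a_{\sigma(i)}$ for all $i$. Let $I_a=|u_a|^2$. The Hamiltonian of the nonlinear Schrödinger equation $iu_t=-u_{xx}+\varphi(|u|^2)u$ is $$H=H_0+\frac1{2\pi}\int_{\mathbb T}g(|u|^2)\,dx,\qquad H_0=\sum_{a\in\mathbb Z}a^2|u_a|^2,$$ and for $r\ge 3$ the remainder of its Taylor expansion is $$R_{\ge 2r+2}=\frac1{2\pi}\int_{\mathbb T}\Big(g(|u|^2)-\sum_{l=2}^r\frac{\varphi^{(l-1)}(0)}{l!}|u|^{2l}\Big)dx.$$ Let $C_0\ge1$ be any constant with $\big|\varphi^{(l-1)}(0)/l!\big|<C_0^{\,l-1}$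 for all $l\ge2$. **Theorem 4.1.** There are an absolute constant $K>0$, constants $C,C_1,c>0$ depending only on $\rho,\theta,C_0$, and $\varepsilon_0>0$ (depending on $\varphi,\rho,\theta,C_0$) such that for every integer $r\ge3$ and every $0<\varepsilon\le\varepsilon_0$ with $\varepsilon\le c\,r^{-3/2}$ there are a canonical transformation $\phi^{(1)}:B_{\rho,\theta}(3\varepsilon)\to B_{\rho,\theta}(4\varepsilon)$, real polynomials $K_{2l}$ ($3\le l\le r$) and a real function $\mathscr R$ with $$H\circ\phi^{(1)}=H_0+Z_4+Z_6+\sum_{l=3}^rK_{2l}+\mathscr R+R_{\ge2r+2}\circ\phi^{(1)}\quad\text{on }B_{\rho,\theta}(3\varepsilon),$$ where: (i) for all $z\in B_{\rho,\theta}(3\varepsilon)$, $\|z-\phi^{(1)}(z)\|_{\rho,\theta}\le C\|z\|_{\rho,\theta}^3$, the differential $d\phi^{(1)}(z)$ is invertible, and $\|(d\phi^{(1)}(z))^{-1}\|\le K$ in operator norm; the inverse transformation satisfies the same estimates on $\phi^{(1)}(B_{\rho,\theta}(3\varepsilon))$; (ii) $Z_4$ and $Z_6$ are the integrable polynomials $$Z_4=\varphi'(0)\Big(\sum_aI_a\Big)^2-\frac{\varphi'(0)}2\sum_aI_a^2,$$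 $$Z_6=-\frac{(\varphi'(0))^2}2\sum_{a\ne a'}\frac{I_a^2I_{a'}}{(a-a')^2}+\frac{\varphi''(0)}6\Big(6\big(\sum_aI_a\big)^3-9\big(\sum_aI_a\big)\big(\sum_aI_a^2\big)+4\sum_aI_a^3\Big);$$ (iii) $K_6=\sum_{\boldsymbol j\in\mathcal R_6\setminus\mathcal I_6}c^{(6)}_{\boldsymbol j}z_{\boldsymbol j}$ and $K_{2l}=\sum_{\boldsymbol j\in\mathcal R_{2l}}c^{(2l)}_{\boldsymbol j}z_{\boldsymbol j}$ for $4\le l\le r$, with $\sup_{\boldsymbol j\in\mathcal R_{2l}}|c^{(2l)}_{\boldsymbol j}|\le(8(l-1)^3)^{l-2}C_0^{\,l-1}$ for $3\le l\le r$; (iv) $\mathscr R$ is differentiable on $B_{\rho,\theta}(3\varepsilon)$, its vector field takes values in $\mathcal G_{\rho,\theta}$ there, and $\|X_{\mathscr R}(z)\|_{\rho,\theta}\le K\,(r^3C_1)^r\|z\|_{\rho,\theta}^{2r+1}$. -/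

import Mathlib

open scoped ContDiff ComplexConjugate

noncomputable section

namespace GevreyNLS

/-! ## The Gevrey space -/

/-- The weight `e^{ρ |a|^θ}`. -/
def weight (ρ θ : ℝ) (a : ℤ) : ℝ := Real.exp (ρ * |(a : ℝ)| ^ θ)

theorem weight_pos (ρ θ : ℝ) (a : ℤ) : 0 < weight ρ θ a := Real.exp_pos _

/-- The sequences `u : ℤ → ℂ` with `∑ e^{2ρ|a|^θ} |u_a|² < ∞`, as a complex subspace of `ℤ → ℂ`. -/
def gevreySubmodule (ρ θ : ℝ) : Submodule ℂ (ℤ → ℂ) where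
  carrier := {u | Memℓp (fun a => (weight ρ θ a : ℂ) * u a) 2}
  zero_mem' := by
    have h : (fun a : ℤ => (weight ρ θ a : ℂ) * (0 : ℤ → ℂ) a) = 0 := by
      funext a; simp
    show Memℓp _ 2
    rw [h]; exact zero_memℓp
  add_mem' := by
    intro u v hu hv
    have h : (fun a : ℤ => (weight ρ θ a : ℂ) * (u + v) a) =
        (fun a => (weight ρ θ a : ℂ) * u a) + fun a => (weight ρ θ a : ℂ) * v a := by
      funext a; simp [mul_add]
    show Memℓp _ 2
    rw [h]; exact Memℓp.add hu hv
  smul_mem' := by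
    intro c u hu
    have h : (fun a : ℤ => (weight ρ θ a : ℂ) * (c • u) a) =
        c • fun a => (weight ρ θ a : ℂ) * u a := by
      funext a; simp [mul_left_comm]
    show Memℓp _ 2
    rw [h]; exact Memℓp.const_smul hu c

/-- The Gevrey space `𝒢_{ρ,θ}` of Fourier coefficient sequences. It is a type of its own, so that
its topology is the one of the weighted `ℓ²` norm and not the product topology. -/
def Gevrey (ρ θ : ℝ) : Type := ↥(gevreySubmodule ρ θ)

instance (ρ θ : ℝ) : AddCommGroup (Gevrey ρ θ) :=
  inferInstanceAs (AddCommGroup ↥(gevreySubmodule ρ θ))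

instance (ρ θ : ℝ) : Module ℂ (Gevrey ρ θ) :=
  inferInstanceAs (Module ℂ ↥(gevreySubmodule ρ θ))

instance (ρ θ : ℝ) : CoeFun (Gevrey ρ θ) (fun _ => ℤ → ℂ) := ⟨fun u => u.1⟩

/-- The identification `u ↦ (e^{ρ|a|^θ} u_a)_a` with a subspace of `ℓ²` (in fact all of it). -/
def toEll2 (ρ θ : ℝ) : Gevrey ρ θ →ₗ[ℂ] lp (fun _ : ℤ => ℂ) 2 where
  toFun u := ⟨fun a => (weight ρ θ a : ℂ) * u a, u.2⟩
  map_add' u v := by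
    apply Subtype.ext; funext a
    exact mul_add _ (u a) (v a)
  map_smul' c u := by
    apply Subtype.ext; funext a
    exact mul_left_comm _ c (u a)

theorem toEll2_injective (ρ θ : ℝ) : Function.Injective (toEll2 ρ θ) := by
  intro u v h
  apply Subtype.ext
  funext a
  have h1 := congrFun (congrArg Subtype.val h) a
  have h2 : (weight ρ θ a : ℂ) ≠ 0 := by exact_mod_cast (weight_pos ρ θ a).ne'
  exact mul_left_cancel₀ h2 h1

/-- The norm `‖u‖² = ∑ e^{2ρ|a|^θ} |u_a|²`, transported from `ℓ²`. -/
instance (ρ θ : ℝ) : NormedAddCommGroup (Gevrey ρ θ) :=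
  NormedAddCommGroup.induced (Gevrey ρ θ) (lp (fun _ : ℤ => ℂ) 2) (toEll2 ρ θ)
    (toEll2_injective ρ θ)

instance (ρ θ : ℝ) : NormedSpace ℂ (Gevrey ρ θ) :=
  NormedSpace.induced ℂ (Gevrey ρ θ) (lp (fun _ : ℤ => ℂ) 2) (toEll2 ρ θ)

/-- The norm is the Gevrey norm. -/
theorem norm_sq_eq (ρ θ : ℝ) (u : Gevrey ρ θ) :
    ‖u‖ ^ 2 = ∑' a : ℤ, Real.exp (2 * ρ * |(a : ℝ)| ^ θ) * ‖u a‖ ^ 2 := by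
  have h : ‖u‖ = ‖toEll2 ρ θ u‖ := rfl
  have h2 := lp.norm_rpow_eq_tsum (p := 2) (by norm_num) (toEll2 ρ θ u)
  simp only [ENNReal.toReal_ofNat, Real.rpow_ofNat] at h2
  rw [h, h2]
  refine tsum_congr fun a => ?_
  have h3 : (toEll2 ρ θ u : ∀ _ : ℤ, ℂ) a = (weight ρ θ a : ℂ) * u a := rfl
  rw [h3, norm_mul, mul_pow, Complex.norm_real, Real.norm_eq_abs,
    abs_of_pos (weight_pos ρ θ a), weight, ← Real.exp_nat_mul]
  congr 2
  push_cast; ring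

theorem single_mem (ρ θ : ℝ) (a : ℤ) (c : ℂ) :
    (Pi.single a c : ℤ → ℂ) ∈ gevreySubmodule ρ θ := by
  have h : (fun b : ℤ => (weight ρ θ b : ℂ) * (Pi.single a c : ℤ → ℂ) b) =
      Pi.single a ((weight ρ θ a : ℂ) * c) := by
    funext b
    by_cases hb : b = a
    · subst hb; simp
    · simp [hb]
  show Memℓp _ 2
  rw [h]
  have h2 := (lp.single (E := fun _ : ℤ => ℂ) 2 a ((weight ρ θ a : ℂ) * c)).2
  rwa [lp.coeFn_single] at h2

/-- The element of the Gevrey space whose only nonzero coefficient is `c`, at the mode `a`. -/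
def single (ρ θ : ℝ) (a : ℤ) (c : ℂ) : Gevrey ρ θ := ⟨Pi.single a c, single_mem ρ θ a c⟩

/-! ## Hamiltonian structure

The phase space consists of the points `z = (u, ū)` with `u` in the Gevrey space; such a point is
identified with `u`, and differentials are taken over `ℝ`. -/

variable {ρ θ : ℝ}

/-- The symplectic form `-i ∑ du_a ∧ dū_a`. -/
def sympl (v w : Gevrey ρ θ) : ℂ :=
  -Complex.I * ∑' a : ℤ, (v a * conj (w a) - conj (v a) * w a)

/-- The Wirtinger derivative `∂F/∂ū_a = (∂F/∂x_a + i ∂F/∂y_a) / 2`, where `u_a = x_a + i y_a`. -/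
def dBar (F : Gevrey ρ θ → ℝ) (u : Gevrey ρ θ) (a : ℤ) : ℂ :=
  ((fderiv ℝ F u (single ρ θ a 1) : ℝ) + Complex.I * (fderiv ℝ F u (single ρ θ a Complex.I) : ℝ))
    / 2

/-- `X` is the value at `u` of the Hamiltonian vector field of the real function `F`: its `u_a`
component is `-i ∂F/∂ū_a` (its `ū_a` component is the complex conjugate). -/
def IsHamVectorAt (F : Gevrey ρ θ → ℝ) (u X : Gevrey ρ θ) : Prop :=
  DifferentiableAt ℝ F u ∧ ∀ a : ℤ, X a = -Complex.I * dBar F u a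

/-- A canonical transformation: a smooth diffeomorphism from the open set `Φ.source` onto the open
set `Φ.target` that preserves the symplectic form. -/
def IsCanonical (Φ : OpenPartialHomeomorph (Gevrey ρ θ) (Gevrey ρ θ)) : Prop :=
  ContDiffOn ℝ ∞ Φ Φ.source ∧ ContDiffOn ℝ ∞ Φ.symm Φ.target ∧
    ∀ z ∈ Φ.source, ∀ v w : Gevrey ρ θ,
      sympl (fderiv ℝ Φ z v) (fderiv ℝ Φ z w) = sympl v w

/-- On `s`, the map `ψ` satisfies `‖z - ψ z‖ ≤ C ‖z‖³`, and its differential is invertible with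
`‖(dψ(z))⁻¹‖ ≤ K` in operator norm. -/
def NearIdentity (ψ : Gevrey ρ θ → Gevrey ρ θ) (s : Set (Gevrey ρ θ)) (C K : ℝ) : Prop :=
  ∀ z ∈ s, ‖z - ψ z‖ ≤ C * ‖z‖ ^ 3 ∧
    ∃ A : Gevrey ρ θ ≃L[ℝ] Gevrey ρ θ,
      HasFDerivAt ψ (A : Gevrey ρ θ →L[ℝ] Gevrey ρ θ) z ∧
      ‖(A.symm : Gevrey ρ θ →L[ℝ] Gevrey ρ θ)‖ ≤ K

/-! ## Index sets and monomials -/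

/-- Multi-indices `(j₁, …, j_{2l})` with `j_i = (δ_i, a_i) ∈ {±1} × ℤ`. -/
abbrev Idx (l : ℕ) : Type := Fin (2 * l) → ℤˣ × ℤ

/-- The resonant set `ℛ_{2l}`: `∑ δ_i = 0`, `∑ δ_i a_i = 0` and `∑ δ_i a_i² = 0`. -/
def resonant (l : ℕ) : Set (Idx l) :=
  {j | ∑ i, ((j i).1 : ℤ) = 0 ∧ ∑ i, ((j i).1 : ℤ) * (j i).2 = 0 ∧
    ∑ i, ((j i).1 : ℤ) * (j i).2 ^ 2 = 0}

/-- The integrable set `ℐ_{2l}`. -/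
def integrable (l : ℕ) : Set (Idx l) :=
  {j | j ∈ resonant l ∧ ∃ σ : Equiv.Perm (Fin (2 * l)),
    ∀ i, (j i).1 = -(j (σ i)).1 ∧ (j i).2 = (j (σ i)).2}

/-- `z_{(1,a)} = u_a` and `z_{(-1,a)} = ū_a`. -/
def coord (u : Gevrey ρ θ) (j : ℤˣ × ℤ) : ℂ := if j.1 = 1 then u j.2 else conj (u j.2)

/-- The monomial `z_{j₁} ⋯ z_{j_{2l}}`. -/
def monomial {l : ℕ} (u : Gevrey ρ θ) (j : Idx l) : ℂ := ∏ i, coord u (j i)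

/-! ## The Hamiltonian of the nonlinear Schrödinger equation -/

/-- The function `x ↦ ∑ u_a e^{iax}`. -/
def toFunction (u : Gevrey ρ θ) (x : ℝ) : ℂ :=
  ∑' a : ℤ, u a * Complex.exp (Complex.I * a * x)

/-- The actions `I_a = |u_a|²`. -/
def action (u : Gevrey ρ θ) (a : ℤ) : ℝ := ‖u a‖ ^ 2

/-- `H₀ = ∑ a² |u_a|²`. -/
def H0 (u : Gevrey ρ θ) : ℝ := ∑' a : ℤ, (a : ℝ) ^ 2 * action u a

/-- `g(y) = ∫₀^y φ`. -/
def primitive (φ : ℝ → ℝ) (y : ℝ) : ℝ := ∫ η in (0 : ℝ)..y, φ η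

/-- `H = H₀ + (1/2π) ∫ g(|u|²) dx`. -/
def hamiltonian (φ : ℝ → ℝ) (u : Gevrey ρ θ) : ℝ :=
  H0 u + 1 / (2 * Real.pi) * ∫ x in (0 : ℝ)..(2 * Real.pi), primitive φ (‖toFunction u x‖ ^ 2)

/-- The remainder of the Taylor expansion of the Hamiltonian: the terms of order at least `2r+2`
in `u`, obtained by subtracting from `g(y)` its Taylor polynomial
`∑_{l=2}^r φ^{(l-1)}(0)/l! y^l`. -/
def taylorRemainder (φ : ℝ → ℝ) (r : ℕ) (u : Gevrey ρ θ) : ℝ :=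
  1 / (2 * Real.pi) * ∫ x in (0 : ℝ)..(2 * Real.pi),
    (primitive φ (‖toFunction u x‖ ^ 2) -
      ∑ l ∈ Finset.Icc 2 r,
        iteratedDeriv (l - 1) φ 0 / (l.factorial : ℝ) * (‖toFunction u x‖ ^ 2) ^ l)

/-- `Z₄ = φ'(0) (∑ I_a)² - φ'(0)/2 ∑ I_a²`. -/
def Z4 (φ : ℝ → ℝ) (u : Gevrey ρ θ) : ℝ :=
  deriv φ 0 * (∑' a : ℤ, action u a) ^ 2 - deriv φ 0 / 2 * ∑' a : ℤ, action u a ^ 2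

/-- `Z₆ = -φ'(0)²/2 ∑_{a ≠ a'} I_a² I_{a'} / (a-a')²
  + φ''(0)/6 (6 (∑ I_a)³ - 9 (∑ I_a) (∑ I_a²) + 4 ∑ I_a³)`. -/
def Z6 (φ : ℝ → ℝ) (u : Gevrey ρ θ) : ℝ :=
  -(deriv φ 0) ^ 2 / 2 *
      (∑' p : {p : ℤ × ℤ // p.1 ≠ p.2},
        action u p.1.1 ^ 2 * action u p.1.2 / ((p.1.1 : ℝ) - (p.1.2 : ℝ)) ^ 2) +
    iteratedDeriv 2 φ 0 / 6 *
      (6 * (∑' a : ℤ, action u a) ^ 3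
        - 9 * (∑' a : ℤ, action u a) * (∑' a : ℤ, action u a ^ 2)
        + 4 * ∑' a : ℤ, action u a ^ 3)

end GevreyNLS

end

open GevreyNLS

/-!
The transformation is the time-one map of a single polynomial Hamiltonian
`χ = ∑_{1 ≤ k < r} χ_k`, with `χ_k` homogeneous of degree `2 k + 2`, and not a composition of `r`
successive changes of variables. Expanding along the flow gives
`(H₀ + P) ∘ Φ = H₀ + ∑_n ad_χ^n P / n! + ∑_n ad_χ^n {H₀, χ} / (n + 1)!`, where `P` is the sum of the
Taylor polynomials of the nonlinearity of degree at most `2 r`. In each degree only finitely many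
brackets occur, so the right-hand side is a formal sum `W` (`lieSeries`), and `χ_k` enters `W_k`
only through `{H₀, χ_k}`, which multiplies every coefficient by `i` times its frequency
`Ω = ∑ δ_i a_i²`. The generator is thus determined degree by degree (`IsNormalizing.succ`) so that
only resonant monomials are left below the degree `2 r + 2`; there are no small divisors, because
`Ω` is an integer.

Polynomials are handled through their families of coefficients, with the supremum norm. The
coefficients of a bracket of polynomials of degrees `2 k + 2` and `2 i + 2` are at most
`(2 k + 2) (2 i + 2)` times the product of the suprema (`isHamCoef_bracket`). Induction over the degree then yields the bound
`(8 k³)^(k - 1) C₀^k` for the coefficients of `χ_k` and of `W_k`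
(`isHamCoef_ad`, `IsNormalizing.isHam_next`), and the bound `(24 r³ C₀)^k` for `W_k` in all degrees
(`IsNormalizing.isHam_lieSeries_all`). Since `θ < 1`, the Gevrey norm is submultiplicative for
convolutions up to a constant `a = algConst ρ θ` (`exists_normSq_conv_le`), so a vector field of
degree `p` with momentum conservation is bounded by `a^p` times the supremum of its coefficients
(`norm_vecL_le`). On balls of radius `≲ r^(-3/2)` all the series converge geometrically: the terms
of degree at least `2 r + 2` form the remainder (`exists_isHamVectorAt_tail`), and the flow is close
to the identity. The flow is smooth in its initial value because the integral equation is inverted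
by the inverse function theorem in the space of curves (`exists_smooth_curves`,
`exists_timeOneMap`), and the Lie series represents the pullback (`IsNormalizing.pullback_eq`).

The integrable terms are computed from `W_1` and `W_2`. In degree four every resonant monomial is
integrable (`matched_of_resonant_four`), and the result is `Z₄`. In degree six the integrable part of
`P_2` gives the terms with `φ''(0)` (`tsum_orbitCount_three`), and the integrable part of the
contraction of `P_1` with `χ_1` gives the sum with the denominators `(a - a')²`: the terms with three
distinct modes cancel by the partial fraction identity `exchange_cyclic`.
-/

noncomputable section

open scoped ENNReal InnerProductSpace

namespace GevreyNLS

/-! ### The weight -/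

section

theorem summable_pow_mul_exp {c θ : ℝ} (hc : 0 < c) (hθ : 0 < θ) (m : ℕ) :
    Summable fun a : ℤ => |(a : ℝ)| ^ m * Real.exp (-(c * |(a : ℝ)| ^ θ)) := by
  obtain ⟨n, hn⟩ := exists_nat_ge ((m + 2 : ℝ) / θ)
  have hn' : (m + 2 : ℝ) ≤ θ * n := by rw [div_le_iff₀ hθ] at hn; linarith
  have hs : Summable fun a : ℤ => (n.factorial / c ^ n) * (1 / (a : ℝ) ^ 2) :=
    (Real.summable_one_div_int_pow.2 one_lt_two).mul_left _
  refine Summable.of_norm_bounded_eventually hs ?_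
  have hfin : ({0} : Set ℤ)ᶜ ∈ Filter.cofinite := (Set.finite_singleton 0).compl_mem_cofinite
  filter_upwards [hfin] with a ha
  have ha0 : a ≠ 0 := ha
  have hx : 1 ≤ |(a : ℝ)| := by exact_mod_cast Int.one_le_abs ha0
  set x := |(a : ℝ)| with hxdef
  have hx0 : 0 < x := by linarith
  have hxsq : (a : ℝ) ^ 2 = x ^ 2 := by rw [hxdef, sq_abs]
  rw [Real.norm_of_nonneg (by positivity), hxsq]
  have h1 : (c * x ^ θ) ^ n / n.factorial ≤ Real.exp (c * x ^ θ) :=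
    Real.pow_div_factorial_le_exp _ (by positivity) n
  have h2 : x ^ (m + 2) ≤ (x ^ θ) ^ n := by
    rw [← Real.rpow_natCast, ← Real.rpow_mul_natCast hx0.le]
    exact Real.rpow_le_rpow_of_exponent_le hx (by push_cast; linarith)
  rw [Real.exp_neg, ← div_eq_mul_inv, div_le_iff₀ (Real.exp_pos _)]
  have h3 : (n.factorial / c ^ n) * (1 / x ^ 2) * ((c * x ^ θ) ^ n / n.factorial)
      = (x ^ θ) ^ n / x ^ 2 := by
    have : (n.factorial : ℝ) ≠ 0 := by positivity
    rw [mul_pow]; field_simp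
  calc x ^ m ≤ (x ^ θ) ^ n / x ^ 2 := by
        rw [le_div_iff₀ (by positivity), ← pow_add]; exact h2
    _ ≤ _ := by rw [← h3]; gcongr

/-- For `y ≤ x`, adding `y` to `x` increases the `θ`-th power by at most the fraction `2 ^ θ - 1 < 1`
of `y ^ θ`. -/
theorem rpow_add_le_of_le {θ x y : ℝ} (h0 : 0 < θ) (h1 : θ < 1) (hy : 0 ≤ y) (hxy : y ≤ x) :
    (x + y) ^ θ ≤ x ^ θ + (2 ^ θ - 1) * y ^ θ := by
  rcases hy.eq_or_lt with rfl | hy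
  · simp [Real.zero_rpow h0.ne']
  have hx : 0 < x := hy.trans_le hxy
  have hc := (Real.concaveOn_rpow h0.le h1.le).2
  have hp : y ∈ Set.Ici (0 : ℝ) := hy.le
  have hq : x + y ∈ Set.Ici (0 : ℝ) := by simp; linarith
  have ht : 0 ≤ (x - y) / x := div_nonneg (by linarith) hx.le
  have hs : 0 ≤ y / x := by positivity
  have hst : y / x + (x - y) / x = 1 := by field_simp; ring
  have e1 := hc hp hq hs ht hst
  have e2 := hc hp hq ht hs (by linarith)
  simp only [smul_eq_mul] at e1 e2
  have f1 : y / x * y + (x - y) / x * (x + y) = x := by field_simp; ring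
  have f2 : (x - y) / x * y + y / x * (x + y) = 2 * y := by field_simp; ring
  rw [f1] at e1
  rw [f2, Real.mul_rpow (by norm_num) hy.le] at e2
  have : y / x * y ^ θ + (x - y) / x * y ^ θ = y ^ θ := by rw [← add_mul, hst, one_mul]
  have : y / x * (x + y) ^ θ + (x - y) / x * (x + y) ^ θ = (x + y) ^ θ := by
    rw [← add_mul, hst, one_mul]
  nlinarith

theorem two_rpow_sub_one_lt {θ : ℝ} (h1 : θ < 1) : (2 : ℝ) ^ θ - 1 < 1 := by
  have := Real.rpow_lt_rpow_of_exponent_lt (x := 2) (by norm_num) h1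
  rw [Real.rpow_one] at this
  linarith

theorem weight_le_of_abs_le {ρ θ : ℝ} (hρ : 0 < ρ) (h0 : 0 < θ) (h1 : θ < 1) {b c : ℤ}
    (h : |c| ≤ |b|) :
    weight ρ θ (b + c) ≤ weight ρ θ b * weight ((2 ^ θ - 1) * ρ) θ c := by
  have h' : |(c : ℝ)| ≤ |(b : ℝ)| := by exact_mod_cast h
  rw [weight, weight, weight, ← Real.exp_add, Real.exp_le_exp]
  have e1 : |((b + c : ℤ) : ℝ)| ^ θ ≤ (|(b : ℝ)| + |(c : ℝ)|) ^ θ := by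
    push_cast
    exact Real.rpow_le_rpow (abs_nonneg _) (abs_add_le _ _) h0.le
  have e2 := rpow_add_le_of_le h0 h1 (abs_nonneg _) h'
  nlinarith [mul_le_mul_of_nonneg_left (e1.trans e2) hρ.le]

/-- The weight of the Gevrey norm is subadditive in the exponent with a gain: one of the two factors
needs only the exponent `(2 ^ θ - 1) ρ < ρ`. -/
theorem weight_add_le {ρ θ : ℝ} (hρ : 0 < ρ) (h0 : 0 < θ) (h1 : θ < 1) (b c : ℤ) :
    weight ρ θ (b + c) ≤ weight ρ θ b * weight ((2 ^ θ - 1) * ρ) θ c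
      + weight ((2 ^ θ - 1) * ρ) θ b * weight ρ θ c := by
  rcases le_total |c| |b| with h | h
  · have := weight_le_of_abs_le hρ h0 h1 h
    have := mul_pos (weight_pos ((2 ^ θ - 1) * ρ) θ b) (weight_pos ρ θ c)
    linarith
  · have := weight_le_of_abs_le hρ h0 h1 h
    have := mul_pos (weight_pos ρ θ b) (weight_pos ((2 ^ θ - 1) * ρ) θ c)
    rw [add_comm b c]
    linarith

theorem one_le_weight {ρ θ : ℝ} (hρ : 0 < ρ) (a : ℤ) : 1 ≤ weight ρ θ a := by
  rw [weight, Real.one_le_exp_iff]; positivity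

/-! ### Convolutions of nonnegative sequences -/

theorem two_mul_mul_le_sq_add_sq (x y : ℝ≥0∞) : 2 * (x * y) ≤ x ^ 2 + y ^ 2 := by
  wlog h : x ≤ y generalizing x y
  · rw [mul_comm x y, add_comm]; exact this y x (le_of_not_ge h)
  obtain ⟨d, rfl⟩ := exists_add_of_le h
  calc 2 * (x * (x + d)) ≤ 2 * (x * (x + d)) + d ^ 2 := le_self_add
    _ = _ := by ring

/-- A common source of the Cauchy–Schwarz inequality and of its weighted form. -/
theorem tsum_sq_le_mul_of_two_mul_le {ι : Type*} {p q s : ι → ℝ≥0∞}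
    (h : ∀ b c, 2 * (p b * p c) ≤ q b * s c + q c * s b) :
    (∑' b, p b) ^ 2 ≤ (∑' b, q b) * ∑' b, s b := by
  have e : ∀ f g : ι → ℝ≥0∞, (∑' b, f b) * ∑' b, g b = ∑' b, ∑' c, f b * g c := by
    intro f g
    rw [← ENNReal.tsum_mul_right]
    exact tsum_congr fun b => ENNReal.tsum_mul_left.symm
  have h2 : 2 * (∑' b, p b) ^ 2 ≤ 2 * ((∑' b, q b) * ∑' b, s b) := by
    have e1 : 2 * ((∑' b, q b) * ∑' b, s b) = ∑' b, ∑' c, (q b * s c + q c * s b) := by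
      have e3 : (∑' b, q b) * ∑' b, s b = ∑' b, ∑' c, q c * s b := by
        rw [e]; exact ENNReal.tsum_comm
      rw [two_mul]
      nth_rewrite 2 [e3]
      rw [e, ← ENNReal.tsum_add]
      exact tsum_congr fun b => ENNReal.tsum_add.symm
    rw [e1, sq, e, ← ENNReal.tsum_mul_left]
    refine ENNReal.tsum_le_tsum fun b => ?_
    rw [← ENNReal.tsum_mul_left]
    exact ENNReal.tsum_le_tsum fun c => h b c
  exact (ENNReal.mul_le_mul_iff_right two_ne_zero ENNReal.ofNat_ne_top).1 h2

theorem tsum_mul_sq_le {ι : Type*} (f g : ι → ℝ≥0∞) :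
    (∑' b, f b * g b) ^ 2 ≤ (∑' b, f b ^ 2) * ∑' b, g b ^ 2 := by
  refine tsum_sq_le_mul_of_two_mul_le fun b c => ?_
  have := two_mul_mul_le_sq_add_sq (f b * g c) (f c * g b)
  calc _ = 2 * (f b * g c * (f c * g b)) := by ring
    _ ≤ _ := this
    _ = _ := by ring

theorem tsum_mul_sq_le_weighted {ι : Type*} (x w : ι → ℝ≥0∞) :
    (∑' b, x b * w b) ^ 2 ≤ (∑' b, x b ^ 2 * w b) * ∑' b, w b := by
  refine tsum_sq_le_mul_of_two_mul_le fun b c => ?_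
  have := two_mul_mul_le_sq_add_sq (x b) (x c)
  calc _ = 2 * (x b * x c) * (w b * w c) := by ring
    _ ≤ (x b ^ 2 + x c ^ 2) * (w b * w c) := by gcongr
    _ = _ := by ring

/-- Young's inequality `ℓ² * ℓ¹ ⊆ ℓ²`. -/
theorem tsum_conv_sq_le (x y : ℤ → ℝ≥0∞) :
    ∑' a, (∑' b, x b * y (a - b)) ^ 2 ≤ (∑' b, x b ^ 2) * (∑' b, y b) ^ 2 := by
  have shift : ∀ b, ∑' a, y (a - b) = ∑' a, y a := fun b =>
    (Equiv.subRight b).tsum_eq y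
  have shift' : ∀ a, ∑' b, y (a - b) = ∑' b, y b := fun a =>
    (Equiv.subLeft a).tsum_eq y
  calc ∑' a, (∑' b, x b * y (a - b)) ^ 2
      ≤ ∑' a, (∑' b, x b ^ 2 * y (a - b)) * ∑' b, y b := by
        refine ENNReal.tsum_le_tsum fun a => ?_
        rw [← shift' a]
        exact tsum_mul_sq_le_weighted x fun b => y (a - b)
    _ = (∑' b, x b ^ 2) * (∑' b, y b) ^ 2 := by
        rw [ENNReal.tsum_mul_right, ENNReal.tsum_comm]
        simp_rw [ENNReal.tsum_mul_left, shift]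
        rw [ENNReal.tsum_mul_right]; ring

/-- The square of the Gevrey norm of a nonnegative sequence. -/
def normSq (ρ θ : ℝ) (y : ℤ → ℝ≥0∞) : ℝ≥0∞ := ∑' a, (ENNReal.ofReal (weight ρ θ a) * y a) ^ 2

theorem normSq_mono {ρ θ : ℝ} {x y : ℤ → ℝ≥0∞} (h : ∀ a, x a ≤ y a) :
    normSq ρ θ x ≤ normSq ρ θ y :=
  ENNReal.tsum_le_tsum fun a => by gcongr; exact h a

theorem add_sq_le_two_mul (x y : ℝ≥0∞) : (x + y) ^ 2 ≤ 2 * (x ^ 2 + y ^ 2) := by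
  calc (x + y) ^ 2 = x ^ 2 + y ^ 2 + 2 * (x * y) := by ring
    _ ≤ x ^ 2 + y ^ 2 + (x ^ 2 + y ^ 2) := by gcongr; exact two_mul_mul_le_sq_add_sq x y
    _ = _ := by ring

/-- The Gevrey norm controls convolutions because `θ < 1`: the smaller of the two frequencies is
weighted only with the fraction `2 ^ θ - 1 < 1` of its exponent, which leaves an `ℓ¹` sequence. -/
theorem exists_normSq_conv_le {ρ θ : ℝ} (hρ : 0 < ρ) (h0 : 0 < θ) (h1 : θ < 1) :
    ∃ C : ℝ, 1 ≤ C ∧ ∀ x y : ℤ → ℝ≥0∞, normSq ρ θ (fun a => ∑' b, x b * y (a - b)) ≤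
      ENNReal.ofReal C ^ 2 * (normSq ρ θ x * normSq ρ θ y) := by
  set κ := (2 : ℝ) ^ θ - 1 with hκ
  have hκ1 : κ < 1 := two_rpow_sub_one_lt h1
  have hs := summable_pow_mul_exp (c := 2 * ((1 - κ) * ρ)) (by nlinarith) h0 0
  simp only [pow_zero, one_mul] at hs
  set S := ∑' a : ℤ, Real.exp (-(2 * ((1 - κ) * ρ) * |(a : ℝ)| ^ θ)) with hS
  have hS0 : 0 ≤ S := tsum_nonneg fun a => (Real.exp_pos _).le
  let W : ℤ → ℝ≥0∞ := fun a => ENNReal.ofReal (weight ρ θ a)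
  let V : ℤ → ℝ≥0∞ := fun a => ENNReal.ofReal (weight (κ * ρ) θ a)
  let U : ℤ → ℝ≥0∞ := fun a => ENNReal.ofReal (Real.exp (-((1 - κ) * ρ * |(a : ℝ)| ^ θ)))
  have hV : ∀ a, V a = U a * W a := by
    intro a
    simp only [V, U, W]
    rw [← ENNReal.ofReal_mul (Real.exp_pos _).le, weight, weight, ← Real.exp_add]
    congr 2; ring
  have hU : ∑' a, U a ^ 2 = ENNReal.ofReal S := by
    rw [hS, ENNReal.ofReal_tsum_of_nonneg (fun a => (Real.exp_pos _).le) hs]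
    refine tsum_congr fun a => ?_
    simp only [U]
    rw [← ENNReal.ofReal_pow (Real.exp_pos _).le, ← Real.exp_nat_mul]
    congr 2; push_cast; ring
  have hl1 : ∀ y : ℤ → ℝ≥0∞, (∑' a, V a * y a) ^ 2 ≤ ENNReal.ofReal S * normSq ρ θ y := by
    intro y
    have : ∀ a, V a * y a = U a * (W a * y a) := fun a => by rw [hV, mul_assoc]
    simp_rw [this]
    rw [← hU]
    exact tsum_mul_sq_le _ _
  refine ⟨4 * S + 1, by linarith, fun x y => ?_⟩
  have key : ∀ a, (W a * ∑' b, x b * y (a - b)) ^ 2 ≤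
      2 * ((∑' b, (W b * x b) * (V (a - b) * y (a - b))) ^ 2 +
        (∑' b, (V b * x b) * (W (a - b) * y (a - b))) ^ 2) := by
    intro a
    refine le_trans ?_ (add_sq_le_two_mul _ _)
    gcongr
    rw [← ENNReal.tsum_mul_left, ← ENNReal.tsum_add]
    refine ENNReal.tsum_le_tsum fun b => ?_
    have hw := weight_add_le hρ h0 h1 b (a - b)
    rw [add_sub_cancel, ← hκ] at hw
    have hw' : W a ≤ W b * V (a - b) + V b * W (a - b) := by
      simp only [W, V]
      rw [← ENNReal.ofReal_mul (weight_pos _ _ _).le, ← ENNReal.ofReal_mul (weight_pos _ _ _).le,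
        ← ENNReal.ofReal_add (mul_pos (weight_pos _ _ _) (weight_pos _ _ _)).le
          (mul_pos (weight_pos _ _ _) (weight_pos _ _ _)).le]
      exact ENNReal.ofReal_le_ofReal hw
    calc W a * (x b * y (a - b)) ≤ (W b * V (a - b) + V b * W (a - b)) * (x b * y (a - b)) := by
          gcongr
      _ = _ := by ring
  have t1 := tsum_conv_sq_le (fun b => W b * x b) (fun b => V b * y b)
  have t2 := tsum_conv_sq_le (fun b => W b * y b) (fun b => V b * x b)
  have t2' : ∀ a, ∑' b, (V b * x b) * (W (a - b) * y (a - b)) =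
      ∑' b, (W b * y b) * (V (a - b) * x (a - b)) := by
    intro a
    rw [← (Equiv.subLeft a).tsum_eq]
    refine tsum_congr fun b => ?_
    simp only [Equiv.subLeft_apply, sub_sub_cancel]; ring
  have hC : ENNReal.ofReal (4 * S + 1) ^ 2 ≥ 4 * ENNReal.ofReal S := by
    have e4 : (4 : ℝ≥0∞) = ENNReal.ofReal 4 := by simp
    rw [e4, ← ENNReal.ofReal_mul (by norm_num), ← ENNReal.ofReal_pow (by linarith)]
    apply ENNReal.ofReal_le_ofReal
    nlinarith
  calc normSq ρ θ (fun a => ∑' b, x b * y (a - b))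
      ≤ ∑' a, 2 * ((∑' b, (W b * x b) * (V (a - b) * y (a - b))) ^ 2 +
        (∑' b, (V b * x b) * (W (a - b) * y (a - b))) ^ 2) := ENNReal.tsum_le_tsum key
    _ ≤ 2 * (normSq ρ θ x * (ENNReal.ofReal S * normSq ρ θ y) +
          normSq ρ θ y * (ENNReal.ofReal S * normSq ρ θ x)) := by
        rw [ENNReal.tsum_mul_left, ENNReal.tsum_add]
        simp_rw [t2']
        gcongr
        · exact t1.trans (by gcongr; · exact le_rfl
                             · exact hl1 y)
        · exact t2.trans (by gcongr; · exact le_rfl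
                             · exact hl1 x)
    _ = 4 * ENNReal.ofReal S * (normSq ρ θ x * normSq ρ θ y) := by ring
    _ ≤ _ := by gcongr

end

/-! ### Coordinates and multi-indices -/

section

/-- The admissible indices of the Gevrey space. -/
class GevreyIndex (ρ θ : ℝ) : Prop where
  rho_pos : 0 < ρ
  theta_pos : 0 < θ
  theta_lt : θ < 1

/-- The index `(δ, a)` of one of the coordinates `u_a`, `ū_a`. -/
abbrev Mode : Type := ℤˣ × ℤ

/-- The index of the conjugate coordinate. -/
def bar (o : Mode) : Mode := (-o.1, o.2)

@[simp] theorem bar_bar (o : Mode) : bar (bar o) = o := by simp [bar]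

/-- `∑ δ_i`. -/
def charge {n : ℕ} (j : Fin n → Mode) : ℤ := ∑ i, ((j i).1 : ℤ)
/-- `∑ δ_i a_i`. -/
def mom {n : ℕ} (j : Fin n → Mode) : ℤ := ∑ i, ((j i).1 : ℤ) * (j i).2
/-- `∑ δ_i a_i²`, the frequency of the monomial `z_j` under the flow of `H₀`. -/
def freq {n : ℕ} (j : Fin n → Mode) : ℤ := ∑ i, ((j i).1 : ℤ) * (j i).2 ^ 2

variable {ρ θ : ℝ}

theorem rpow_exp_neg (ρ θ : ℝ) (a : ℤ) :
    (weight ρ θ a)⁻¹ = Real.exp (-(ρ * |(a : ℝ)| ^ θ)) := by rw [weight, Real.exp_neg]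

theorem units_tsum {α : Type*} [NormedAddCommGroup α] [CompleteSpace α] {f : Mode → α} (hf : Summable f) :
    ∑' o, f o = ∑' a : ℤ, f (1, a) + ∑' a : ℤ, f (-1, a) := by
  rw [hf.tsum_prod, tsum_fintype]
  have : (Finset.univ : Finset ℤˣ) = {1, -1} := rfl
  rw [this, Finset.sum_pair (by decide)]

theorem units_tsum_ennreal (f : Mode → ℝ≥0∞) :
    ∑' o, f o = ∑' a : ℤ, f (1, a) + ∑' a : ℤ, f (-1, a) := by
  rw [ENNReal.tsum_prod', tsum_fintype]
  have : (Finset.univ : Finset ℤˣ) = {1, -1} := rfl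
  rw [this, Finset.sum_pair (by decide)]

theorem units_summable {f : Mode → ℝ} (h0 : ∀ o, 0 ≤ f o) (h : ∀ d, Summable fun a => f (d, a)) :
    Summable f :=
  (summable_prod_of_nonneg h0).2 ⟨h, (hasSum_fintype _).summable⟩

theorem coord_one (u : Gevrey ρ θ) (a : ℤ) : coord u (1, a) = u a := by simp [coord]
theorem coord_neg_one (u : Gevrey ρ θ) (a : ℤ) : coord u (-1, a) = conj (u a) := by
  have : (-1 : ℤˣ) ≠ 1 := by decide
  simp [coord, this]
theorem coord_bar (u : Gevrey ρ θ) (o : Mode) : coord u (bar o) = conj (coord u o) := by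
  obtain ⟨d, a⟩ := o
  rcases Int.units_eq_one_or d with rfl | rfl
  · simp only [bar]; rw [coord_neg_one, coord_one]
  · simp only [bar, neg_neg]; rw [coord_neg_one, coord_one]; simp
theorem norm_coord (u : Gevrey ρ θ) (o : Mode) : ‖coord u o‖ = ‖u o.2‖ := by
  unfold coord; split_ifs <;> simp

theorem weight_mul_norm_le (u : Gevrey ρ θ) (a : ℤ) : weight ρ θ a * ‖u a‖ ≤ ‖u‖ := by
  have h := lp.norm_apply_le_norm (p := 2) (by norm_num) (toEll2 ρ θ u) a
  have h3 : (toEll2 ρ θ u : ∀ _ : ℤ, ℂ) a = (weight ρ θ a : ℂ) * u a := rfl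
  rw [h3, norm_mul, Complex.norm_real, Real.norm_of_nonneg (weight_pos ρ θ a).le] at h
  exact h

theorem norm_apply_le (u : Gevrey ρ θ) (a : ℤ) : ‖u a‖ ≤ (weight ρ θ a)⁻¹ * ‖u‖ := by
  rw [inv_mul_eq_div, le_div_iff₀ (weight_pos ρ θ a), mul_comm]
  exact weight_mul_norm_le u a

theorem norm_coord_le (u : Gevrey ρ θ) (o : Mode) : ‖coord u o‖ ≤ (weight ρ θ o.2)⁻¹ * ‖u‖ := by
  rw [norm_coord]; exact norm_apply_le u o.2

theorem add_apply (u v : Gevrey ρ θ) (a : ℤ) : (u + v) a = u a + v a := rfl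
theorem real_smul_apply (c : ℝ) (u : Gevrey ρ θ) (a : ℤ) : (c • u) a = (c : ℂ) * u a := rfl

/-- The coordinate `z_o` as a real-linear form. -/
def coordL (ρ θ : ℝ) (o : Mode) : Gevrey ρ θ →ₗ[ℝ] ℂ where
  toFun u := coord u o
  map_add' u v := by
    unfold coord; split_ifs <;> simp [add_apply]
  map_smul' c u := by
    unfold coord; split_ifs <;> simp [real_smul_apply]

/-- The real-multilinear form `w ↦ ∏ (w_k)_{j_k}`. -/
def monomialL (ρ θ : ℝ) {n : ℕ} (j : Fin n → Mode) :
    MultilinearMap ℝ (fun _ : Fin n => Gevrey ρ θ) ℂ :=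
  (MultilinearMap.mkPiAlgebra ℝ (Fin n) ℂ).compLinearMap fun k => coordL ρ θ (j k)

theorem monomialL_apply {n : ℕ} (j : Fin n → Mode) (w : Fin n → Gevrey ρ θ) :
    monomialL ρ θ j w = ∏ k, coord (w k) (j k) := rfl

/-! ### Sums over multi-indices -/

theorem summable_norm_prod {R : Type*} [NormedCommRing R] [CompleteSpace R] {ι : Type*} {n : ℕ}
    (v : Fin n → ι → R) (h : ∀ k, Summable fun o => ‖v k o‖) :
    Summable (fun j : Fin n → ι => ‖∏ k, v k (j k)‖) ∧
      ∑' j : Fin n → ι, ∏ k, v k (j k) = ∏ k, ∑' o, v k o := by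
  induction n with
  | zero => exact ⟨(hasSum_fintype _).summable, by simp⟩
  | succ n ih =>
    obtain ⟨h1, h2⟩ := ih (fun k => v k.succ) fun k => h k.succ
    let e := Fin.consEquiv (fun _ : Fin (n + 1) => ι)
    have he : ∀ x : ι × (Fin n → ι), ∏ k, v k (e x k) = v 0 x.1 * ∏ k : Fin n, v k.succ (x.2 k) := by
      intro x
      rw [Fin.prod_univ_succ]; rfl
    constructor
    · rw [← e.summable_iff]
      have := (Summable.mul_norm (h 0) h1)
      refine this.congr fun x => ?_
      simp only [Function.comp, he]
    · rw [← e.tsum_eq, Fin.prod_univ_succ, ← h2, tsum_mul_tsum_of_summable_norm (h 0) h1]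
      exact tsum_congr he

/-- Sums over multi-indices, one of whose entries is singled out. -/
theorem tsum_insertNth {α : Type*} [NormedAddCommGroup α] [CompleteSpace α] {ι : Type*} {p : ℕ}
    {F : (Fin (p + 1) → ι) → α} (hF : Summable F) (i : Fin (p + 1)) :
    ∑' j, F j = ∑' o, ∑' j' : Fin p → ι, F (i.insertNth o j') := by
  let e := Fin.insertNthEquiv (fun _ : Fin (p + 1) => ι) i
  have h : Summable fun x => F (e x) := e.summable_iff.2 hF
  rw [← e.tsum_eq, h.tsum_prod]
  rfl

/-! ### The majorant of a multilinear vector field -/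

theorem ofReal_weight_mul_sq (ρ θ : ℝ) (a : ℤ) (c : ℂ) :
    ENNReal.ofReal (‖(weight ρ θ a : ℂ) * c‖ ^ 2) = (ENNReal.ofReal (weight ρ θ a) * ‖c‖ₑ) ^ 2 := by
  rw [norm_mul, Complex.norm_real, Real.norm_of_nonneg (weight_pos ρ θ a).le,
    ← ofReal_norm, ← ENNReal.ofReal_mul (weight_pos ρ θ a).le,
    ← ENNReal.ofReal_pow (mul_nonneg (weight_pos ρ θ a).le (norm_nonneg _))]

/-- The element of the Gevrey space with the given coefficients. -/
def ofSeq (y : ℤ → ℂ) (h : y ∈ gevreySubmodule ρ θ) : Gevrey ρ θ := ⟨y, h⟩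

theorem enorm_sq_eq_normSq (u : Gevrey ρ θ) : ‖u‖ₑ ^ 2 = normSq ρ θ fun a => ‖u a‖ₑ := by
  have h := lp.hasSum_norm (p := 2) (by norm_num) (toEll2 ρ θ u)
  simp only [ENNReal.toReal_ofNat, Real.rpow_ofNat] at h
  have h1 : ‖u‖ ^ 2 = ‖toEll2 ρ θ u‖ ^ 2 := rfl
  rw [← ofReal_norm, ← ENNReal.ofReal_pow (norm_nonneg _), h1, ← h.tsum_eq,
    ENNReal.ofReal_tsum_of_nonneg (fun _ => by positivity) h.summable]
  refine tsum_congr fun a => ?_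
  exact ofReal_weight_mul_sq ρ θ a (u a)

/-- A sequence whose Gevrey norm is at most `B` is an element of the Gevrey space. -/
theorem exists_gevrey_of_normSq_le {y : ℤ → ℂ} {B : ℝ} (hB : 0 ≤ B)
    (h : normSq ρ θ (fun a => ‖y a‖ₑ) ≤ ENNReal.ofReal (B ^ 2)) :
    ∃ u : Gevrey ρ θ, u.1 = y ∧ ‖u‖ ≤ B := by
  have hm : y ∈ gevreySubmodule ρ θ := by
    refine memℓp_gen ?_
    simp only [ENNReal.toReal_ofNat, Real.rpow_ofNat]
    have hfin : ∑' a, ENNReal.ofReal (‖(weight ρ θ a : ℂ) * y a‖ ^ 2) ≠ ⊤ := by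
      refine ne_top_of_le_ne_top ENNReal.ofReal_ne_top (le_trans (le_of_eq ?_) h)
      refine tsum_congr fun a => ?_
      exact ofReal_weight_mul_sq ρ θ a (y a)
    refine (ENNReal.summable_toReal hfin).congr fun a => ?_
    rw [ENNReal.toReal_ofReal (by positivity)]
  refine ⟨ofSeq y hm, rfl, ?_⟩
  have h1 := enorm_sq_eq_normSq (ρ := ρ) (θ := θ) (ofSeq (ρ := ρ) (θ := θ) y hm)
  have h2 : ‖(ofSeq (ρ := ρ) (θ := θ) y hm)‖ₑ ^ 2 ≤ ENNReal.ofReal (B ^ 2) := h1.trans_le h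
  rw [← ofReal_norm, ← ENNReal.ofReal_pow (norm_nonneg _),
    ENNReal.ofReal_le_ofReal_iff (by positivity)] at h2
  exact (pow_le_pow_iff_left₀ (norm_nonneg _) hB two_ne_zero).1 h2

/-- The amplitudes `|u_b| + |u_{-b}|`, indexed by the momentum `b` that a coordinate carries. -/
def amplitude (u : Gevrey ρ θ) (b : ℤ) : ℝ≥0∞ :=
  ∑' o : Mode, if (o.1 : ℤ) * o.2 = b then ‖coord u o‖ₑ else 0

theorem amplitude_eq (u : Gevrey ρ θ) (b : ℤ) : amplitude u b = ‖u b‖ₑ + ‖u (-b)‖ₑ := by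
  rw [amplitude, units_tsum_ennreal]
  congr 1
  · rw [tsum_eq_single b]
    · simp [coord_one]
    · intro a ha; simp [ha]
  · rw [tsum_eq_single (-b)]
    · simp [coord_neg_one]
    · intro a ha
      have : ¬ -a = b := fun h => ha (by omega)
      simp [this]

theorem weight_neg (ρ θ : ℝ) (a : ℤ) : weight ρ θ (-a) = weight ρ θ a := by
  simp [weight]

theorem normSq_amplitude_le (u : Gevrey ρ θ) : normSq ρ θ (amplitude u) ≤ 4 * ‖u‖ₑ ^ 2 := by
  have h : normSq ρ θ (fun a => ‖u (-a)‖ₑ) = normSq ρ θ fun a => ‖u a‖ₑ := by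
    unfold normSq
    rw [← (Equiv.neg ℤ).tsum_eq]
    simp [weight_neg]
  calc normSq ρ θ (amplitude u)
      ≤ ∑' a, 2 * ((ENNReal.ofReal (weight ρ θ a) * ‖u a‖ₑ) ^ 2 +
          (ENNReal.ofReal (weight ρ θ a) * ‖u (-a)‖ₑ) ^ 2) := by
        refine ENNReal.tsum_le_tsum fun a => ?_
        rw [amplitude_eq, mul_add]
        exact add_sq_le_two_mul _ _
    _ = 2 * (normSq ρ θ (fun a => ‖u a‖ₑ) + normSq ρ θ (fun a => ‖u (-a)‖ₑ)) := by
        rw [ENNReal.tsum_mul_left, ENNReal.tsum_add]; rfl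
    _ = 4 * ‖u‖ₑ ^ 2 := by rw [h, enorm_sq_eq_normSq]; ring

/-- The sum of `∏ |(w_k)_{j_k}|` over the multi-indices of momentum `a`. -/
def majorant {p : ℕ} (w : Fin p → Gevrey ρ θ) (a : ℤ) : ℝ≥0∞ :=
  ∑' j : Fin p → Mode, if mom j = a then ∏ k, ‖coord (w k) (j k)‖ₑ else 0

theorem majorant_succ {p : ℕ} (w : Fin (p + 1) → Gevrey ρ θ) (a : ℤ) :
    majorant w a = ∑' b, amplitude (w 0) b * majorant (fun k : Fin p => w k.succ) (a - b) := by
  let e := Fin.consEquiv (fun _ : Fin (p + 1) => Mode)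
  have hm : ∀ x : Mode × (Fin p → Mode), mom (e x) = (x.1.1 : ℤ) * x.1.2 + mom x.2 := by
    intro x; unfold mom; rw [Fin.sum_univ_succ]; rfl
  have hp : ∀ x : Mode × (Fin p → Mode), ∏ k, ‖coord (w k) (e x k)‖ₑ =
      ‖coord (w 0) x.1‖ₑ * ∏ k : Fin p, ‖coord (w k.succ) (x.2 k)‖ₑ := by
    intro x; rw [Fin.prod_univ_succ]; rfl
  unfold majorant amplitude
  rw [← e.tsum_eq, ENNReal.tsum_prod']
  simp_rw [hm, hp, ← ENNReal.tsum_mul_right]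
  refine Eq.trans (tsum_congr fun o : Mode => ?_) ENNReal.tsum_comm
  refine Eq.trans ?_ (tsum_eq_single ((o.1 : ℤ) * o.2) ?_).symm
  · rw [if_pos rfl, ← ENNReal.tsum_mul_left]
    refine tsum_congr fun j => ?_
    have : ((o.1 : ℤ) * o.2 + mom j = a) ↔ mom j = a - (o.1 : ℤ) * o.2 := by
      constructor <;> intro h <;> linarith
    simp only [this, mul_ite, mul_zero]
  · intro b hb
    rw [if_neg (Ne.symm hb), zero_mul]

section Constants

variable (ρ θ) [hI : GevreyIndex ρ θ]

theorem summable_inv_weight : Summable fun o : Mode => (weight ρ θ o.2)⁻¹ := by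
  refine units_summable (fun o => (inv_pos.2 (weight_pos ρ θ _)).le) fun d => ?_
  have := summable_pow_mul_exp hI.rho_pos hI.theta_pos 0
  simp only [pow_zero, one_mul] at this
  simp_rw [rpow_exp_neg]
  exact this

/-- A constant that governs both the `ℓ¹` norm and the convolutions of Gevrey sequences. -/
def algConst : ℝ := (∑' o : Mode, (weight ρ θ o.2)⁻¹) +
  2 * (exists_normSq_conv_le hI.rho_pos hI.theta_pos hI.theta_lt).choose

theorem two_mul_le_algConst :
    2 * (exists_normSq_conv_le hI.rho_pos hI.theta_pos hI.theta_lt).choose ≤ algConst ρ θ := by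
  have : 0 ≤ ∑' o : Mode, (weight ρ θ o.2)⁻¹ := tsum_nonneg fun o => (inv_pos.2 (weight_pos ρ θ _)).le
  unfold algConst; linarith

theorem one_le_algConst : 1 ≤ algConst ρ θ := by
  have := (exists_normSq_conv_le hI.rho_pos hI.theta_pos hI.theta_lt).choose_spec.1
  have := two_mul_le_algConst ρ θ
  linarith

theorem algConst_pos : 0 < algConst ρ θ := zero_lt_one.trans_le (one_le_algConst ρ θ)

theorem tsum_inv_weight_le : ∑' o : Mode, (weight ρ θ o.2)⁻¹ ≤ algConst ρ θ := by
  have := (exists_normSq_conv_le hI.rho_pos hI.theta_pos hI.theta_lt).choose_spec.1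
  unfold algConst; linarith

variable {ρ θ}

/-- The Gevrey norm of a product of `p` functions with arbitrary conjugations: by induction on `p`, one
convolution at a time. -/
theorem normSq_majorant_le {p : ℕ} (w : Fin p → Gevrey ρ θ) :
    normSq ρ θ (majorant w) ≤ ENNReal.ofReal ((algConst ρ θ ^ p * ∏ k, ‖w k‖) ^ 2) := by
  induction p with
  | zero =>
    have h0 : ∀ a, a ≠ 0 → majorant w a = 0 := by
      intro a ha
      simp [majorant, mom, Ne.symm ha]
    have h1 : majorant w 0 = 1 := by simp [majorant, mom]
    unfold normSq
    rw [tsum_eq_single 0 (fun a ha => by simp [h0 a ha]), h1]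
    simp [weight, Real.zero_rpow hI.theta_pos.ne']
  | succ p ih =>
    obtain ⟨hC, hconv⟩ :=
      (exists_normSq_conv_le hI.rho_pos hI.theta_pos hI.theta_lt).choose_spec
    have h2 := two_mul_le_algConst ρ θ
    set C := (exists_normSq_conv_le hI.rho_pos hI.theta_pos hI.theta_lt).choose
    have hA := algConst_pos ρ θ
    have e1 : majorant w = fun a =>
        ∑' b, amplitude (w 0) b * majorant (fun k : Fin p => w k.succ) (a - b) :=
      funext (majorant_succ w)
    rw [e1]
    refine (hconv _ _).trans ?_
    calc ENNReal.ofReal C ^ 2 * (normSq ρ θ (amplitude (w 0)) *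
          normSq ρ θ (majorant fun k : Fin p => w k.succ))
        ≤ ENNReal.ofReal C ^ 2 * ((4 * ‖w 0‖ₑ ^ 2) *
          ENNReal.ofReal ((algConst ρ θ ^ p * ∏ k : Fin p, ‖w k.succ‖) ^ 2)) := by
          gcongr
          · exact normSq_amplitude_le _
          · exact ih _
      _ = ENNReal.ofReal ((2 * C * ‖w 0‖ * (algConst ρ θ ^ p * ∏ k : Fin p, ‖w k.succ‖)) ^ 2) := by
          have e4 : (4 : ℝ≥0∞) = ENNReal.ofReal 4 := by simp
          rw [e4, ← ofReal_norm, ← ENNReal.ofReal_pow (by linarith),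
            ← ENNReal.ofReal_pow (norm_nonneg _), ← ENNReal.ofReal_mul (by norm_num),
            ← ENNReal.ofReal_mul (by positivity), ← ENNReal.ofReal_mul (by positivity)]
          congr 1; ring
      _ ≤ _ := by
          rw [Fin.prod_univ_succ]
          refine ENNReal.ofReal_le_ofReal ?_
          have hP : 0 ≤ ∏ k : Fin p, ‖w k.succ‖ := Finset.prod_nonneg fun _ _ => norm_nonneg _
          have e : algConst ρ θ ^ (p + 1) * (‖w 0‖ * ∏ k : Fin p, ‖w k.succ‖) =
            algConst ρ θ * ‖w 0‖ * (algConst ρ θ ^ p * ∏ k : Fin p, ‖w k.succ‖) := by ring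
          rw [e]
          gcongr

end Constants

theorem toEll2_surjective (ρ θ : ℝ) : Function.Surjective (toEll2 ρ θ) := by
  intro y
  have h2 : ∀ a, (weight ρ θ a : ℂ) ≠ 0 := fun a => by exact_mod_cast (weight_pos ρ θ a).ne'
  have e : (fun a => (weight ρ θ a : ℂ) * ((weight ρ θ a : ℂ)⁻¹ * y a)) = y := by
    funext a; rw [mul_inv_cancel_left₀ (h2 a)]
  refine ⟨⟨fun a => (weight ρ θ a : ℂ)⁻¹ * y a, ?_⟩, ?_⟩
  · show Memℓp _ 2
    rw [e]; exact y.2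
  · exact Subtype.ext e

instance (ρ θ : ℝ) : CompleteSpace (Gevrey ρ θ) := by
  let e : Gevrey ρ θ ≃ₗᵢ[ℂ] lp (fun _ : ℤ => ℂ) 2 :=
    LinearIsometryEquiv.ofSurjective ⟨toEll2 ρ θ, fun _ => rfl⟩ (toEll2_surjective ρ θ)
  exact e.toIsometryEquiv.completeSpace

end

/-! ### Multilinear maps with bounded coefficients -/

section

variable {ρ θ : ℝ}

/-- The coefficients `f_j` of a homogeneous polynomial `∑_j f_j z_{j_1} ⋯ z_{j_n}`. They are not
required to be symmetric in `j`. -/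
abbrev Coef (n : ℕ) : Type := (Fin n → Mode) → ℂ

theorem summable_coef_mul_prod {n : ℕ} {f : Coef n} {B : ℝ} (hf : ∀ j, ‖f j‖ ≤ B)
    {v : Fin n → Mode → ℂ} (hv : ∀ k, Summable fun o => ‖v k o‖) :
    Summable fun j => ‖f j * ∏ k, v k (j k)‖ := by
  refine Summable.of_nonneg_of_le (fun _ => norm_nonneg _) (fun j => ?_)
    ((summable_norm_prod v hv).1.mul_left B)
  rw [norm_mul]
  gcongr
  exact hf j

theorem enorm_finset_prod {n : ℕ} (x : Fin n → ℂ) : ‖∏ k, x k‖ₑ = ∏ k, ‖x k‖ₑ := by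
  simp_rw [← ofReal_norm]
  rw [norm_prod, ENNReal.ofReal_prod_of_nonneg fun _ _ => norm_nonneg _]

section Multilinear

variable [hI : GevreyIndex ρ θ]

theorem summable_norm_coord (u : Gevrey ρ θ) : Summable fun o : Mode => ‖coord u o‖ :=
  Summable.of_nonneg_of_le (fun _ => norm_nonneg _) (norm_coord_le u)
    ((summable_inv_weight ρ θ).mul_right _)

theorem tsum_norm_coord_le (u : Gevrey ρ θ) : ∑' o : Mode, ‖coord u o‖ ≤ algConst ρ θ * ‖u‖ := by
  calc ∑' o : Mode, ‖coord u o‖ ≤ ∑' o : Mode, (weight ρ θ o.2)⁻¹ * ‖u‖ :=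
        (summable_norm_coord u).tsum_le_tsum (norm_coord_le u)
          ((summable_inv_weight ρ θ).mul_right _)
    _ = (∑' o : Mode, (weight ρ θ o.2)⁻¹) * ‖u‖ := tsum_mul_right
    _ ≤ _ := by gcongr; exact tsum_inv_weight_le ρ θ

theorem summable_norm_monomial {n : ℕ} {f : Coef n} {B : ℝ} (hf : ∀ j, ‖f j‖ ≤ B)
    (w : Fin n → Gevrey ρ θ) : Summable fun j => ‖f j * monomialL ρ θ j w‖ :=
  summable_coef_mul_prod (v := fun k o => coord (w k) o) hf fun k => summable_norm_coord (w k)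

theorem summable_monomial {n : ℕ} {f : Coef n} {B : ℝ} (hf : ∀ j, ‖f j‖ ≤ B)
    (w : Fin n → Gevrey ρ θ) : Summable fun j => f j * monomialL ρ θ j w :=
  (summable_norm_monomial hf w).of_norm

theorem norm_tsum_monomial_le {n : ℕ} {f : Coef n} {B : ℝ} (hB : 0 ≤ B) (hf : ∀ j, ‖f j‖ ≤ B)
    (w : Fin n → Gevrey ρ θ) :
    ‖∑' j, f j * monomialL ρ θ j w‖ ≤ B * algConst ρ θ ^ n * ∏ k, ‖w k‖ := by
  have h2 := summable_norm_prod (fun k o => ‖coord (w k) o‖)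
    (fun k => by simpa using summable_norm_coord (w k))
  have hn : ∀ j : Fin n → Mode, ‖monomialL ρ θ j w‖ = ∏ k, ‖coord (w k) (j k)‖ := fun j => by
    rw [monomialL_apply, norm_prod]
  calc ‖∑' j, f j * monomialL ρ θ j w‖ ≤ ∑' j, ‖f j * monomialL ρ θ j w‖ :=
        norm_tsum_le_tsum_norm (summable_norm_monomial hf w)
    _ ≤ ∑' j : Fin n → Mode, B * ∏ k, ‖coord (w k) (j k)‖ := by
        refine (summable_norm_monomial hf w).tsum_le_tsum (fun j => ?_) (h2.1.of_norm.mul_left B)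
        rw [norm_mul, hn]
        gcongr
        exact hf j
    _ = B * ∏ k, ∑' o, ‖coord (w k) o‖ := by rw [tsum_mul_left, h2.2]
    _ ≤ B * ∏ k, (algConst ρ θ * ‖w k‖) := by
        refine mul_le_mul_of_nonneg_left (Finset.prod_le_prod
          (fun k _ => tsum_nonneg fun o => norm_nonneg _) fun k _ => tsum_norm_coord_le _) hB
    _ = _ := by rw [Finset.prod_mul_distrib, Finset.prod_const, Finset.card_fin]; ring

variable (ρ θ)

open Classical in
/-- The real-multilinear form `w ↦ ∑_j f_j ∏_k (w_k)_{j_k}` of a bounded family of coefficients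
(and `0` for an unbounded one). -/
def formL {n : ℕ} (f : Coef n) : ContinuousMultilinearMap ℝ (fun _ : Fin n => Gevrey ρ θ) ℂ :=
  if h : ∃ B : ℝ, 0 ≤ B ∧ ∀ j, ‖f j‖ ≤ B then
    MultilinearMap.mkContinuous
      { toFun := fun w => ∑' j, f j * monomialL ρ θ j w
        map_update_add' := by
          intro _ w k x y
          obtain ⟨B, -, hf⟩ := h
          rw [← (summable_monomial hf _).tsum_add (summable_monomial hf _)]
          refine tsum_congr fun j => ?_
          rw [← mul_add]
          congr 1
          convert (monomialL ρ θ j).map_update_add w k x y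
        map_update_smul' := by
          intro _ w k c x
          obtain ⟨B, -, hf⟩ := h
          rw [← tsum_const_smul'' c]
          refine tsum_congr fun j => ?_
          rw [← mul_smul_comm]
          congr 1
          convert (monomialL ρ θ j).map_update_smul w k c x }
      (h.choose * algConst ρ θ ^ n)
      (fun w => norm_tsum_monomial_le h.choose_spec.1 h.choose_spec.2 w)
  else 0

variable {ρ θ}

theorem formL_apply {n : ℕ} {f : Coef n} {B : ℝ} (hf : ∀ j, ‖f j‖ ≤ B)
    (w : Fin n → Gevrey ρ θ) : formL ρ θ f w = ∑' j, f j * ∏ k, coord (w k) (j k) := by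
  have h : ∃ B : ℝ, 0 ≤ B ∧ ∀ j, ‖f j‖ ≤ B :=
    ⟨max B 0, le_max_right _ _, fun j => (hf j).trans (le_max_left _ _)⟩
  rw [formL, dif_pos h]; rfl

theorem norm_formL_le {n : ℕ} {f : Coef n} {B : ℝ} (hB : 0 ≤ B) (hf : ∀ j, ‖f j‖ ≤ B) :
    ‖formL ρ θ f‖ ≤ B * algConst ρ θ ^ n := by
  have hA := algConst_pos ρ θ
  refine ContinuousMultilinearMap.opNorm_le_bound (by positivity) fun w => ?_
  rw [formL_apply hf]
  exact norm_tsum_monomial_le hB hf w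

theorem enorm_tsum_vec_le {p : ℕ} {V : Coef p} {B : ℝ} (hB : 0 ≤ B) (hV : ∀ j, ‖V j‖ ≤ B)
    (w : Fin p → Gevrey ρ θ) :
    normSq ρ θ (fun a => ‖∑' j, if mom j = a then V j * monomialL ρ θ j w else 0‖ₑ) ≤
      ENNReal.ofReal ((B * algConst ρ θ ^ p * ∏ k, ‖w k‖) ^ 2) := by
  have hA := algConst_pos ρ θ
  have hP : 0 ≤ ∏ k, ‖w k‖ := Finset.prod_nonneg fun _ _ => norm_nonneg _
  have h1 : ∀ a, ‖∑' j, if mom j = a then V j * monomialL ρ θ j w else 0‖ₑ ≤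
      ENNReal.ofReal B * majorant w a := by
    intro a
    refine enorm_tsum_le_tsum_enorm.trans ?_
    unfold majorant
    rw [← ENNReal.tsum_mul_left]
    refine ENNReal.tsum_le_tsum fun j => ?_
    split_ifs
    · rw [enorm_mul, monomialL_apply, enorm_finset_prod]
      gcongr
      rw [← ofReal_norm]
      exact ENNReal.ofReal_le_ofReal (hV j)
    · simp
  calc _ ≤ normSq ρ θ (fun a => ENNReal.ofReal B * majorant w a) := normSq_mono h1
    _ = ENNReal.ofReal B ^ 2 * normSq ρ θ (majorant w) := by
        unfold normSq
        rw [← ENNReal.tsum_mul_left]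
        exact tsum_congr fun a => by ring
    _ ≤ ENNReal.ofReal B ^ 2 * ENNReal.ofReal ((algConst ρ θ ^ p * ∏ k, ‖w k‖) ^ 2) := by
        gcongr; exact normSq_majorant_le w
    _ = _ := by
        rw [← ENNReal.ofReal_pow hB, ← ENNReal.ofReal_mul (by positivity)]
        congr 1; ring

theorem summable_vec {p : ℕ} {V : Coef p} {B : ℝ} (hV : ∀ j, ‖V j‖ ≤ B)
    (w : Fin p → Gevrey ρ θ) (a : ℤ) :
    Summable fun j => if mom j = a then V j * monomialL ρ θ j w else 0 := by
  refine Summable.of_norm_bounded (summable_norm_monomial hV w) fun j => ?_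
  split_ifs
  · exact le_rfl
  · rw [norm_zero]; exact norm_nonneg _

variable (ρ θ)

open Classical in
/-- The real-multilinear map with values in the Gevrey space whose `a`-th component is
`∑_j V_j ∏_k (w_k)_{j_k}`, summed over the multi-indices `j` of momentum `a`
(and `0` if the coefficients are unbounded). -/
def vecL {p : ℕ} (V : Coef p) :
    ContinuousMultilinearMap ℝ (fun _ : Fin p => Gevrey ρ θ) (Gevrey ρ θ) :=
  if h : ∃ B : ℝ, 0 ≤ B ∧ ∀ j, ‖V j‖ ≤ B then
    have hex := fun w : Fin p → Gevrey ρ θ => exists_gevrey_of_normSq_le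
      (mul_nonneg (mul_nonneg h.choose_spec.1 (pow_nonneg (algConst_pos ρ θ).le p))
        (Finset.prod_nonneg fun k _ => norm_nonneg (w k)))
      (enorm_tsum_vec_le h.choose_spec.1 h.choose_spec.2 w)
    MultilinearMap.mkContinuous
      { toFun := fun w => (hex w).choose
        map_update_add' := by
          intro _ w k x y
          refine Subtype.ext (funext fun a => ?_)
          obtain ⟨B, -, hf⟩ := id h
          refine Eq.trans ?_ (add_apply _ _ a).symm
          simp only [(hex _).choose_spec.1]
          rw [← (summable_vec hf _ a).tsum_add (summable_vec hf _ a)]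
          refine tsum_congr fun j => ?_
          split_ifs
          · rw [← mul_add]
            congr 1
            convert (monomialL ρ θ j).map_update_add w k x y
          · simp
        map_update_smul' := by
          intro _ w k c x
          refine Subtype.ext (funext fun a => ?_)
          refine Eq.trans ?_ (real_smul_apply _ _ a).symm
          simp only [(hex _).choose_spec.1]
          rw [← tsum_mul_left]
          refine tsum_congr fun j => ?_
          split_ifs
          · rw [mul_left_comm]
            congr 1
            rw [← Complex.real_smul]
            convert (monomialL ρ θ j).map_update_smul w k c x
          · simp }
      (h.choose * algConst ρ θ ^ p)
      (fun w => (hex w).choose_spec.2)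
  else 0

variable {ρ θ}

theorem vecL_apply {p : ℕ} {V : Coef p} {B : ℝ} (hV : ∀ j, ‖V j‖ ≤ B)
    (w : Fin p → Gevrey ρ θ) (a : ℤ) :
    vecL ρ θ V w a = ∑' j, if mom j = a then V j * ∏ k, coord (w k) (j k) else 0 := by
  have h : ∃ B : ℝ, 0 ≤ B ∧ ∀ j, ‖V j‖ ≤ B :=
    ⟨max B 0, le_max_right _ _, fun j => (hV j).trans (le_max_left _ _)⟩
  have hex := fun w : Fin p → Gevrey ρ θ => exists_gevrey_of_normSq_le
      (mul_nonneg (mul_nonneg h.choose_spec.1 (pow_nonneg (algConst_pos ρ θ).le p))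
        (Finset.prod_nonneg fun k _ => norm_nonneg (w k)))
      (enorm_tsum_vec_le h.choose_spec.1 h.choose_spec.2 w)
  have : vecL ρ θ V w = (hex w).choose := by
    rw [vecL, dif_pos h]; rfl
  rw [this]
  exact congrFun (hex w).choose_spec.1 a

theorem norm_vecL_le {p : ℕ} {V : Coef p} {B : ℝ} (hB : 0 ≤ B) (hV : ∀ j, ‖V j‖ ≤ B) :
    ‖vecL ρ θ V‖ ≤ B * algConst ρ θ ^ p := by
  have hA := algConst_pos ρ θ
  refine ContinuousMultilinearMap.opNorm_le_bound (by positivity) fun w => ?_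
  have hP : 0 ≤ ∏ k, ‖w k‖ := Finset.prod_nonneg fun _ _ => norm_nonneg _
  obtain ⟨x, hx1, hx2⟩ := exists_gevrey_of_normSq_le
    (mul_nonneg (mul_nonneg hB (pow_nonneg hA.le p)) hP) (enorm_tsum_vec_le hB hV w)
  have : vecL ρ θ V w = x := by
    refine Subtype.ext (funext fun a => (vecL_apply hV w a).trans ?_)
    rw [hx1]; rfl
  rw [this]; exact hx2

end Multilinear

end

/-! ### Multilinear maps on the diagonal -/

section

variable {ρ θ : ℝ}

section Diagonal

variable {E F : Type*} [NormedAddCommGroup E] [NormedSpace ℝ E] [NormedAddCommGroup F]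
  [NormedSpace ℝ F] {p : ℕ}

/-- The derivative of `u ↦ M (u, …, u)`. -/
def diagDeriv (M : ContinuousMultilinearMap ℝ (fun _ : Fin p => E) F) (u : E) : E →L[ℝ] F :=
  (M.linearDeriv fun _ => u).comp (ContinuousLinearMap.pi fun _ => .id ℝ _)

theorem hasFDerivAt_diag (M : ContinuousMultilinearMap ℝ (fun _ : Fin p => E) F) (u : E) :
    HasFDerivAt (fun u => M fun _ => u) (diagDeriv M u) u :=
  (M.hasFDerivAt fun _ => u).comp u
    (ContinuousLinearMap.pi fun _ : Fin p => ContinuousLinearMap.id ℝ E).hasFDerivAt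

theorem contDiff_diag (M : ContinuousMultilinearMap ℝ (fun _ : Fin p => E) F) :
    ContDiff ℝ ∞ fun u => M fun _ => u :=
  M.contDiff.comp (contDiff_pi.2 fun _ => contDiff_id)

theorem diagDeriv_apply (M : ContinuousMultilinearMap ℝ (fun _ : Fin p => E) F) (u v : E) :
    diagDeriv M u v = ∑ i, M (Function.update (fun _ => u) i v) := by
  simp [diagDeriv, ContinuousMultilinearMap.linearDeriv_apply]

theorem norm_diag_le (M : ContinuousMultilinearMap ℝ (fun _ : Fin p => E) F) (u : E) :
    ‖M fun _ => u‖ ≤ ‖M‖ * ‖u‖ ^ p := by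
  simpa using M.le_opNorm fun _ => u

theorem norm_diagDeriv_le (M : ContinuousMultilinearMap ℝ (fun _ : Fin p => E) F) (u : E) :
    ‖diagDeriv M u‖ ≤ p * ‖M‖ * ‖u‖ ^ (p - 1) := by
  refine ContinuousLinearMap.opNorm_le_bound _ (by positivity) fun v => ?_
  rw [diagDeriv_apply]
  refine (norm_sum_le _ _).trans ?_
  have h : ∀ i : Fin p, ‖M (Function.update (fun _ => u) i v)‖ ≤ ‖M‖ * (‖u‖ ^ (p - 1) * ‖v‖) := by
    intro i
    refine (M.le_opNorm _).trans ?_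
    gcongr
    rw [← Finset.mul_prod_erase _ _ (Finset.mem_univ i), Function.update_self, mul_comm]
    gcongr
    rw [Finset.prod_congr rfl (g := fun _ => ‖u‖) fun k hk => by
      rw [Function.update_of_ne (Finset.ne_of_mem_erase hk)]]
    simp
  calc _ ≤ ∑ i : Fin p, ‖M‖ * (‖u‖ ^ (p - 1) * ‖v‖) := Finset.sum_le_sum fun i _ => h i
    _ = _ := by simp; ring

end Diagonal

/-! ### Real polynomials that conserve charge and momentum -/

theorem charge_insertNth {p : ℕ} (i : Fin (p + 1)) (o : Mode) (j : Fin p → Mode) :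
    charge (i.insertNth o j : Fin (p + 1) → Mode) = (o.1 : ℤ) + charge j := by
  simp [charge, Fin.sum_univ_succAbove _ i]

theorem mom_insertNth {p : ℕ} (i : Fin (p + 1)) (o : Mode) (j : Fin p → Mode) :
    mom (i.insertNth o j : Fin (p + 1) → Mode) = (o.1 : ℤ) * o.2 + mom j := by
  simp [mom, Fin.sum_univ_succAbove _ i]

theorem freq_insertNth {p : ℕ} (i : Fin (p + 1)) (o : Mode) (j : Fin p → Mode) :
    freq (i.insertNth o j : Fin (p + 1) → Mode) = (o.1 : ℤ) * o.2 ^ 2 + freq j := by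
  simp [freq, Fin.sum_univ_succAbove _ i]

theorem charge_bar {n : ℕ} (j : Fin n → Mode) : charge (fun k => bar (j k)) = -charge j := by
  simp [charge, bar]

theorem mom_bar {n : ℕ} (j : Fin n → Mode) : mom (fun k => bar (j k)) = -mom j := by
  simp [mom, bar]

theorem freq_bar {n : ℕ} (j : Fin n → Mode) : freq (fun k => bar (j k)) = -freq j := by
  simp [freq, bar]

theorem bar_insertNth {p : ℕ} (i : Fin (p + 1)) (o : Mode) (j : Fin p → Mode) :
    (fun k => bar ((i.insertNth o j : Fin (p + 1) → Mode) k)) =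
      (i.insertNth (bar o) (fun k => bar (j k)) : Fin (p + 1) → Mode) := by
  funext k
  refine Fin.succAboveCases i ?_ (fun k => ?_) k <;> simp

/-- The coefficients of a real homogeneous polynomial whose monomials have zero charge and zero
momentum, with `B` as a bound of the coefficients. -/
structure IsHamCoef {n : ℕ} (f : Coef n) (B : ℝ) : Prop where
  bound : ∀ j, ‖f j‖ ≤ B
  charge_eq : ∀ j, f j ≠ 0 → charge j = 0
  mom_eq : ∀ j, f j ≠ 0 → mom j = 0
  real : ∀ j, f (fun k => bar (j k)) = conj (f j)

theorem IsHamCoef.nonneg {n : ℕ} {f : Coef n} {B : ℝ} (h : IsHamCoef f B) : 0 ≤ B :=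
  (norm_nonneg _).trans (h.bound fun _ => (1, 0))

theorem IsHamCoef.mono {n : ℕ} {f : Coef n} {B B' : ℝ} (h : IsHamCoef f B) (hB : B ≤ B') :
    IsHamCoef f B' := ⟨fun j => (h.bound j).trans hB, h.charge_eq, h.mom_eq, h.real⟩

theorem isHamCoef_zero {n : ℕ} : IsHamCoef (0 : Coef n) 0 :=
  ⟨by simp, by simp, by simp, by simp⟩

theorem IsHamCoef.add {n : ℕ} {f g : Coef n} {A B : ℝ} (hf : IsHamCoef f A) (hg : IsHamCoef g B) :
    IsHamCoef (f + g) (A + B) where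
  bound j := (norm_add_le _ _).trans (add_le_add (hf.bound j) (hg.bound j))
  charge_eq j h := by
    by_cases h1 : f j = 0
    · exact hg.charge_eq j fun h2 => h (by simp [h1, h2])
    · exact hf.charge_eq j h1
  mom_eq j h := by
    by_cases h1 : f j = 0
    · exact hg.mom_eq j fun h2 => h (by simp [h1, h2])
    · exact hf.mom_eq j h1
  real j := by simp [hf.real, hg.real]

theorem IsHamCoef.smul {n : ℕ} {f : Coef n} {A : ℝ} (hf : IsHamCoef f A) (c : ℝ) :
    IsHamCoef (c • f) (|c| * A) where
  bound j := by
    rw [Pi.smul_apply, norm_smul, Real.norm_eq_abs]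
    exact mul_le_mul_of_nonneg_left (hf.bound j) (abs_nonneg _)
  charge_eq j h := hf.charge_eq j fun h2 => h (by simp [h2])
  mom_eq j h := hf.mom_eq j fun h2 => h (by simp [h2])
  real j := by simp [hf.real]

theorem IsHamCoef.sum {n : ℕ} {ι : Type*} (s : Finset ι) {f : ι → Coef n} {A : ι → ℝ}
    (hf : ∀ i ∈ s, IsHamCoef (f i) (A i)) : IsHamCoef (∑ i ∈ s, f i) (∑ i ∈ s, A i) := by
  classical
  induction s using Finset.induction_on with
  | empty => simpa using isHamCoef_zero
  | insert i s hi ih =>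
    rw [Finset.sum_insert hi, Finset.sum_insert hi]
    exact (hf i (Finset.mem_insert_self _ _)).add
      (ih fun k hk => hf k (Finset.mem_insert_of_mem hk))

/-- The partial derivative `∂F/∂z_o` of the polynomial with the coefficients `f`. -/
def partialDeriv {p : ℕ} (f : Coef (p + 1)) (o : Mode) (u : Gevrey ρ θ) : ℂ :=
  ∑ i : Fin (p + 1), ∑' j : Fin p → Mode, f (i.insertNth o j) * ∏ k, coord u (j k)

/-- The coefficients of the `u_a`-components `-i ∂F/∂ū_a` of the Hamiltonian vector field; momentum
conservation recovers `a` from the multi-index. -/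
def hamCoef {p : ℕ} (f : Coef (p + 1)) : Coef p := fun j =>
  -Complex.I * ∑ i : Fin (p + 1), f (i.insertNth (-1, mom j) j)

theorem norm_hamCoef_le {p : ℕ} {f : Coef (p + 1)} {B : ℝ} (hf : ∀ j, ‖f j‖ ≤ B) (j : Fin p → Mode) :
    ‖hamCoef f j‖ ≤ (p + 1) * B := by
  rw [hamCoef, norm_mul, norm_neg, Complex.norm_I, one_mul]
  refine (norm_sum_le _ _).trans ((Finset.sum_le_sum fun i _ => hf _).trans ?_)
  simp

theorem prod_coord_bar {p : ℕ} (u : Gevrey ρ θ) (j : Fin p → Mode) :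
    ∏ k, coord u (bar (j k)) = conj (∏ k, coord u (j k)) := by
  rw [map_prod]
  exact Finset.prod_congr rfl fun k _ => coord_bar u _

/-- Conjugation of all the entries of a multi-index. -/
def barEquiv (p : ℕ) : (Fin p → Mode) ≃ (Fin p → Mode) where
  toFun j := fun k => bar (j k)
  invFun j := fun k => bar (j k)
  left_inv j := by simp
  right_inv j := by simp

theorem partialDeriv_bar {p : ℕ} {f : Coef (p + 1)} {B : ℝ} (hf : IsHamCoef f B) (o : Mode)
    (u : Gevrey ρ θ) : partialDeriv f (bar o) u = conj (partialDeriv f o u) := by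
  unfold partialDeriv
  rw [map_sum]
  refine Finset.sum_congr rfl fun i _ => ?_
  rw [Complex.conj_tsum, ← (barEquiv p).tsum_eq]
  refine tsum_congr fun j => ?_
  simp only [barEquiv, Equiv.coe_fn_mk]
  rw [prod_coord_bar, ← bar_insertNth, hf.real, map_mul]

section

variable [hI : GevreyIndex ρ θ]

variable (ρ θ) in
/-- The Hamiltonian vector field of the polynomial with the coefficients `f`. -/
def hamVec {p : ℕ} (f : Coef (p + 1)) (u : Gevrey ρ θ) : Gevrey ρ θ :=
  vecL ρ θ (hamCoef f) fun _ => u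

variable (ρ θ) in
/-- The value at `u` of the polynomial with the coefficients `f`. -/
def evalC {n : ℕ} (f : Coef n) (u : Gevrey ρ θ) : ℂ := formL ρ θ f fun _ => u

theorem hamVec_apply {p : ℕ} {f : Coef (p + 1)} {B : ℝ} (hf : IsHamCoef f B) (u : Gevrey ρ θ)
    (a : ℤ) : hamVec ρ θ f u a = -Complex.I * partialDeriv f (-1, a) u := by
  have hs : ∀ i : Fin (p + 1), Summable fun j : Fin p → Mode =>
      f (i.insertNth (-1, a) j) * ∏ k, coord u (j k) := fun i =>
    summable_monomial (f := fun j => f (i.insertNth (-1, a) j)) (fun j => hf.bound _) fun _ => u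
  rw [hamVec, vecL_apply (norm_hamCoef_le hf.bound), partialDeriv,
    ← Summable.tsum_finsetSum fun i _ => hs i, ← tsum_mul_left]
  refine tsum_congr fun j => ?_
  split_ifs with h
  · rw [hamCoef, h, mul_assoc, Finset.sum_mul]
  · have : ∀ i : Fin (p + 1), f (i.insertNth (-1, a) j) = 0 := by
      intro i
      by_contra hne
      have := hf.mom_eq _ hne
      rw [mom_insertNth] at this
      apply h
      push_cast at this
      linarith
    simp [this]

/-- The coordinates `-i δ ∂F/∂z_{(-δ, a)}` of the Hamiltonian vector field; for `δ = -1` this is the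
reality of `F`. -/
theorem coord_hamVec {p : ℕ} {f : Coef (p + 1)} {B : ℝ} (hf : IsHamCoef f B) (u : Gevrey ρ θ)
    (o : Mode) : coord (hamVec ρ θ f u) o =
      -Complex.I * ((o.1 : ℤ) : ℂ) * partialDeriv f (bar o) u := by
  obtain ⟨d, a⟩ := o
  rcases Int.units_eq_one_or d with rfl | rfl
  · rw [coord_one, hamVec_apply hf]; simp [bar]
  · rw [coord_neg_one, hamVec_apply hf]
    have : ((-1, a) : Mode) = bar (1, a) := rfl
    rw [this, partialDeriv_bar hf, bar_bar]
    simp [bar]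

theorem conj_evalC {n : ℕ} {f : Coef n} {B : ℝ} (hf : IsHamCoef f B) (u : Gevrey ρ θ) :
    conj (evalC ρ θ f u) = evalC ρ θ f u := by
  rw [evalC, formL_apply hf.bound, Complex.conj_tsum, ← (barEquiv n).tsum_eq]
  refine tsum_congr fun j => ?_
  simp only [barEquiv, Equiv.coe_fn_mk]
  rw [prod_coord_bar, hf.real, map_mul]; simp

theorem evalC_eq_re {n : ℕ} {f : Coef n} {B : ℝ} (hf : IsHamCoef f B) (u : Gevrey ρ θ) :
    evalC ρ θ f u = ((evalC ρ θ f u).re : ℂ) :=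
  (Complex.conj_eq_iff_re.1 (conj_evalC hf u)).symm

/-- The sum over the multi-indices of a polynomial, one of whose factors is replaced by an arbitrary
summable family. -/
theorem tsum_replace {p : ℕ} {f : Coef (p + 1)} {B : ℝ} (hf : ∀ j, ‖f j‖ ≤ B)
    (u : Gevrey ρ θ) {v : Mode → ℂ} (hv : Summable fun o => ‖v o‖) (i : Fin (p + 1)) :
    (Summable fun j => f j * (v (j i) * ∏ k, coord u (j (i.succAbove k)))) ∧
    ∑' j, f j * (v (j i) * ∏ k, coord u (j (i.succAbove k))) =
      ∑' o, v o * ∑' j : Fin p → Mode, f (i.insertNth o j) * ∏ k, coord u (j k) := by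
  let F : Fin (p + 1) → Mode → ℂ := i.insertNth v fun _ => coord u
  have hF : ∀ k, Summable fun o => ‖F k o‖ := by
    intro k
    refine Fin.succAboveCases i ?_ (fun k => ?_) k
    · simpa [F] using hv
    · simpa [F] using summable_norm_coord u
  have h1 := (summable_coef_mul_prod hf hF).of_norm
  have h2 : ∀ j : Fin (p + 1) → Mode, f j * ∏ k, F k (j k) =
      f j * (v (j i) * ∏ k, coord u (j (i.succAbove k))) := by
    intro j
    rw [Fin.prod_univ_succAbove _ i]
    simp [F]
  simp_rw [h2] at h1
  refine ⟨h1, ?_⟩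
  rw [tsum_insertNth h1 i]
  refine tsum_congr fun o => ?_
  rw [← tsum_mul_left]
  refine tsum_congr fun j => ?_
  simp only [Fin.insertNth_apply_same, Fin.insertNth_apply_succAbove]
  ring

theorem summable_mul_partial {p : ℕ} {f : Coef (p + 1)} {B : ℝ} (hf : ∀ j, ‖f j‖ ≤ B)
    (u : Gevrey ρ θ) {v : Mode → ℂ} (hv : Summable fun o => ‖v o‖) (i : Fin (p + 1)) :
    Summable fun o => v o * ∑' j : Fin p → Mode, f (i.insertNth o j) * ∏ k, coord u (j k) := by
  have hB : 0 ≤ B := (norm_nonneg _).trans (hf fun _ => (1, 0))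
  refine Summable.of_norm_bounded (hv.mul_right (B * algConst ρ θ ^ p * ∏ k : Fin p, ‖u‖)) fun o => ?_
  rw [norm_mul]
  gcongr
  exact norm_tsum_monomial_le hB (fun j => hf (i.insertNth o j)) fun _ => u

theorem tsum_mul_partialDeriv {p : ℕ} {f : Coef (p + 1)} {B : ℝ} (hf : ∀ j, ‖f j‖ ≤ B)
    (u : Gevrey ρ θ) {v : Mode → ℂ} (hv : Summable fun o => ‖v o‖) :
    ∑' o, v o * partialDeriv f o u =
      ∑ i : Fin (p + 1), ∑' j, f j * (v (j i) * ∏ k, coord u (j (i.succAbove k))) := by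
  unfold partialDeriv
  simp_rw [Finset.mul_sum]
  rw [Summable.tsum_finsetSum fun i _ => summable_mul_partial hf u hv i]
  exact Finset.sum_congr rfl fun i _ => (tsum_replace hf u hv i).2.symm

theorem linearDeriv_formL {p : ℕ} {f : Coef (p + 1)} {B : ℝ} (hf : ∀ j, ‖f j‖ ≤ B)
    (u v : Gevrey ρ θ) :
    ((formL ρ θ f).linearDeriv fun _ => u) (fun _ => v) =
      ∑' o, coord v o * partialDeriv f o u := by
  rw [tsum_mul_partialDeriv hf u (summable_norm_coord v),
    ContinuousMultilinearMap.linearDeriv_apply]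
  refine Finset.sum_congr rfl fun i _ => ?_
  rw [formL_apply hf]
  refine tsum_congr fun j => ?_
  rw [Fin.prod_univ_succAbove _ i]
  simp

/-- The derivative of the polynomial with the coefficients `f`. -/
def evalDeriv {n : ℕ} (f : Coef n) (u : Gevrey ρ θ) : Gevrey ρ θ →L[ℝ] ℂ :=
  diagDeriv (formL ρ θ f) u

theorem hasFDerivAt_evalC {n : ℕ} (f : Coef n) (u : Gevrey ρ θ) :
    HasFDerivAt (evalC ρ θ f) (evalDeriv f u) u :=
  hasFDerivAt_diag _ u

theorem evalDeriv_apply {p : ℕ} {f : Coef (p + 1)} {B : ℝ} (hf : ∀ j, ‖f j‖ ≤ B)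
    (u v : Gevrey ρ θ) : evalDeriv f u v = ∑' o, coord v o * partialDeriv f o u :=
  linearDeriv_formL hf u v

/-- The Hamiltonian vector field represents the derivative of a polynomial through the symplectic form. -/
theorem evalDeriv_eq_sympl {p : ℕ} {f : Coef (p + 1)} {B : ℝ} (hf : IsHamCoef f B)
    (u v : Gevrey ρ θ) : evalDeriv f u v = sympl v (hamVec ρ θ f u) := by
  have hs : Summable fun o => coord v o * partialDeriv f o u := by
    unfold partialDeriv
    simp_rw [Finset.mul_sum]
    exact summable_sum fun i _ => summable_mul_partial hf.bound u (summable_norm_coord v) i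
  have h1 : Summable fun a : ℤ => coord v (1, a) * partialDeriv f (1, a) u := hs.prod_factor 1
  have h2 : Summable fun a : ℤ => coord v (-1, a) * partialDeriv f (-1, a) u := hs.prod_factor (-1)
  rw [evalDeriv_apply hf.bound, units_tsum hs, sympl, ← tsum_mul_left, ← h1.tsum_add h2]
  refine tsum_congr fun a => ?_
  have e1 : partialDeriv f (1, a) u = conj (partialDeriv f (-1, a) u) := by
    rw [← partialDeriv_bar hf]; simp [bar]
  rw [hamVec_apply hf, coord_one, coord_neg_one, e1]
  simp only [map_mul, map_neg, Complex.conj_I, neg_neg]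
  linear_combination (v a * conj (partialDeriv f (-1, a) u) +
    conj (v a) * partialDeriv f (-1, a) u) * Complex.I_sq

end

/-! ### Poisson brackets -/

/-- The only mode `o` for which adding `o` to `j` can give charge and momentum zero. -/
def complMode {p : ℕ} (j : Fin p → Mode) : Mode :=
  let d : ℤˣ := if charge j = -1 then 1 else -1
  (d, -((d : ℤ) * mom j))

theorem eq_complMode {p : ℕ} {f : Coef (p + 1)} {B : ℝ} (hf : IsHamCoef f B) {i : Fin (p + 1)}
    {o : Mode} {j : Fin p → Mode} (h : f (i.insertNth o j) ≠ 0) : o = complMode j := by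
  have h1 := hf.charge_eq _ h
  have h2 := hf.mom_eq _ h
  rw [charge_insertNth] at h1
  rw [mom_insertNth] at h2
  obtain ⟨d, a⟩ := o
  rcases Int.units_eq_one_or d with rfl | rfl
  · have : charge j = -1 := by push_cast at h1; linarith
    simp only [complMode, this, if_true]
    push_cast at h2
    refine Prod.ext rfl ?_
    push_cast; linarith
  · have : charge j ≠ -1 := by push_cast at h1; intro h; linarith
    simp only [complMode, this, if_false]
    push_cast at h2
    refine Prod.ext rfl ?_
    push_cast; linarith

/-- The first `p` entries of a multi-index of length `p + q`. -/
def leftPart {p q N : ℕ} (h : p + q = N) (j : Fin N → Mode) : Fin p → Mode :=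
  fun x => j (Fin.cast h (Fin.castAdd q x))

/-- The last `q` entries of a multi-index of length `p + q`. -/
def rightPart {p q N : ℕ} (h : p + q = N) (j : Fin N → Mode) : Fin q → Mode :=
  fun y => j (Fin.cast h (Fin.natAdd p y))

/-- The coefficients of the Poisson bracket `-i ∑_a (∂F/∂u_a ∂G/∂ū_a - ∂F/∂ū_a ∂G/∂u_a)`: each
position of `f` is contracted with each position of `g`, and the contracted mode is determined by
charge and momentum conservation. -/
def bracket {p q N : ℕ} (h : p + q = N) (f : Coef (p + 1)) (g : Coef (q + 1)) : Coef N := fun j =>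
  -Complex.I * (((complMode (leftPart h j)).1 : ℤ) : ℂ) *
    ∑ i : Fin (p + 1), ∑ i' : Fin (q + 1),
      f (i.insertNth (complMode (leftPart h j)) (leftPart h j)) *
        g (i'.insertNth (bar (complMode (leftPart h j))) (rightPart h j))

theorem norm_units (d : ℤˣ) : ‖((d : ℤ) : ℂ)‖ = 1 := by
  rcases Int.units_eq_one_or d with rfl | rfl <;> simp

theorem split_sum {M : Type*} [AddCommMonoid M] {p q N : ℕ} (h : p + q = N) (F : Fin N → M) :
    ∑ k, F k = ∑ x, F (Fin.cast h (Fin.castAdd q x)) + ∑ y, F (Fin.cast h (Fin.natAdd p y)) := by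
  subst h
  simp [Fin.sum_univ_add]

theorem charge_eq_add {p q N : ℕ} (h : p + q = N) (j : Fin N → Mode) :
    charge j = charge (leftPart h j) + charge (rightPart h j) :=
  split_sum h fun k => ((j k).1 : ℤ)

theorem mom_eq_add {p q N : ℕ} (h : p + q = N) (j : Fin N → Mode) :
    mom j = mom (leftPart h j) + mom (rightPart h j) :=
  split_sum h fun k => ((j k).1 : ℤ) * (j k).2

theorem complMode_bar {p : ℕ} {j : Fin p → Mode} (h : charge j = 1 ∨ charge j = -1) :
    complMode (fun k => bar (j k)) = bar (complMode j) := by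
  have hc := charge_bar j
  have hm := mom_bar j
  rcases h with h | h
  · simp only [complMode, hc, hm, h]; simp [bar]
  · simp only [complMode, hc, hm, h]; simp [bar]

/-- Poisson brackets preserve the conservation laws and reality; there are `(p + 1) (q + 1)`
contractions. -/
theorem isHamCoef_bracket {p q N : ℕ} (h : p + q = N) {f : Coef (p + 1)} {g : Coef (q + 1)}
    {A B : ℝ} (hf : IsHamCoef f A) (hg : IsHamCoef g B) :
    IsHamCoef (bracket h f g) ((p + 1) * (q + 1) * (A * B)) where
  bound j := by
    rw [bracket, norm_mul, norm_mul, norm_neg, Complex.norm_I, norm_units, one_mul, one_mul]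
    have : ∑ i : Fin (p + 1), ∑ i' : Fin (q + 1), A * B = (p + 1) * (q + 1) * (A * B) := by
      simp; ring
    rw [← this]
    refine (norm_sum_le _ _).trans (Finset.sum_le_sum fun i _ => ?_)
    refine (norm_sum_le _ _).trans (Finset.sum_le_sum fun i' _ => ?_)
    rw [norm_mul]
    exact mul_le_mul (hf.bound _) (hg.bound _) (norm_nonneg _) hf.nonneg
  charge_eq j hne := by
    rw [bracket] at hne
    have hne2 := right_ne_zero_of_mul hne
    obtain ⟨i, -, hi⟩ := Finset.exists_ne_zero_of_sum_ne_zero hne2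
    obtain ⟨i', -, hi'⟩ := Finset.exists_ne_zero_of_sum_ne_zero hi
    have h1 := hf.charge_eq _ (left_ne_zero_of_mul hi')
    have h2 := hg.charge_eq _ (right_ne_zero_of_mul hi')
    rw [charge_insertNth] at h1 h2
    rw [charge_eq_add h]
    simp only [bar, Units.val_neg] at h2
    linarith
  mom_eq j hne := by
    rw [bracket] at hne
    have hne2 := right_ne_zero_of_mul hne
    obtain ⟨i, -, hi⟩ := Finset.exists_ne_zero_of_sum_ne_zero hne2
    obtain ⟨i', -, hi'⟩ := Finset.exists_ne_zero_of_sum_ne_zero hi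
    have h1 := hf.mom_eq _ (left_ne_zero_of_mul hi')
    have h2 := hg.mom_eq _ (right_ne_zero_of_mul hi')
    rw [mom_insertNth] at h1 h2
    rw [mom_eq_add h]
    simp only [bar, Units.val_neg] at h2
    linarith
  real j := by
    have el : leftPart h (fun k => bar (j k)) = fun k => bar (leftPart h j k) := rfl
    have er : rightPart h (fun k => bar (j k)) = fun k => bar (rightPart h j k) := rfl
    unfold bracket
    rw [el, er]
    set j₁ : Fin p → Mode := leftPart h j
    set j₂ : Fin q → Mode := rightPart h j
    by_cases hc : charge j₁ = 1 ∨ charge j₁ = -1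
    · rw [complMode_bar hc]
      simp_rw [← bar_insertNth, hf.real, hg.real]
      simp [map_sum, bar]
    · have hz : ∀ (o : Mode) (i : Fin (p + 1)), f (i.insertNth o j₁) = 0 := by
        intro o i
        by_contra hne
        have := hf.charge_eq _ hne
        rw [charge_insertNth] at this
        rcases Int.units_eq_one_or o.1 with ho | ho <;> rw [ho] at this <;> push_cast at this
        · exact hc (Or.inr (by linarith))
        · exact hc (Or.inl (by linarith))
      have hz' : ∀ (o : Mode) (i : Fin (p + 1)), f (i.insertNth o fun k => bar (j₁ k)) = 0 := by
        intro o i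
        rw [← bar_bar o, ← bar_insertNth, hf.real, hz, map_zero]
      simp [hz, hz']

/-- The derivative of `F` along the Hamiltonian vector field of `G` is `{F, G}`. -/
theorem evalDeriv_hamVec [hI : GevreyIndex ρ θ] {p q N : ℕ} (h : p + q = N) {f : Coef (p + 1)}
    {g : Coef (q + 1)} {A B : ℝ} (hf : IsHamCoef f A) (hg : IsHamCoef g B) (u : Gevrey ρ θ) :
    evalDeriv f u (hamVec ρ θ g u) = evalC ρ θ (bracket h f g) u := by
  have hsf : ∀ (i : Fin (p + 1)) (o : Mode), Summable fun j : Fin p → Mode =>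
      ‖f (i.insertNth o j) * ∏ k, coord u (j k)‖ := fun i o =>
    summable_norm_monomial (f := fun j => f (i.insertNth o j)) (fun j => hf.bound _) fun _ => u
  have hsg : ∀ (i : Fin (q + 1)) (o : Mode), Summable fun j : Fin q → Mode =>
      ‖g (i.insertNth o j) * ∏ k, coord u (j k)‖ := fun i o =>
    summable_norm_monomial (f := fun j => g (i.insertNth o j)) (fun j => hg.bound _) fun _ => u
  -- the terms of one contraction, before the contracted mode `o` is identified
  let T : Fin (p + 1) → Fin (q + 1) → Mode → (Fin p → Mode) × (Fin q → Mode) → ℂ :=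
    fun i i' o x => (-Complex.I * ((o.1 : ℤ) : ℂ)) *
      ((f (i.insertNth o x.1) * ∏ k, coord u (x.1 k)) *
        (g (i'.insertNth (bar o) x.2) * ∏ k, coord u (x.2 k)))
  have hT0 : ∀ i i' o x, o ≠ complMode x.1 → T i i' o x = 0 := by
    intro i i' o x ho
    have : f (i.insertNth o x.1) = 0 := by
      by_contra hne; exact ho (eq_complMode hf hne)
    simp [T, this]
  have hTs : ∀ i i', Summable fun x : (Fin p → Mode) × (Fin q → Mode) =>
      T i i' (complMode x.1) x := by
    intro i i'
    have h1 := (summable_norm_prod (fun (_ : Fin p) o => coord u o)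
      (fun _ => summable_norm_coord u)).1
    have h2 := (summable_norm_prod (fun (_ : Fin q) o => coord u o)
      (fun _ => summable_norm_coord u)).1
    refine Summable.of_norm_bounded ((Summable.mul_norm h1 h2).mul_left (A * B)) fun x => ?_
    simp only [T]
    rw [norm_mul, norm_mul, norm_neg, Complex.norm_I, norm_units, one_mul, one_mul, norm_mul,
      norm_mul, norm_mul, norm_mul]
    have a1 := hf.bound (i.insertNth (complMode x.1) x.1)
    have a2 := hg.bound (i'.insertNth (bar (complMode x.1)) x.2)
    have hA := hf.nonneg
    calc _ = (‖f (i.insertNth (complMode x.1) x.1)‖ * ‖g (i'.insertNth (bar (complMode x.1)) x.2)‖) *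
        (‖∏ k, coord u (x.1 k)‖ * ‖∏ k, coord u (x.2 k)‖) := by ring
      _ ≤ _ := by gcongr
  have hTp : ∀ i i', Summable fun y : Mode × ((Fin p → Mode) × (Fin q → Mode)) =>
      T i i' y.1 y.2 := by
    intro i i'
    let e : (Fin p → Mode) × (Fin q → Mode) → Mode × ((Fin p → Mode) × (Fin q → Mode)) :=
      fun x => (complMode x.1, x)
    have he : Function.Injective e := fun x y hxy => (Prod.ext_iff.1 hxy).2
    refine (he.summable_iff ?_).1 (hTs i i')
    rintro ⟨o, x⟩ hx
    refine hT0 i i' o x fun ho => hx ⟨x, ?_⟩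
    rw [ho]
  have hTe : ∀ i i', ∑' o, (-Complex.I * ((o.1 : ℤ) : ℂ)) *
      ((∑' j : Fin p → Mode, f (i.insertNth o j) * ∏ k, coord u (j k)) *
        ∑' j : Fin q → Mode, g (i'.insertNth (bar o) j) * ∏ k, coord u (j k)) =
      ∑' x : (Fin p → Mode) × (Fin q → Mode), T i i' (complMode x.1) x := by
    intro i i'
    have e1 : ∑' x : (Fin p → Mode) × (Fin q → Mode), T i i' (complMode x.1) x =
        ∑' x : (Fin p → Mode) × (Fin q → Mode), ∑' o, T i i' o x :=
      tsum_congr fun x => (tsum_eq_single _ fun o ho => hT0 i i' o x ho).symm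
    have e2 := Summable.tsum_comm (f := fun o x => T i i' o x) (hTp i i')
    rw [e1, e2]
    refine tsum_congr fun o => ?_
    rw [tsum_mul_tsum_of_summable_norm (hsf i o) (hsg i' (bar o)), ← tsum_mul_left]
  have hTo : ∀ (i : Fin (p + 1)) (i' : Fin (q + 1)), Summable fun o : Mode => (-Complex.I * ((o.1 : ℤ) : ℂ)) *
      ((∑' j : Fin p → Mode, f (i.insertNth o j) * ∏ k, coord u (j k)) *
        ∑' j : Fin q → Mode, g (i'.insertNth (bar o) j) * ∏ k, coord u (j k)) := by
    intro i i'
    refine (hTp i i').prod.congr fun o => ?_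
    rw [tsum_mul_tsum_of_summable_norm (hsf i o) (hsg i' (bar o)), ← tsum_mul_left]
  -- the left-hand side
  rw [evalDeriv_apply hf.bound]
  have hL : ∀ o, coord (hamVec ρ θ g u) o * partialDeriv f o u =
      ∑ i : Fin (p + 1), ∑ i' : Fin (q + 1), (-Complex.I * ((o.1 : ℤ) : ℂ)) *
      ((∑' j : Fin p → Mode, f (i.insertNth o j) * ∏ k, coord u (j k)) *
        ∑' j : Fin q → Mode, g (i'.insertNth (bar o) j) * ∏ k, coord u (j k)) := by
    intro o
    rw [coord_hamVec hg, partialDeriv, partialDeriv, mul_assoc, mul_comm (∑ i, _) (∑ i, _),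
      Finset.sum_mul_sum, Finset.mul_sum]
    simp_rw [Finset.mul_sum]
  simp_rw [hL]
  rw [Summable.tsum_finsetSum fun i _ => summable_sum fun i' _ => hTo i i']
  simp_rw [Summable.tsum_finsetSum fun i' _ => hTo _ i', hTe]
  -- the right-hand side
  rw [evalC, formL_apply (isHamCoef_bracket h hf hg).bound]
  subst h
  rw [← (Fin.appendEquiv p q).tsum_eq]
  have hR : ∀ x : (Fin p → Mode) × (Fin q → Mode),
      bracket rfl f g (Fin.appendEquiv p q x) * ∏ k, coord u (Fin.appendEquiv p q x k) =
      ∑ i : Fin (p + 1), ∑ i' : Fin (q + 1), T i i' (complMode x.1) x := by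
    intro x
    have el : leftPart rfl (Fin.appendEquiv p q x) = x.1 := by
      funext k; simp [leftPart, Fin.appendEquiv]
    have er : rightPart rfl (Fin.appendEquiv p q x) = x.2 := by
      funext k; simp [rightPart, Fin.appendEquiv]
    simp only [bracket, el, er, T]
    simp only [Fin.appendEquiv, Equiv.coe_fn_mk, Fin.append_left,
      Fin.append_right, Fin.prod_univ_add]
    simp_rw [← Finset.mul_sum]
    rw [mul_assoc]
    congr 1
    rw [Finset.sum_mul]
    refine Finset.sum_congr rfl fun i _ => ?_
    rw [← Finset.sum_mul]
    ring
  simp_rw [hR]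
  rw [Summable.tsum_finsetSum fun i _ => summable_sum fun i' _ => hTs i i']
  simp_rw [Summable.tsum_finsetSum fun i' _ => hTs _ i']

end

/-! ### The symplectic form and the quadratic Hamiltonian -/

section

variable {ρ θ : ℝ}

theorem mul_memℓp {m : ℤ → ℝ} {C : ℝ} (hm : ∀ a, |m a| ≤ C * weight ρ θ a) (u : Gevrey ρ θ) :
    Memℓp (fun a => (m a : ℂ) * u a) 2 := by
  have h : Memℓp (fun a => ((C : ℂ) • (toEll2 ρ θ u : ∀ _ : ℤ, ℂ)) a) 2 := (toEll2 ρ θ u).2.const_smul _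
  refine memℓp_gen ?_
  refine Summable.of_nonneg_of_le (fun _ => by positivity) (fun a => ?_)
    ((memℓp_gen_iff (by norm_num)).1 h)
  have h3 : (toEll2 ρ θ u : ∀ _ : ℤ, ℂ) a = (weight ρ θ a : ℂ) * u a := rfl
  simp only [ENNReal.toReal_ofNat, Real.rpow_ofNat, Pi.smul_apply, smul_eq_mul]
  rw [h3, ← mul_assoc, norm_mul, norm_mul, Complex.norm_real]
  have : |m a| ≤ ‖(C : ℂ) * (weight ρ θ a : ℂ)‖ := by
    rw [norm_mul, Complex.norm_real, Complex.norm_real, ← norm_mul]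
    exact (hm a).trans (le_abs_self _)
  gcongr
  exact this

/-- Multiplication of the coefficients by a real sequence, as a map into `ℓ²`. -/
def mulLin (m : ℤ → ℝ) {C : ℝ} (hm : ∀ a, |m a| ≤ C * weight ρ θ a) :
    Gevrey ρ θ →ₗ[ℝ] lp (fun _ : ℤ => ℂ) 2 where
  toFun u := ⟨fun a => (m a : ℂ) * u a, mul_memℓp hm u⟩
  map_add' u v := by
    apply Subtype.ext; funext a
    exact mul_add _ (u a) (v a)
  map_smul' c u := by
    apply Subtype.ext; funext a
    exact mul_left_comm _ (c : ℂ) (u a)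

theorem norm_mulLin_le (m : ℤ → ℝ) {C : ℝ} (hC : 0 ≤ C) (hm : ∀ a, |m a| ≤ C * weight ρ θ a)
    (u : Gevrey ρ θ) : ‖mulLin m hm u‖ ≤ C * ‖u‖ := by
  have h : ‖mulLin m hm u‖ ≤ ‖(C : ℂ) • toEll2 ρ θ u‖ := by
    refine lp.norm_mono (by norm_num) fun a => ?_
    have h1 : (mulLin m hm u : ∀ _ : ℤ, ℂ) a = (m a : ℂ) * u a := rfl
    have h3 : ((C : ℂ) • toEll2 ρ θ u : lp (fun _ : ℤ => ℂ) 2) a = (C : ℂ) * ((weight ρ θ a : ℂ) * u a) := rfl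
    rw [h1, h3, ← mul_assoc, norm_mul, norm_mul, Complex.norm_real, norm_mul, Complex.norm_real,
      Complex.norm_real, ← norm_mul]
    gcongr
    exact (hm a).trans (le_abs_self _)
  refine h.trans (le_of_eq ?_)
  rw [norm_smul, Complex.norm_real, Real.norm_of_nonneg hC]
  rfl

/-- The form `(v, w) ↦ ∑_a m_a² v̄_a w_a`. -/
def innerL (m : ℤ → ℝ) {C : ℝ} (hC : 0 ≤ C) (hm : ∀ a, |m a| ≤ C * weight ρ θ a) :
    Gevrey ρ θ →L[ℝ] Gevrey ρ θ →L[ℝ] ℂ :=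
  LinearMap.mkContinuous₂
    (LinearMap.mk₂ ℝ (fun v w => ⟪mulLin m hm v, mulLin m hm w⟫_ℂ)
      (fun v v' w => by rw [map_add, inner_add_left])
      (fun c v w => by
        have h : mulLin m hm (c • v) = (c : ℂ) • mulLin m hm v := map_smul (mulLin m hm) c v
        rw [h, inner_smul_left]; simp)
      (fun v w w' => by rw [map_add, inner_add_right])
      (fun c v w => by
        have h : mulLin m hm (c • w) = (c : ℂ) • mulLin m hm w := map_smul (mulLin m hm) c w
        rw [h, inner_smul_right]; simp))
    (C * C) (fun v w => by
      refine (norm_inner_le_norm (𝕜 := ℂ) (mulLin m hm v) (mulLin m hm w)).trans ?_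
      have h1 := norm_mulLin_le m hC hm v
      have h2 := norm_mulLin_le m hC hm w
      calc _ ≤ (C * ‖v‖) * (C * ‖w‖) := by gcongr
        _ = _ := by ring)

theorem hasSum_innerL (m : ℤ → ℝ) {C : ℝ} (hC : 0 ≤ C) (hm : ∀ a, |m a| ≤ C * weight ρ θ a)
    (v w : Gevrey ρ θ) :
    HasSum (fun a : ℤ => (m a : ℂ) ^ 2 * (conj (v a) * w a)) (innerL m hC hm v w) := by
  have h := lp.hasSum_inner (𝕜 := ℂ) (G := fun _ : ℤ => ℂ) (mulLin m hm v) (mulLin m hm w)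
  have e : ∀ a : ℤ, inner ℂ ((mulLin m hm v : ∀ _ : ℤ, ℂ) a) ((mulLin m hm w : ∀ _ : ℤ, ℂ) a) =
      (m a : ℂ) ^ 2 * (conj (v a) * w a) := by
    intro a
    have h1 : (mulLin m hm v : ∀ _ : ℤ, ℂ) a = (m a : ℂ) * v a := rfl
    have h2 : (mulLin m hm w : ∀ _ : ℤ, ℂ) a = (m a : ℂ) * w a := rfl
    rw [h1, h2, RCLike.inner_apply, map_mul, Complex.conj_ofReal]
    ring
  simp_rw [e] at h
  exact h

section

variable [hI : GevreyIndex ρ θ]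

theorem one_le_mul_weight (ρ θ : ℝ) [hI : GevreyIndex ρ θ] (a : ℤ) :
    |(1 : ℤ → ℝ) a| ≤ 1 * weight ρ θ a := by
  simpa using one_le_weight hI.rho_pos a

/-- The quadratic form `H₀` is continuous on the Gevrey space because the weight dominates `|a|`. -/
theorem exists_abs_le_weight (ρ θ : ℝ) [hI : GevreyIndex ρ θ] :
    ∃ C : ℝ, 0 ≤ C ∧ ∀ a : ℤ, |(a : ℝ)| ≤ C * weight ρ θ a := by
  have h := summable_pow_mul_exp hI.rho_pos hI.theta_pos 1
  refine ⟨∑' a : ℤ, |(a : ℝ)| ^ 1 * Real.exp (-(ρ * |(a : ℝ)| ^ θ)),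
    tsum_nonneg fun a => by positivity, fun a => ?_⟩
  have h1 := h.le_tsum a fun b _ => by positivity
  rw [← rpow_exp_neg, ← div_eq_mul_inv, div_le_iff₀ (weight_pos ρ θ a), pow_one] at h1
  exact h1

variable (ρ θ) in
/-- The symplectic form as a continuous bilinear map. -/
def symplL : Gevrey ρ θ →L[ℝ] Gevrey ρ θ →L[ℝ] ℂ :=
  (-Complex.I) • ((innerL 1 zero_le_one (one_le_mul_weight ρ θ)).flip -
    innerL 1 zero_le_one (one_le_mul_weight ρ θ))

theorem symplL_apply (v w : Gevrey ρ θ) : symplL ρ θ v w = sympl v w := by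
  have h1 := hasSum_innerL 1 zero_le_one (one_le_mul_weight ρ θ) v w
  have h2 := hasSum_innerL 1 zero_le_one (one_le_mul_weight ρ θ) w v
  have h3 := (h2.sub h1).tsum_eq
  simp only [symplL, smul_apply, sub_apply,
    ContinuousLinearMap.flip_apply, smul_eq_mul]
  rw [sympl, ← h3]
  congr 1
  refine tsum_congr fun a => ?_
  simp; ring

theorem sympl_swap (v w : Gevrey ρ θ) : sympl w v = -sympl v w := by
  simp only [← symplL_apply, symplL, smul_apply, sub_apply,
    ContinuousLinearMap.flip_apply, smul_eq_mul]
  ring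

variable (ρ θ) in
/-- The form `(v, w) ↦ ∑_a a² v̄_a w_a`. -/
def freqForm : Gevrey ρ θ →L[ℝ] Gevrey ρ θ →L[ℝ] ℂ :=
  innerL (fun a => (a : ℝ)) (exists_abs_le_weight ρ θ).choose_spec.1
    (exists_abs_le_weight ρ θ).choose_spec.2

theorem hasSum_freqForm (v w : Gevrey ρ θ) :
    HasSum (fun a : ℤ => (a : ℂ) ^ 2 * (conj (v a) * w a)) (freqForm ρ θ v w) := by
  have h := hasSum_innerL (fun a => (a : ℝ)) (exists_abs_le_weight ρ θ).choose_spec.1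
    (exists_abs_le_weight ρ θ).choose_spec.2 v w
  simp only [Complex.ofReal_intCast] at h
  exact h

theorem freqForm_self (u : Gevrey ρ θ) : freqForm ρ θ u u = (H0 u : ℂ) := by
  rw [← (hasSum_freqForm u u).tsum_eq, H0, Complex.ofReal_tsum]
  refine tsum_congr fun a => ?_
  rw [mul_comm (conj _), Complex.mul_conj, Complex.normSq_eq_norm_sq, action]
  push_cast; ring

/-- The derivative of `H₀`, as a complex-valued form. -/
def H0Deriv (u : Gevrey ρ θ) : Gevrey ρ θ →L[ℝ] ℂ := freqForm ρ θ u + (freqForm ρ θ).flip u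

theorem hasFDerivAt_H0 (u : Gevrey ρ θ) :
    HasFDerivAt (fun u : Gevrey ρ θ => (H0 u : ℂ)) (H0Deriv u) u := by
  have h := (freqForm ρ θ).hasFDerivAt_of_bilinear (hasFDerivAt_id u) (hasFDerivAt_id u)
  have e : (fun u : Gevrey ρ θ => (H0 u : ℂ)) = fun u => freqForm ρ θ (id u) (id u) :=
    funext fun u => (freqForm_self u).symm
  rw [e]
  refine h.congr_fderiv ?_
  ext v
  simp [H0Deriv]

theorem summable_sq_mul_coord (u : Gevrey ρ θ) :
    Summable fun o : Mode => ‖Complex.I * ((o.1 : ℤ) : ℂ) * (o.2 : ℂ) ^ 2 * coord u o‖ := by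
  have h := summable_pow_mul_exp hI.rho_pos hI.theta_pos 2
  refine units_summable (fun _ => norm_nonneg _) fun d => ?_
  refine Summable.of_nonneg_of_le (fun _ => norm_nonneg _) (fun a => ?_) (h.mul_right ‖u‖)
  rw [norm_mul, norm_mul, norm_mul, Complex.norm_I, norm_units, one_mul, one_mul, norm_pow,
    Complex.norm_intCast, ← rpow_exp_neg, mul_assoc]
  gcongr
  exact norm_coord_le u (d, a)

/-- Along the Hamiltonian vector field of `χ`, the derivative of `H₀` multiplies each coefficient
of `χ` by `i` times its frequency. -/
theorem H0Deriv_hamVec {p : ℕ} {χ D : Coef (p + 1)} {A B : ℝ} (hχ : IsHamCoef χ A)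
    (hD : ∀ j, ‖D j‖ ≤ B) (h : ∀ j, D j = Complex.I * (freq j : ℂ) * χ j) (u : Gevrey ρ θ) :
    H0Deriv u (hamVec ρ θ χ u) = evalC ρ θ D u := by
  set X := hamVec ρ θ χ u with hX
  let v : Mode → ℂ := fun o => Complex.I * ((o.1 : ℤ) : ℂ) * (o.2 : ℂ) ^ 2 * coord u o
  have hv : Summable fun o => ‖v o‖ := summable_sq_mul_coord u
  have h1 := hasSum_freqForm u X
  have h2 := hasSum_freqForm X u
  have e1 : ∀ a : ℤ, v (-1, a) * partialDeriv χ (-1, a) u = (a : ℂ) ^ 2 * (conj (u a) * X a) := by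
    intro a
    rw [hX, hamVec_apply hχ]
    simp only [v, coord_neg_one]
    push_cast; ring
  have e2 : ∀ a : ℤ, v (1, a) * partialDeriv χ (1, a) u = (a : ℂ) ^ 2 * (conj (X a) * u a) := by
    intro a
    have e1 : partialDeriv χ (1, a) u = conj (partialDeriv χ (-1, a) u) := by
      rw [← partialDeriv_bar hχ]; simp [bar]
    rw [hX, hamVec_apply hχ, e1]
    simp only [v, coord_one, map_mul, map_neg, Complex.conj_I]
    push_cast; ring
  have hs : Summable fun o => v o * partialDeriv χ o u := by
    unfold partialDeriv
    simp_rw [Finset.mul_sum]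
    exact summable_sum fun i _ => summable_mul_partial hχ.bound u hv i
  have e3 : H0Deriv u X = ∑' o, v o * partialDeriv χ o u := by
    rw [units_tsum hs]
    simp only [e1, e2]
    rw [h1.tsum_eq, h2.tsum_eq, add_comm]
    rfl
  rw [e3, tsum_mul_partialDeriv hχ.bound u hv, evalC, formL_apply hD,
    ← Summable.tsum_finsetSum fun i _ => (tsum_replace hχ.bound u hv i).1]
  refine tsum_congr fun j => ?_
  have e4 : ∀ i : Fin (p + 1), χ j * (v (j i) * ∏ k, coord u (j (i.succAbove k))) =
      (Complex.I * χ j * ∏ k, coord u (j k)) * ((((j i).1 : ℤ) : ℂ) * ((j i).2 : ℂ) ^ 2) := by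
    intro i
    rw [Fin.prod_univ_succAbove _ i]
    simp only [v]; ring
  simp_rw [e4]
  rw [← Finset.mul_sum, h, freq]
  push_cast; ring

/-! ### Norms and derivatives of polynomial Hamiltonian vector fields -/

theorem norm_evalC_le {n : ℕ} {f : Coef n} {B : ℝ} (hf : IsHamCoef f B) (u : Gevrey ρ θ) :
    ‖evalC ρ θ f u‖ ≤ B * (algConst ρ θ * ‖u‖) ^ n := by
  refine (norm_diag_le (formL ρ θ f) u).trans ?_
  rw [mul_pow, ← mul_assoc]
  gcongr
  exact norm_formL_le hf.nonneg hf.bound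

theorem norm_evalDeriv_le {n : ℕ} {f : Coef n} {B : ℝ} (hf : IsHamCoef f B) (u : Gevrey ρ θ) :
    ‖evalDeriv f u‖ ≤ n * (B * algConst ρ θ ^ n) * ‖u‖ ^ (n - 1) := by
  refine (norm_diagDeriv_le (formL ρ θ f) u).trans ?_
  gcongr
  exact norm_formL_le hf.nonneg hf.bound

theorem norm_hamL_le {p : ℕ} {f : Coef (p + 1)} {B : ℝ} (hf : IsHamCoef f B) :
    ‖vecL ρ θ (hamCoef f)‖ ≤ (p + 1) * B * algConst ρ θ ^ p :=
  norm_vecL_le (mul_nonneg (by positivity) hf.nonneg) (norm_hamCoef_le hf.bound)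

theorem norm_hamVec_le {p : ℕ} {f : Coef (p + 1)} {B : ℝ} (hf : IsHamCoef f B) (u : Gevrey ρ θ) :
    ‖hamVec ρ θ f u‖ ≤ (p + 1) * B * (algConst ρ θ * ‖u‖) ^ p := by
  refine (norm_diag_le (vecL ρ θ (hamCoef f)) u).trans ?_
  rw [mul_pow, ← mul_assoc]
  gcongr
  exact norm_hamL_le hf

/-- The derivative of a Hamiltonian vector field is an infinitesimally symplectic map. -/
theorem sympl_diagDeriv {p : ℕ} {f : Coef (p + 1)} {B : ℝ} (hf : IsHamCoef f B)
    (u v w : Gevrey ρ θ) :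
    sympl (diagDeriv (vecL ρ θ (hamCoef f)) u v) w +
      sympl v (diagDeriv (vecL ρ θ (hamCoef f)) u w) = 0 := by
  have h1 : ∀ y, HasFDerivAt (evalC ρ θ f) ((symplL ρ θ).flip (hamVec ρ θ f y)) y := by
    intro y
    refine (hasFDerivAt_evalC f y).congr_fderiv ?_
    ext v
    rw [evalDeriv_eq_sympl hf, ContinuousLinearMap.flip_apply, symplL_apply]
  have h2 : HasFDerivAt (fun y => (symplL ρ θ).flip (hamVec ρ θ f y))
      (((symplL ρ θ).flip).comp (diagDeriv (vecL ρ θ (hamCoef f)) u)) u :=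
    ((symplL ρ θ).flip).hasFDerivAt.comp u (hasFDerivAt_diag (vecL ρ θ (hamCoef f)) u)
  have h3 := second_derivative_symmetric h1 h2 v w
  simp only [ContinuousLinearMap.comp_apply, ContinuousLinearMap.flip_apply, symplL_apply] at h3
  rw [← h3, sympl_swap]
  ring

end

end

/-! ### The time-one map of a small polynomial vector field -/

section

theorem norm_le_of_eq_add {E : Type*} [NormedAddCommGroup E] {x y z : E} {c : ℝ}
    (h : x = y + z) (hz : ‖z‖ ≤ c * ‖x‖) : (1 - c) * ‖x‖ ≤ ‖y‖ := by
  have : ‖x‖ ≤ ‖y‖ + ‖z‖ := by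
    conv_lhs => rw [h]
    exact norm_add_le _ _
  linarith

section Flow

open Set unitInterval

variable {E F : Type*} [NormedAddCommGroup E] [NormedSpace ℝ E] [NormedAddCommGroup F]
  [NormedSpace ℝ F]

/-- The pointwise action of a multilinear map on continuous curves. -/
def liftCurves {p : ℕ} (M : ContinuousMultilinearMap ℝ (fun _ : Fin p => E) F) :
    ContinuousMultilinearMap ℝ (fun _ : Fin p => C(I, E)) C(I, F) :=
  MultilinearMap.mkContinuous
    { toFun := fun γ => ⟨fun t => M fun k => γ k t,
        M.cont.comp (continuous_pi fun k => (γ k).continuous)⟩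
      map_update_add' := by
        intro _ γ k x y
        ext t
        have h : ∀ z : C(I, E), (fun i => Function.update γ k z i t) =
            Function.update (fun i => γ i t) k (z t) := by
          intro z; funext i
          by_cases hi : i = k
          · subst hi; simp
          · simp [hi]
        simp only [ContinuousMap.coe_mk, ContinuousMap.add_apply, h]
        exact M.map_update_add _ _ _ _
      map_update_smul' := by
        intro _ γ k c x
        ext t
        have h : ∀ z : C(I, E), (fun i => Function.update γ k z i t) =
            Function.update (fun i => γ i t) k (z t) := by
          intro z; funext i
          by_cases hi : i = k
          · subst hi; simp
          · simp [hi]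
        simp only [ContinuousMap.coe_mk, ContinuousMap.smul_apply, h]
        exact M.map_update_smul _ _ _ _ }
    ‖M‖ (fun γ => by
      rw [ContinuousMap.norm_le _ (by positivity)]
      intro t
      refine (M.le_opNorm _).trans ?_
      gcongr with i
      exact (γ i).norm_coe_le_norm t)

theorem liftCurves_apply {p : ℕ} (M : ContinuousMultilinearMap ℝ (fun _ : Fin p => E) F)
    (γ : Fin p → C(I, E)) (t : I) : liftCurves M γ t = M fun k => γ k t := rfl

theorem diagDeriv_liftCurves {p : ℕ} (M : ContinuousMultilinearMap ℝ (fun _ : Fin p => E) F)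
    (γ h : C(I, E)) (t : I) : diagDeriv (liftCurves M) γ h t = diagDeriv M (γ t) (h t) := by
  rw [diagDeriv_apply, diagDeriv_apply, ContinuousMap.sum_apply]
  refine Finset.sum_congr rfl fun i _ => ?_
  rw [liftCurves_apply]
  congr 1
  funext k
  by_cases hk : k = i
  · subst hk; simp
  · simp [hk]

/-- The curve with the initial point `x` and the velocity `g`. -/
def primitiveCurve (x : E) (g : C(I, E)) (t : ℝ) : E :=
  x + ∫ s in (0 : ℝ)..t, g (projIcc 0 1 zero_le_one s)

theorem hasDerivAt_primitiveCurve [CompleteSpace E] (x : E) (g : C(I, E)) (t : ℝ) :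
    HasDerivAt (primitiveCurve x g) (g (projIcc 0 1 zero_le_one t)) t := by
  have hc : Continuous fun s : ℝ => g (projIcc 0 1 zero_le_one s) :=
    g.continuous.comp continuous_projIcc
  exact (intervalIntegral.integral_hasDerivAt_right (hc.intervalIntegrable _ _)
    (hc.stronglyMeasurableAtFilter _ _) hc.continuousAt).const_add x

theorem primitiveCurve_zero (x : E) (g : C(I, E)) : primitiveCurve x g 0 = x := by
  simp [primitiveCurve]

theorem norm_integral_curve_le (g : C(I, E)) (t : I) :
    ‖∫ s in (0 : ℝ)..t, g (projIcc 0 1 zero_le_one s)‖ ≤ ‖g‖ := by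
  have h := intervalIntegral.norm_integral_le_of_norm_le_const (a := 0) (b := (t : ℝ))
    (f := fun s => g (projIcc 0 1 zero_le_one s)) (C := ‖g‖) fun s _ => g.norm_coe_le_norm _
  refine h.trans ?_
  have h1 : |(t : ℝ) - 0| ≤ 1 := by rw [sub_zero, abs_of_nonneg t.2.1]; exact t.2.2
  exact mul_le_of_le_one_right (norm_nonneg _) h1

/-- Integration of curves from the time `0`. -/
def integrateL (E : Type*) [NormedAddCommGroup E] [NormedSpace ℝ E] [CompleteSpace E] :
    C(I, E) →L[ℝ] C(I, E) :=
  LinearMap.mkContinuous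
    { toFun := fun g => ⟨fun t => ∫ s in (0 : ℝ)..t, g (projIcc 0 1 zero_le_one s), by
        have h : Continuous (primitiveCurve 0 g) := continuous_iff_continuousAt.2 fun t =>
          (hasDerivAt_primitiveCurve 0 g t).continuousAt
        have h2 := h.comp (continuous_subtype_val (p := fun t => t ∈ I))
        simpa [primitiveCurve, Function.comp_def] using h2⟩
      map_add' := by
        intro g g'
        ext t
        simp only [ContinuousMap.coe_mk, ContinuousMap.add_apply]
        exact intervalIntegral.integral_add
          ((g.continuous.comp continuous_projIcc).intervalIntegrable _ _)
          ((g'.continuous.comp continuous_projIcc).intervalIntegrable _ _)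
      map_smul' := by
        intro c g
        ext t
        simp only [ContinuousMap.coe_mk, ContinuousMap.smul_apply, RingHom.id_apply]
        exact intervalIntegral.integral_smul _ _ }
    1 (fun g => by
      rw [one_mul, ContinuousMap.norm_le _ (norm_nonneg _)]
      exact norm_integral_curve_le g)

theorem norm_integrateL_le [CompleteSpace E] (g : C(I, E)) : ‖integrateL E g‖ ≤ ‖g‖ := by
  rw [ContinuousMap.norm_le _ (norm_nonneg _)]
  exact norm_integral_curve_le g

theorem primitiveCurve_eq_of_eq [CompleteSpace E] {γ g : C(I, E)} {x : E}
    (h : γ = ContinuousMap.const I x + integrateL E g) {t : ℝ} (ht : t ∈ Icc (0 : ℝ) 1) :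
    primitiveCurve x g t = γ ⟨t, ht⟩ := by
  rw [h]; rfl

/-- The constant curves. -/
def constCurveL (E : Type*) [NormedAddCommGroup E] [NormedSpace ℝ E] : E →L[ℝ] C(I, E) :=
  LinearMap.mkContinuous
    { toFun := fun x => ContinuousMap.const I x
      map_add' := fun _ _ => rfl
      map_smul' := fun _ _ => rfl } 1 (fun x => by
      rw [one_mul, ContinuousMap.norm_le _ (norm_nonneg _)]
      exact fun t => le_rfl)

theorem norm_constCurveL_le (x : E) : ‖constCurveL E x‖ ≤ ‖x‖ := by
  rw [ContinuousMap.norm_le _ (norm_nonneg _)]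
  exact fun t => le_rfl

/-- An invertible perturbation of the identity. -/
theorem exists_equiv_of_norm_sub_le [CompleteSpace E] {A : E →L[ℝ] E} {c : ℝ} (hc : c < 1)
    (h : ‖A - ContinuousLinearMap.id ℝ E‖ ≤ c) :
    ∃ e : E ≃L[ℝ] E, (e : E →L[ℝ] E) = A := by
  have h1 : ‖ContinuousLinearMap.id ℝ E - A‖ < 1 := by rw [norm_sub_rev]; exact h.trans_lt hc
  refine ⟨ContinuousLinearEquiv.unitsEquiv ℝ E (Units.oneSub (ContinuousLinearMap.id ℝ E - A) h1), ?_⟩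
  ext v
  have : (ContinuousLinearEquiv.unitsEquiv ℝ E
    (Units.oneSub (ContinuousLinearMap.id ℝ E - A) h1)) v =
      ((1 : E →L[ℝ] E) - (ContinuousLinearMap.id ℝ E - A)) v := rfl
  simp only [ContinuousLinearEquiv.coe_coe]
  rw [this]
  simp

variable {ι : Type*} (s : Finset ι) {p : ι → ℕ}
  (T : ∀ i, ContinuousMultilinearMap ℝ (fun _ : Fin (p i) => E) E)

/-- The polynomial vector field `u ↦ ∑_i T_i (u, …, u)`. -/
def polyField (u : E) : E := ∑ i ∈ s, T i fun _ => u

/-- The derivative of a polynomial vector field. -/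
def polyFieldDeriv (u : E) : E →L[ℝ] E := ∑ i ∈ s, diagDeriv (T i) u

theorem hasFDerivAt_polyField (u : E) : HasFDerivAt (polyField s T) (polyFieldDeriv s T u) u :=
  HasFDerivAt.fun_sum fun i _ => hasFDerivAt_diag (T i) u

theorem contDiff_polyField : ContDiff ℝ ∞ (polyField s T) :=
  ContDiff.sum fun i _ => contDiff_diag (T i)

theorem polyField_liftCurves (γ : C(I, E)) (t : I) :
    polyField s (fun i => liftCurves (T i)) γ t = polyField s T (γ t) := by
  simp only [polyField, ContinuousMap.sum_apply]
  rfl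

theorem polyFieldDeriv_liftCurves (γ h : C(I, E)) (t : I) :
    polyFieldDeriv s (fun i => liftCurves (T i)) γ h t = polyFieldDeriv s T (γ t) (h t) := by
  simp only [polyFieldDeriv, sum_apply, ContinuousMap.sum_apply]
  exact Finset.sum_congr rfl fun i _ => diagDeriv_liftCurves (T i) γ h t

theorem norm_polyFieldDeriv_liftCurves_le {c r : ℝ} (hc : 0 ≤ c)
    (hT : ∀ u ∈ Metric.ball (0 : E) r, ‖polyFieldDeriv s T u‖ ≤ c) {γ : C(I, E)} (hγ : ‖γ‖ < r)
    (h : C(I, E)) : ‖polyFieldDeriv s (fun i => liftCurves (T i)) γ h‖ ≤ c * ‖h‖ := by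
  rw [ContinuousMap.norm_le _ (by positivity)]
  intro t
  rw [polyFieldDeriv_liftCurves]
  have h1 : γ t ∈ Metric.ball (0 : E) r := by
    rw [mem_ball_zero_iff]; exact (γ.norm_coe_le_norm t).trans_lt hγ
  refine (ContinuousLinearMap.le_opNorm _ _).trans ?_
  gcongr
  · exact hT _ h1
  · exact h.norm_coe_le_norm t

/-- The integral curves of a small polynomial vector field form a smooth family: the integral
equation is inverted by the inverse function theorem on the space of curves. -/
theorem exists_smooth_curves [CompleteSpace E] [Nontrivial E] {ε : ℝ} (hε : 0 < ε)
    (hT : ∀ u ∈ Metric.ball (0 : E) (4 * ε), ‖polyFieldDeriv s T u‖ ≤ 1 / 8)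
    (h0 : polyField s T 0 = 0) :
    ∃ Γ : E → C(I, E), ContDiffOn ℝ ∞ Γ (Metric.ball 0 (3 * ε)) ∧
      ∀ z ∈ Metric.ball (0 : E) (3 * ε), ‖Γ z‖ < 4 * ε ∧ ‖Γ z‖ ≤ 2 * ‖z‖ ∧
        Γ z = constCurveL E z + integrateL E (polyField s (fun i => liftCurves (T i)) (Γ z)) := by
  set N := polyField s (fun i => liftCurves (T i)) with hN
  have hNlip : ∀ γ ∈ Metric.ball (0 : C(I, E)) (4 * ε), ∀ γ' ∈ Metric.ball (0 : C(I, E)) (4 * ε),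
      ‖N γ - N γ'‖ ≤ 1 / 8 * ‖γ - γ'‖ := by
    intro γ hγ γ' hγ'
    exact (convex_ball _ _).norm_image_sub_le_of_norm_hasFDerivWithin_le
      (fun x _ => (hasFDerivAt_polyField s (fun i => liftCurves (T i)) x).hasFDerivWithinAt)
      (fun x hx => ContinuousLinearMap.opNorm_le_bound _ (by norm_num) fun h =>
        norm_polyFieldDeriv_liftCurves_le s T (by norm_num) hT (mem_ball_zero_iff.1 hx) h) hγ' hγ
  let G : C(I, E) → C(I, E) := fun γ => γ - integrateL E (N γ)
  have hN0 : N 0 = 0 := by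
    ext t
    rw [hN, polyField_liftCurves]
    simpa using h0
  have hG0 : G 0 = 0 := by simp [G, hN0]
  have hGa : ApproximatesLinearOn G
      ((ContinuousLinearEquiv.refl ℝ C(I, E) : C(I, E) ≃L[ℝ] C(I, E)) : C(I, E) →L[ℝ] C(I, E))
      (Metric.ball 0 (4 * ε)) (1 / 8) := by
    intro γ hγ γ' hγ'
    have e : G γ - G γ' - (γ - γ') = -integrateL E (N γ - N γ') := by
      simp only [G, map_sub]; abel
    simp only [ContinuousLinearEquiv.coe_coe, ContinuousLinearEquiv.refl_apply]
    rw [e, norm_neg]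
    refine (norm_integrateL_le _).trans ((hNlip γ hγ γ' hγ').trans ?_)
    simp
  have hone : ‖((ContinuousLinearEquiv.refl ℝ C(I, E)).symm : C(I, E) →L[ℝ] C(I, E))‖₊ = 1 := by
    obtain ⟨x, hx⟩ := exists_ne (0 : E)
    have : Nontrivial C(I, E) := ⟨ContinuousMap.const I x, 0, fun h => hx (DFunLike.congr_fun h 0)⟩
    exact NNReal.eq ContinuousLinearMap.norm_id
  have hinv : Subsingleton C(I, E) ∨ (1 / 8 : NNReal) <
      ‖((ContinuousLinearEquiv.refl ℝ C(I, E)).symm : C(I, E) →L[ℝ] C(I, E))‖₊⁻¹ := by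
    right
    rw [hone, inv_one, ← NNReal.coe_lt_coe]
    norm_num
  let e := hGa.toOpenPartialHomeomorph G (Metric.ball 0 (4 * ε)) hinv Metric.isOpen_ball
  have htar : ∀ z ∈ Metric.ball (0 : E) (3 * ε), constCurveL E z ∈ e.target := by
    intro z hz
    have hsub := hGa.closedBall_subset_target hinv Metric.isOpen_ball (b := 0) (ε := 7 / 2 * ε)
      (by positivity) (Metric.closedBall_subset_ball (by linarith))
    apply hsub
    rw [hG0, mem_closedBall_zero_iff, hone]
    rw [mem_ball_zero_iff] at hz
    refine (norm_constCurveL_le z).trans ?_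
    push_cast
    linarith
  have hsymm : ∀ z ∈ Metric.ball (0 : E) (3 * ε), e.symm (constCurveL E z) ∈
      Metric.ball (0 : C(I, E)) (4 * ε) := fun z hz => e.map_target (htar z hz)
  refine ⟨fun z => e.symm (constCurveL E z), fun z hz => ?_, fun z hz => ?_⟩
  · have hγ := mem_ball_zero_iff.1 (hsymm z hz)
    have hd : HasFDerivAt G (ContinuousLinearMap.id ℝ C(I, E) - (integrateL E).comp
        (polyFieldDeriv s (fun i => liftCurves (T i)) (e.symm (constCurveL E z))))
        (e.symm (constCurveL E z)) :=
      (hasFDerivAt_id _).sub ((integrateL E).hasFDerivAt.comp _ (hasFDerivAt_polyField s _ _))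
    obtain ⟨A, hA⟩ := exists_equiv_of_norm_sub_le (E := C(I, E)) (c := 1 / 8) (by norm_num)
      (A := ContinuousLinearMap.id ℝ C(I, E) - (integrateL E).comp
        (polyFieldDeriv s (fun i => liftCurves (T i)) (e.symm (constCurveL E z)))) (by
        rw [sub_sub_cancel_left, norm_neg]
        refine ContinuousLinearMap.opNorm_le_bound _ (by norm_num) fun h => ?_
        exact (norm_integrateL_le _).trans
          (norm_polyFieldDeriv_liftCurves_le s T (by norm_num) hT hγ h))
    rw [← hA] at hd
    have hG : ContDiff ℝ ∞ G :=
      contDiff_id.sub ((integrateL E).contDiff.comp (contDiff_polyField s _))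
    have h1 : ContDiffAt ℝ ∞ e.symm (constCurveL E z) :=
      e.contDiffAt_symm (htar z hz) hd hG.contDiffAt
    exact (h1.comp z (constCurveL E).contDiff.contDiffAt).contDiffWithinAt
  · set γ := e.symm (constCurveL E z) with hγdef
    have hγ := hsymm z hz
    have heq : γ = constCurveL E z + integrateL E (N γ) := by
      have h1 : G γ = constCurveL E z := e.right_inv (htar z hz)
      rw [← h1]; simp [G]
    have hNγ : ‖N γ‖ ≤ 1 / 8 * ‖γ‖ := by
      have := hNlip γ hγ 0 (Metric.mem_ball_self (by positivity))
      simpa [hN0] using this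
    have h2 := norm_le_of_eq_add heq ((norm_integrateL_le _).trans hNγ)
    have h3 := norm_constCurveL_le z
    exact ⟨mem_ball_zero_iff.1 hγ, by linarith [norm_nonneg γ], heq⟩

/-- The time-one map of a polynomial vector field with a small derivative, together with the
integral curves `γ z` that define it. It preserves every bilinear form that the vector field
preserves infinitesimally. -/
theorem exists_timeOneMap [CompleteSpace E] [Nontrivial E] {ε : ℝ} (hε : 0 < ε)
    (hT : ∀ u ∈ Metric.ball (0 : E) (4 * ε), ‖polyFieldDeriv s T u‖ ≤ 1 / 8)
    (h0 : polyField s T 0 = 0) :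
    ∃ (Φ : OpenPartialHomeomorph E E) (γ : E → ℝ → E), Φ.source = Metric.ball 0 (3 * ε) ∧
      ContDiffOn ℝ ∞ Φ Φ.source ∧ ContDiffOn ℝ ∞ Φ.symm Φ.target ∧
      (∀ z ∈ Φ.source, γ z 0 = z ∧ γ z 1 = Φ z ∧ (∀ t ∈ Icc (0 : ℝ) 1,
        ‖γ z t‖ ≤ 2 * ‖z‖ ∧ ‖γ z t‖ < 4 * ε ∧ HasDerivAt (γ z) (polyField s T (γ z t)) t)) ∧
      (∀ z ∈ Φ.source, ∃ A : E ≃L[ℝ] E, HasFDerivAt Φ (A : E →L[ℝ] E) z ∧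
        ‖(A : E →L[ℝ] E)‖ ≤ 2 ∧ ‖(A.symm : E →L[ℝ] E)‖ ≤ 2) ∧
      ∀ B : E →L[ℝ] E →L[ℝ] F, (∀ u v w, B (polyFieldDeriv s T u v) w +
        B v (polyFieldDeriv s T u w) = 0) →
        ∀ z ∈ Φ.source, ∀ v w, B (fderiv ℝ Φ z v) (fderiv ℝ Φ z w) = B v w := by
  obtain ⟨Γ, hΓs, hΓ⟩ := exists_smooth_curves s T hε hT h0
  set U := Metric.ball (0 : E) (3 * ε) with hU
  have hUo : IsOpen U := Metric.isOpen_ball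
  let ev : C(I, E) →L[ℝ] E := ContinuousMap.evalCLM ℝ (1 : I)
  let f : E → E := fun z => ev (Γ z)
  set N := polyField s (fun i => liftCurves (T i)) with hN
  -- the variational equation
  have hD : ∀ z ∈ U, ∃ D : E →L[ℝ] C(I, E), HasFDerivAt Γ D z ∧ ∀ v,
      D v = constCurveL E v +
        integrateL E (polyFieldDeriv s (fun i => liftCurves (T i)) (Γ z) (D v)) := by
    intro z hz
    have h1 : DifferentiableAt ℝ Γ z :=
      ((hΓs.differentiableOn (by simp)) z hz).differentiableAt (hUo.mem_nhds hz)
    refine ⟨fderiv ℝ Γ z, h1.hasFDerivAt, fun v => ?_⟩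
    have h2 : HasFDerivAt (fun z => constCurveL E z + integrateL E (N (Γ z)))
        (constCurveL E + (integrateL E).comp
          ((polyFieldDeriv s (fun i => liftCurves (T i)) (Γ z)).comp (fderiv ℝ Γ z))) z :=
      (constCurveL E).hasFDerivAt.add ((integrateL E).hasFDerivAt.comp z
        ((hasFDerivAt_polyField s _ _).comp z h1.hasFDerivAt))
    have h3 : Γ =ᶠ[nhds z] fun z => constCurveL E z + integrateL E (N (Γ z)) := by
      filter_upwards [hUo.mem_nhds hz] with y hy
      exact (hΓ y hy).2.2
    have h4 := (h2.congr_of_eventuallyEq h3).unique h1.hasFDerivAt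
    exact (DFunLike.congr_fun h4 v).symm
  have hDn : ∀ z ∈ U, ∀ D : E →L[ℝ] C(I, E), (∀ v, D v = constCurveL E v +
        integrateL E (polyFieldDeriv s (fun i => liftCurves (T i)) (Γ z) (D v))) →
      ‖ev.comp D - ContinuousLinearMap.id ℝ E‖ ≤ 1 / 7 := by
    intro z hz D hDv
    refine ContinuousLinearMap.opNorm_le_bound _ (by norm_num) fun v => ?_
    have h1 := (norm_integrateL_le _).trans
      (norm_polyFieldDeriv_liftCurves_le s T (by norm_num) hT (hΓ z hz).1 (D v))
    have h2 := norm_le_of_eq_add (hDv v) h1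
    have h3 := norm_constCurveL_le v
    have h4 : (ev.comp D - ContinuousLinearMap.id ℝ E) v = integrateL E
        (polyFieldDeriv s (fun i => liftCurves (T i)) (Γ z) (D v)) 1 := by
      have : (D v) 1 = v + integrateL E
        (polyFieldDeriv s (fun i => liftCurves (T i)) (Γ z) (D v)) 1 := by
        conv_lhs => rw [hDv v]
        rfl
      simp only [sub_apply, ContinuousLinearMap.comp_apply,
        ContinuousLinearMap.id_apply]
      show (D v) 1 - v = _
      rw [this]; abel
    rw [h4]
    refine (ContinuousMap.norm_coe_le_norm _ _).trans (h1.trans ?_)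
    linarith
  have hfa : ApproximatesLinearOn f
      ((ContinuousLinearEquiv.refl ℝ E : E ≃L[ℝ] E) : E →L[ℝ] E) U (1 / 7) := by
    intro x hx y hy
    have := (convex_ball (0 : E) (3 * ε)).norm_image_sub_le_of_norm_hasFDerivWithin_le'
      (f := f) (f' := fun z => ev.comp (fderiv ℝ Γ z)) (φ := ContinuousLinearMap.id ℝ E) (C := 1 / 7)
      (fun z hz => by
        obtain ⟨D, hD1, hD2⟩ := hD z hz
        rw [hD1.fderiv]
        exact (ev.hasFDerivAt.comp z hD1).hasFDerivWithinAt)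
      (fun z hz => by
        obtain ⟨D, hD1, hD2⟩ := hD z hz
        rw [hD1.fderiv]
        exact hDn z hz D hD2) hy hx
    simpa using this
  have hone : ‖((ContinuousLinearEquiv.refl ℝ E).symm : E →L[ℝ] E)‖₊ = 1 :=
    NNReal.eq ContinuousLinearMap.norm_id
  have hinv : Subsingleton E ∨ (1 / 7 : NNReal) <
      ‖((ContinuousLinearEquiv.refl ℝ E).symm : E →L[ℝ] E)‖₊⁻¹ := by
    right
    rw [hone, inv_one, ← NNReal.coe_lt_coe]
    norm_num
  let Φ := hfa.toOpenPartialHomeomorph f U hinv hUo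
  have hA : ∀ z ∈ U, ∃ A : E ≃L[ℝ] E, HasFDerivAt f (A : E →L[ℝ] E) z ∧
        ‖(A : E →L[ℝ] E)‖ ≤ 2 ∧ ‖(A.symm : E →L[ℝ] E)‖ ≤ 2 := by
    intro z hz
    obtain ⟨D, hD1, hD2⟩ := hD z hz
    have hn := hDn z hz D hD2
    obtain ⟨A, hA⟩ := exists_equiv_of_norm_sub_le (by norm_num) hn
    have hlow : ∀ v, ‖A v - v‖ ≤ 1 / 7 * ‖v‖ := by
      intro v
      have h1 : A v - v = (ev.comp D - ContinuousLinearMap.id ℝ E) v := by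
        rw [← hA]; simp
      rw [h1]
      exact (ContinuousLinearMap.le_opNorm _ _).trans (by gcongr)
    refine ⟨A, ?_, ?_, ?_⟩
    · rw [hA]; exact ev.hasFDerivAt.comp z hD1
    · refine ContinuousLinearMap.opNorm_le_bound _ (by norm_num) fun v => ?_
      have h1 : ‖A v‖ ≤ ‖A v - v‖ + ‖v‖ := by simpa using norm_add_le (A v - v) v
      have := hlow v
      simp only [ContinuousLinearEquiv.coe_coe]
      linarith [norm_nonneg v]
    · refine ContinuousLinearMap.opNorm_le_bound _ (by norm_num) fun w => ?_
      have h1 := hlow (A.symm w)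
      rw [A.apply_symm_apply] at h1
      have h2 : ‖A.symm w‖ ≤ ‖w‖ + ‖w - A.symm w‖ := by
        have := norm_sub_le w (w - A.symm w)
        simpa using this
      simp only [ContinuousLinearEquiv.coe_coe]
      linarith [norm_nonneg (A.symm w), norm_nonneg w]
  have hfs : ContDiffOn ℝ ∞ f U := ev.contDiff.comp_contDiffOn hΓs
  refine ⟨Φ, fun z => primitiveCurve z (N (Γ z)), rfl, hfs, ?_, ?_, hA, ?_⟩
  · intro y hy
    have hy' : Φ.symm y ∈ U := Φ.map_target hy
    obtain ⟨A, hA1, -, -⟩ := hA _ hy'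
    exact (Φ.contDiffAt_symm hy hA1
      (hfs.contDiffAt (hUo.mem_nhds hy'))).contDiffWithinAt
  · intro z hz
    have h1 := hΓ z hz
    have hpc : ∀ {t : ℝ} (ht : t ∈ Icc (0 : ℝ) 1), primitiveCurve z (N (Γ z)) t = Γ z ⟨t, ht⟩ :=
      fun ht => primitiveCurve_eq_of_eq h1.2.2 ht
    refine ⟨primitiveCurve_zero _ _, hpc ⟨zero_le_one, le_rfl⟩, fun t ht => ?_⟩
    simp only
    rw [hpc ht]
    have h2 := (Γ z).norm_coe_le_norm ⟨t, ht⟩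
    refine ⟨h2.trans h1.2.1, h2.trans_lt h1.1, ?_⟩
    have h3 := hasDerivAt_primitiveCurve z (N (Γ z)) t
    rw [projIcc_of_mem _ ht, hN, polyField_liftCurves] at h3
    exact h3
  · intro B hB z hz v w
    obtain ⟨D, hD1, hD2⟩ := hD z hz
    have hfd : fderiv ℝ Φ z = ev.comp D := (ev.hasFDerivAt.comp z hD1).fderiv
    rw [hfd]
    let g : E → C(I, E) := fun v => polyFieldDeriv s (fun i => liftCurves (T i)) (Γ z) (D v)
    let c : E → ℝ → E := fun v => primitiveCurve v (g v)
    have hpc : ∀ v, ∀ {t : ℝ} (ht : t ∈ Icc (0 : ℝ) 1), c v t = D v ⟨t, ht⟩ :=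
      fun v _ ht => primitiveCurve_eq_of_eq (hD2 v) ht
    have hcd : ∀ v t, HasDerivAt (c v) (g v (projIcc 0 1 zero_le_one t)) t :=
      fun v t => hasDerivAt_primitiveCurve v (g v) t
    have hder : ∀ t, HasDerivAt (fun t => B (c v t) (c w t))
        (B (g v (projIcc 0 1 zero_le_one t)) (c w t) +
          B (c v t) (g w (projIcc 0 1 zero_le_one t))) t := by
      intro t
      have := (B.hasFDerivAt.comp_hasDerivAt t (hcd v t)).clm_apply (hcd w t)
      simpa using this
    have hconst := constant_of_has_deriv_right_zero (a := 0) (b := 1)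
      (f := fun t => B (c v t) (c w t))
      (fun t _ => (hder t).continuousAt.continuousWithinAt) (fun t ht => by
        have h1 := hder t
        have ht' : t ∈ Icc (0 : ℝ) 1 := Ico_subset_Icc_self ht
        have h2 : B (g v (projIcc 0 1 zero_le_one t)) (c w t) +
          B (c v t) (g w (projIcc 0 1 zero_le_one t)) = 0 := by
          rw [projIcc_of_mem _ ht', hpc v ht', hpc w ht']
          simp only [g, polyFieldDeriv_liftCurves]
          exact hB _ _ _
        rw [h2] at h1
        exact h1.hasDerivWithinAt)
    have h1 := hconst 1 ⟨zero_le_one, le_rfl⟩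
    have h0 : ∀ v, c v 0 = v := fun v => primitiveCurve_zero _ _
    simp only [h0] at h1
    rw [← h1, hpc v ⟨zero_le_one, le_rfl⟩, hpc w ⟨zero_le_one, le_rfl⟩]
    rfl

end Flow

end

/-! ### The formal normal form -/

section

open scoped Nat

/-- Formal sums `∑_k F_k` of homogeneous polynomials, `F_k` being of degree `2 k + 2`, so that Poisson
brackets add the indices. -/
abbrev Graded : Type := ∀ k : ℕ, Coef (2 * k + 1 + 1)

/-- The Poisson bracket `F ↦ {F, χ}` of formal sums. -/
def ad (χ F : Graded) : Graded := fun k =>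
  ∑ i : Fin (k + 1), bracket (p := 2 * (k - i) + 1) (q := 2 * i + 1) (by omega) (F (k - i)) (χ i)

theorem bracket_zero_left {p q N : ℕ} (h : p + q = N) (g : Coef (q + 1)) :
    bracket h (0 : Coef (p + 1)) g = 0 := by
  funext j; simp [bracket]

theorem bracket_zero_right {p q N : ℕ} (h : p + q = N) (f : Coef (p + 1)) :
    bracket h f (0 : Coef (q + 1)) = 0 := by
  funext j; simp [bracket]

/-- Brackets of formal sums without quadratic terms depend only on the terms of smaller degree. -/
theorem ad_congr {χ χ' F F' : Graded} {k : ℕ} (hχ0 : χ 0 = 0) (hχ0' : χ' 0 = 0) (hF0 : F 0 = 0)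
    (hF0' : F' 0 = 0) (hχ : ∀ i < k, χ i = χ' i) (hF : ∀ i < k, F i = F' i) :
    ad χ F k = ad χ' F' k := by
  unfold ad
  refine Finset.sum_congr rfl fun i _ => ?_
  obtain ⟨i, hi⟩ := i
  simp only
  rcases Nat.eq_zero_or_pos i with rfl | h0
  · rw [hχ0, hχ0', bracket_zero_right, bracket_zero_right]
  · rcases Nat.lt_or_ge i k with h1 | h1
    · rw [hχ i h1, hF (k - i) (by omega)]
    · have : k - i = 0 := by omega
      have e : ∀ {F : Graded}, F 0 = 0 → F (k - i) = 0 := by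
        intro F hF; rw [this]; exact hF
      rw [e hF0, e hF0', bracket_zero_left, bracket_zero_left]

theorem ad_zero_zero {χ F : Graded} (hχ0 : χ 0 = 0) : ad χ F 0 = 0 := by
  unfold ad
  rw [Fin.sum_univ_one]
  show bracket _ (F 0) (χ 0) = 0
  rw [hχ0, bracket_zero_right]

theorem iterate_ad_zero {χ F : Graded} (hχ0 : χ 0 = 0) (hF0 : F 0 = 0) (n : ℕ) :
    (ad χ)^[n] F 0 = 0 := by
  cases n with
  | zero => exact hF0
  | succ n => rw [Function.iterate_succ_apply']; exact ad_zero_zero hχ0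

/-- Each bracket raises the degree, so that only finitely many of them contribute to a given degree. -/
theorem iterate_ad_eq_zero {χ F : Graded} (hχ0 : χ 0 = 0) (hF0 : F 0 = 0) {n k : ℕ} (h : k ≤ n) :
    (ad χ)^[n] F k = 0 := by
  induction n generalizing k with
  | zero => obtain rfl : k = 0 := by omega
            exact hF0
  | succ n ih =>
    rw [Function.iterate_succ_apply', ad]
    refine Finset.sum_eq_zero fun i _ => ?_
    obtain ⟨i, hi⟩ := i
    rcases Nat.eq_zero_or_pos i with rfl | h0
    · simp only; rw [hχ0, bracket_zero_right]
    · simp only; rw [ih (by omega), bracket_zero_left]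

theorem iterate_ad_congr {χ χ' F F' : Graded} {k : ℕ} (hχ0 : χ 0 = 0) (hχ0' : χ' 0 = 0)
    (hF0 : F 0 = 0) (hF0' : F' 0 = 0) (hχ : ∀ i < k, χ i = χ' i) (hF : ∀ i < k, F i = F' i)
    {n : ℕ} (hn : n ≠ 0) : (ad χ)^[n] F k = (ad χ')^[n] F' k := by
  induction n generalizing k with
  | zero => exact absurd rfl hn
  | succ n ih =>
    rw [Function.iterate_succ_apply', Function.iterate_succ_apply']
    refine ad_congr hχ0 hχ0' (iterate_ad_zero hχ0 hF0 n) (iterate_ad_zero hχ0' hF0' n) hχ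
      fun i hi => ?_
    rcases Nat.eq_zero_or_pos n with rfl | h0
    · exact hF i hi
    · exact ih (fun l hl => hχ l (by omega)) (fun l hl => hF l (by omega)) (by omega)

/-- One bracket with a generator `χ` of degree at most `2 m` costs the factor `k / (2 m)` in
degree `2 k + 2`, if degrees are weighted by the powers of `s`: there are at most `m` summands, and
the differentiations in each of them cost at most the factor `4 k m`. -/
theorem isHamCoef_ad {m : ℕ} (hm : 0 < m) {χ F : Graded} {A s : ℝ} (hA : 0 ≤ A) (hs : 0 ≤ s)
    (hχ0 : χ 0 = 0) (hχm : ∀ i, m ≤ i → χ i = 0)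
    (hχ : ∀ i, IsHamCoef (χ i) (s ^ i / (8 * m ^ 3))) (hF0 : F 0 = 0) {n : ℕ}
    (hF : ∀ k, IsHamCoef (F k) (A * s ^ k * (k / (2 * m)) ^ n)) (k : ℕ) :
    IsHamCoef (ad χ F k) (A * s ^ k * (k / (2 * m)) ^ (n + 1)) := by
  have hm' : (0 : ℝ) < m := by exact_mod_cast hm
  set c : ℝ := 4 * k * m * (A * s ^ k * (k / (2 * m)) ^ n / (8 * m ^ 3)) with hc
  have hc0 : 0 ≤ c := by positivity
  have hterm : ∀ i : Fin (k + 1), IsHamCoef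
      (bracket (p := 2 * (k - i) + 1) (q := 2 * i + 1) (N := 2 * k + 1 + 1) (by omega) (F (k - i)) (χ i))
      (if (i : ℕ) < m then c else 0) := by
    rintro ⟨i, hi⟩
    simp only
    rcases Nat.eq_zero_or_pos i with rfl | h0
    · rw [hχ0, bracket_zero_right]
      exact isHamCoef_zero.mono (by split_ifs; linarith)
    rcases Nat.lt_or_ge i m with h1 | h1
    · rcases Nat.lt_or_ge i k with h2 | h2
      · rw [if_pos h1]
        refine (isHamCoef_bracket _ (hF (k - i)) (hχ i)).mono ?_
        have hik : i ≤ k := h2.le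
        have e1 : ((2 * (k - i) + 1 : ℕ) : ℝ) + 1 ≤ 2 * k := by
          have : 2 * (k - i) + 1 + 1 ≤ 2 * k := by omega
          exact_mod_cast this
        have e2 : ((2 * i + 1 : ℕ) : ℝ) + 1 ≤ 2 * m := by
          have : 2 * i + 1 + 1 ≤ 2 * m := by omega
          exact_mod_cast this
        have e3 : s ^ (k - i) * s ^ i = s ^ k := by rw [← pow_add]; congr 1; omega
        have e4 : (((k - i : ℕ) : ℝ) / (2 * m)) ^ n ≤ ((k : ℝ) / (2 * m)) ^ n := by
          gcongr
          omega
        calc (((2 * (k - i) + 1 : ℕ) : ℝ) + 1) * (((2 * i + 1 : ℕ) : ℝ) + 1) *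
              (A * s ^ (k - i) * (((k - i : ℕ) : ℝ) / (2 * m)) ^ n * (s ^ i / (8 * m ^ 3)))
            ≤ (2 * k) * (2 * m) *
              (A * s ^ (k - i) * ((k : ℝ) / (2 * m)) ^ n * (s ^ i / (8 * m ^ 3))) := by
              gcongr
          _ = 4 * k * m * (A * (s ^ (k - i) * s ^ i) * ((k : ℝ) / (2 * m)) ^ n / (8 * m ^ 3)) := by
              ring
          _ = c := by rw [e3]
      · have h3 : k - i = 0 := by omega
        have : F (k - i) = 0 := by rw [h3]; exact hF0
        rw [this, bracket_zero_left]
        exact isHamCoef_zero.mono (by split_ifs; linarith)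
    · rw [hχm i h1, bracket_zero_right]
      exact isHamCoef_zero.mono (by split_ifs <;> linarith)
  unfold ad
  refine (IsHamCoef.sum Finset.univ fun i _ => hterm i).mono ?_
  rw [Fin.sum_univ_eq_sum_range (fun i => if i < m then c else 0), ← Finset.sum_filter,
    Finset.sum_const, nsmul_eq_mul]
  have hcard : ((Finset.filter (fun i => i < m) (Finset.range (k + 1))).card : ℝ) ≤ m := by
    have : (Finset.filter (fun i => i < m) (Finset.range (k + 1))).card ≤ (Finset.range m).card :=
      Finset.card_le_card fun i hi => by simp at hi ⊢; exact hi.2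
    simpa using this
  calc _ ≤ m * c := by gcongr
    _ = _ := by
      rw [hc, pow_succ ((k : ℝ) / (2 * m)) n]
      generalize ((k : ℝ) / (2 * m)) ^ n = q
      field_simp
      ring

theorem isHamCoef_iterate_ad {m : ℕ} (hm : 0 < m) {χ F : Graded} {A s : ℝ} (hA : 0 ≤ A)
    (hs : 0 ≤ s) (hχ0 : χ 0 = 0) (hχm : ∀ i, m ≤ i → χ i = 0)
    (hχ : ∀ i, IsHamCoef (χ i) (s ^ i / (8 * m ^ 3))) (hF0 : F 0 = 0)
    (hF : ∀ k, IsHamCoef (F k) (A * s ^ k)) (n k : ℕ) :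
    IsHamCoef ((ad χ)^[n] F k) (A * s ^ k * (k / (2 * m)) ^ n) := by
  induction n generalizing k with
  | zero => simpa using hF k
  | succ n ih =>
    rw [Function.iterate_succ_apply']
    exact isHamCoef_ad hm hA hs hχ0 hχm hχ (iterate_ad_zero hχ0 hF0 n) ih k

/-- The formal sum `{H₀, χ}`. -/
def freqMul (χ : Graded) : Graded := fun k j => Complex.I * (freq j : ℂ) * χ k j

/-- The pullback of `H₀ + P` by the time-one flow of `χ`, up to `H₀` itself:
`∑_n ad_χ^n P / n! + ∑_n ad_χ^n {H₀, χ} / (n + 1)!`. In each degree only finitely many terms differ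
from zero. -/
def lieSeries (P χ : Graded) : Graded := fun k => ∑ n ∈ Finset.range (k + 1),
  ((n ! : ℝ)⁻¹ • (ad χ)^[n] P k + ((n + 1)! : ℝ)⁻¹ • (ad χ)^[n] (freqMul χ) k)

theorem lieSeries_eq_add (P χ : Graded) (k : ℕ) : lieSeries P χ k = P k + freqMul χ k +
    ∑ n ∈ Finset.range k, (((n + 1)! : ℝ)⁻¹ • (ad χ)^[n + 1] P k +
      ((n + 1 + 1)! : ℝ)⁻¹ • (ad χ)^[n + 1] (freqMul χ) k) := by
  rw [lieSeries, Finset.sum_range_succ']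
  refine (add_comm _ _).trans ?_
  simp

theorem freqMul_zero {χ : Graded} {k : ℕ} (h : χ k = 0) : freqMul χ k = 0 := by
  funext j; simp [freqMul, h]

theorem IsHamCoef.freqMul_of_bound {χ : Graded} {k : ℕ} {A B : ℝ} (h : IsHamCoef (χ k) A)
    (hB : ∀ j, ‖freqMul χ k j‖ ≤ B) : IsHamCoef (freqMul χ k) B where
  bound := hB
  charge_eq j hj := h.charge_eq j (right_ne_zero_of_mul hj)
  mom_eq j hj := h.mom_eq j (right_ne_zero_of_mul hj)
  real j := by
    unfold freqMul
    rw [h.real, freq_bar]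
    simp

/-- The subtracted terms make the induction on `N` work; the right-hand side is smaller than `63 / 64`. -/
theorem sum_factorial_le {N : ℕ} (hN : 2 ≤ N) :
    ∑ n ∈ Finset.range N, (1 / 2 : ℝ) ^ (n + 1) * (((n + 1)! : ℝ)⁻¹ + ((n + 1 + 1)! : ℝ)⁻¹) ≤
      63 / 64 - 5 / 24 * (1 / 2) ^ N + 1 / 192 - 1 / 64 := by
  induction N, hN using Nat.le_induction with
  | base => norm_num [Finset.sum_range_succ, Nat.factorial]
  | succ N hN ih =>
    rw [Finset.sum_range_succ]
    have h1 : ((N + 1)! : ℝ)⁻¹ ≤ 6⁻¹ := by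
      apply inv_anti₀ (by norm_num)
      have : 3 ! ≤ (N + 1)! := Nat.factorial_le (by omega)
      exact_mod_cast this
    have h2 : ((N + 1 + 1)! : ℝ)⁻¹ ≤ 24⁻¹ := by
      apply inv_anti₀ (by norm_num)
      have : 4 ! ≤ (N + 1 + 1)! := Nat.factorial_le (by omega)
      exact_mod_cast this
    have h3 : (0 : ℝ) < (1 / 2) ^ (N + 1) := by positivity
    have h4 : (1 / 2 : ℝ) ^ N = 2 * (1 / 2) ^ (N + 1) := by rw [pow_succ]; ring
    have h5 : (1 / 2 : ℝ) ^ (N + 1) * (((N + 1)! : ℝ)⁻¹ + ((N + 1 + 1)! : ℝ)⁻¹) ≤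
        (1 / 2 : ℝ) ^ (N + 1) * (6⁻¹ + 24⁻¹) := by gcongr
    rw [h4] at ih
    linarith

/-- The bound `(8 k³)^{k-1} C₀^k` for the coefficients of degree `2 k + 2`. -/
def coefBound (C₀ : ℝ) (k : ℕ) : ℝ := (8 * (k : ℝ) ^ 3) ^ (k - 1) * C₀ ^ k

theorem coefBound_nonneg {C₀ : ℝ} (h : 1 ≤ C₀) (k : ℕ) : 0 ≤ coefBound C₀ k := by
  unfold coefBound; positivity

theorem coefBound_le {C₀ : ℝ} (h : 1 ≤ C₀) {k m : ℕ} (hk : k ≠ 0) (hkm : k ≤ m) :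
    coefBound C₀ k ≤ (8 * m ^ 3 * C₀) ^ k / (8 * m ^ 3) := by
  have hm : (0 : ℝ) < m := by exact_mod_cast (by omega : 0 < m)
  obtain ⟨l, rfl⟩ := Nat.exists_eq_succ_of_ne_zero hk
  rw [le_div_iff₀ (by positivity), coefBound]
  calc (8 * ((l + 1 : ℕ) : ℝ) ^ 3) ^ (l + 1 - 1) * C₀ ^ (l + 1) * (8 * m ^ 3)
      ≤ (8 * (m : ℝ) ^ 3) ^ (l + 1 - 1) * C₀ ^ (l + 1) * (8 * m ^ 3) := by gcongr
    _ = _ := by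
      rw [Nat.add_sub_cancel, Nat.succ_eq_add_one, mul_pow (8 * (m : ℝ) ^ 3),
        pow_succ (8 * (m : ℝ) ^ 3)]
      ring

/-- The data produced by the formal elimination of the nonresonant terms of degree at most `2 m`:
`χ` is the generator. -/
structure IsNormalizing (P : Graded) (C₀ : ℝ) (m : ℕ) (χ : Graded) : Prop where
  zero : χ 0 = 0
  eq_zero : ∀ i, m ≤ i → χ i = 0
  isHam : ∀ i, IsHamCoef (χ i) (coefBound C₀ i)
  isHam_freqMul : ∀ i, IsHamCoef (freqMul χ i) (coefBound C₀ i)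
  eq_zero_of_freq : ∀ i j, freq j = 0 → χ i j = 0
  lieSeries_eq_zero : ∀ k, k ≠ 0 → k < m → ∀ j, freq j ≠ 0 → lieSeries P χ k j = 0
  isHam_lieSeries : ∀ k, k ≠ 0 → k < m → IsHamCoef (lieSeries P χ k) (coefBound C₀ k)

section

variable {P : Graded} {C₀ : ℝ} {m : ℕ} {χ : Graded}

theorem IsNormalizing.isHam_geometric (h : IsNormalizing P C₀ m χ) (hC : 1 ≤ C₀) (i : ℕ) :
    IsHamCoef (χ i) ((8 * m ^ 3 * C₀) ^ i / (8 * m ^ 3)) := by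
  by_cases h0 : i = 0
  · subst h0; rw [h.zero]; exact isHamCoef_zero.mono (by positivity)
  by_cases hm : m ≤ i
  · rw [h.eq_zero i hm]; exact isHamCoef_zero.mono (by positivity)
  exact (h.isHam i).mono (coefBound_le hC h0 (by omega))

theorem IsNormalizing.isHam_freqMul_geometric (h : IsNormalizing P C₀ m χ) (hC : 1 ≤ C₀) (i : ℕ) :
    IsHamCoef (freqMul χ i) ((8 * (m : ℝ) ^ 3)⁻¹ * (8 * m ^ 3 * C₀) ^ i) := by
  by_cases h0 : i = 0
  · subst h0; rw [freqMul_zero h.zero]; exact isHamCoef_zero.mono (by positivity)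
  by_cases hm : m ≤ i
  · rw [freqMul_zero (h.eq_zero i hm)]; exact isHamCoef_zero.mono (by positivity)
  refine (h.isHam_freqMul i).mono ((coefBound_le hC h0 (not_le.1 hm).le).trans (le_of_eq ?_))
  ring

theorem isHamCoef_of_pow_bound (hC : 1 ≤ C₀) (hm : 0 < m) (hP0 : P 0 = 0)
    (hP : ∀ k, IsHamCoef (P k) (C₀ ^ k)) (k : ℕ) :
    IsHamCoef (P k) ((8 * (m : ℝ) ^ 3)⁻¹ * (8 * m ^ 3 * C₀) ^ k) := by
  by_cases h0 : k = 0
  · subst h0; rw [hP0]; exact isHamCoef_zero.mono (by positivity)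
  have hm' : (1 : ℝ) ≤ m := by exact_mod_cast hm
  have h8 : (1 : ℝ) ≤ 8 * m ^ 3 := by
    have := one_le_pow₀ hm' (n := 3)
    linarith
  refine (hP k).mono ?_
  obtain ⟨l, rfl⟩ := Nat.exists_eq_succ_of_ne_zero h0
  have : (8 * (m : ℝ) ^ 3)⁻¹ * (8 * m ^ 3 * C₀) ^ (l + 1) = (8 * (m : ℝ) ^ 3) ^ l * C₀ ^ (l + 1) := by
    rw [mul_pow, pow_succ (8 * (m : ℝ) ^ 3)]
    field_simp
  rw [Nat.succ_eq_add_one, this]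
  exact le_mul_of_one_le_left (by positivity) (one_le_pow₀ h8)

theorem IsNormalizing.isHam_iterate_P (h : IsNormalizing P C₀ m χ) (hC : 1 ≤ C₀) (hm : 0 < m)
    (hP0 : P 0 = 0) (hP : ∀ k, IsHamCoef (P k) (C₀ ^ k)) (n k : ℕ) :
    IsHamCoef ((ad χ)^[n] P k) ((8 * (m : ℝ) ^ 3)⁻¹ * (8 * m ^ 3 * C₀) ^ k * (k / (2 * m)) ^ n) :=
  isHamCoef_iterate_ad hm (by positivity) (by positivity) h.zero h.eq_zero (h.isHam_geometric hC) hP0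
    (isHamCoef_of_pow_bound hC hm hP0 hP) n k

theorem IsNormalizing.isHam_iterate_freqMul (h : IsNormalizing P C₀ m χ) (hC : 1 ≤ C₀) (hm : 0 < m)
    (n k : ℕ) : IsHamCoef ((ad χ)^[n] (freqMul χ) k)
      ((8 * (m : ℝ) ^ 3)⁻¹ * (8 * m ^ 3 * C₀) ^ k * (k / (2 * m)) ^ n) :=
  isHamCoef_iterate_ad hm (by positivity) (by positivity) h.zero h.eq_zero (h.isHam_geometric hC)
    (freqMul_zero h.zero) (h.isHam_freqMul_geometric hC) n k

/-- The next term of the Lie series obeys the bound of the coefficients: the iterated brackets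
contribute at most the fraction `∑_{n ≥ 1} 2⁻ⁿ (1 / n! + 1 / (n + 1)!) < 31 / 32` of it. -/
theorem IsNormalizing.isHam_next (h : IsNormalizing P C₀ m χ) (hC : 1 ≤ C₀) (hm : 0 < m)
    (hP0 : P 0 = 0) (hP : ∀ k, IsHamCoef (P k) (C₀ ^ k)) :
    IsHamCoef (lieSeries P χ m) (coefBound C₀ m) := by
  have hm' : (0 : ℝ) < m := by exact_mod_cast hm
  rw [lieSeries_eq_add, freqMul_zero (h.eq_zero m le_rfl), add_zero]
  rcases (by omega : m = 1 ∨ 2 ≤ m) with rfl | h2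
  · rw [Finset.sum_range_one, iterate_ad_eq_zero h.zero hP0 le_rfl,
      iterate_ad_eq_zero h.zero (freqMul_zero h.zero) le_rfl]
    simpa [coefBound] using hP 1
  have hb : coefBound C₀ m = (8 * (m : ℝ) ^ 3)⁻¹ * (8 * m ^ 3 * C₀) ^ m := by
    obtain ⟨l, rfl⟩ := Nat.exists_eq_succ_of_ne_zero hm.ne'
    rw [coefBound, Nat.succ_eq_add_one, Nat.add_sub_cancel,
      mul_pow (8 * ((l + 1 : ℕ) : ℝ) ^ 3) C₀, pow_succ (8 * ((l + 1 : ℕ) : ℝ) ^ 3)]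
    field_simp
  have hhalf : ((m : ℝ) / (2 * m)) = 1 / 2 := by field_simp
  have hsum := IsHamCoef.sum (Finset.range m) fun n _ =>
    ((h.isHam_iterate_P hC hm hP0 hP (n + 1) m).smul ((n + 1)! : ℝ)⁻¹).add
      ((h.isHam_iterate_freqMul hC hm (n + 1) m).smul ((n + 1 + 1)! : ℝ)⁻¹)
  refine ((hP m).add hsum).mono ?_
  rw [hhalf, ← hb]
  have e1 : ∀ n : ℕ, |((n + 1)! : ℝ)⁻¹| * (coefBound C₀ m * (1 / 2) ^ (n + 1)) +
      |((n + 1 + 1)! : ℝ)⁻¹| * (coefBound C₀ m * (1 / 2) ^ (n + 1)) =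
      coefBound C₀ m * ((1 / 2) ^ (n + 1) * (((n + 1)! : ℝ)⁻¹ + ((n + 1 + 1)! : ℝ)⁻¹)) := by
    intro n
    rw [abs_of_nonneg (by positivity), abs_of_nonneg (by positivity)]; ring
  simp_rw [e1]
  rw [← Finset.mul_sum]
  have e2 := sum_factorial_le h2
  have e3 : C₀ ^ m ≤ coefBound C₀ m * (1 / 64) := by
    have h64 : (64 : ℝ) ≤ (8 * (m : ℝ) ^ 3) ^ (m - 1) := by
      have hm2 : (2 : ℝ) ≤ m := by exact_mod_cast h2
      have : (64 : ℝ) ≤ 8 * (m : ℝ) ^ 3 := by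
        have := pow_le_pow_left₀ (by norm_num) hm2 3
        linarith
      calc (64 : ℝ) ≤ 8 * (m : ℝ) ^ 3 := this
        _ ≤ _ := le_self_pow₀ (by linarith) (by omega)
    rw [coefBound]
    have : 0 ≤ C₀ ^ m := by positivity
    nlinarith
  have e4 : 0 ≤ coefBound C₀ m := coefBound_nonneg hC m
  have e5 : (0 : ℝ) ≤ 5 / 24 * (1 / 2) ^ m := by positivity
  calc _ ≤ coefBound C₀ m * (1 / 64) + coefBound C₀ m *
        (63 / 64 - 5 / 24 * (1 / 2) ^ m + 1 / 192 - 1 / 64) := by gcongr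
    _ ≤ coefBound C₀ m * 1 := by
        rw [← mul_add]
        gcongr
        linarith
    _ = _ := mul_one _

/-- The elimination of the nonresonant terms of the next degree: `i Ω χ = -W` is solved for `χ`,
where the frequencies `Ω` are integers, so that there are no small divisors. -/
theorem IsNormalizing.succ (h : IsNormalizing P C₀ m χ) (hC : 1 ≤ C₀) (hm : 0 < m)
    (hP0 : P 0 = 0) (hP : ∀ k, IsHamCoef (P k) (C₀ ^ k)) :
    ∃ χ', IsNormalizing P C₀ (m + 1) χ' := by
  have hW := h.isHam_next hC hm hP0 hP
  set W := lieSeries P χ m with hWdef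
  let y : Coef (2 * m + 1 + 1) := fun j =>
    if freq j = 0 then 0 else Complex.I * W j / (freq j : ℂ)
  have hy0 : ∀ j, freq j = 0 → y j = 0 := fun j hj => if_pos hj
  have hyI : ∀ j, Complex.I * (freq j : ℂ) * y j = if freq j = 0 then 0 else -W j := by
    intro j
    by_cases hj : freq j = 0
    · simp [hj]
    · have : (freq j : ℂ) ≠ 0 := by exact_mod_cast hj
      simp only [y, if_neg hj]
      field_simp
      rw [Complex.I_sq]; ring
  have hyn : ∀ j, ‖y j‖ ≤ ‖W j‖ := by
    intro j
    by_cases hj : freq j = 0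
    · rw [hy0 j hj]; simp
    · simp only [y, if_neg hj]
      rw [norm_div, norm_mul, Complex.norm_I, one_mul]
      refine div_le_self (norm_nonneg _) ?_
      rw [Complex.norm_intCast]
      exact_mod_cast Int.one_le_abs hj
  have hyW : ∀ j, y j ≠ 0 → W j ≠ 0 := fun j hj hw => hj (by
    have := hyn j; rw [hw, norm_zero] at this; exact norm_le_zero_iff.1 this)
  have hyH : IsHamCoef y (coefBound C₀ m) :=
    { bound := fun j => (hyn j).trans (hW.bound j)
      charge_eq := fun j hj => hW.charge_eq j (hyW j hj)
      mom_eq := fun j hj => hW.mom_eq j (hyW j hj)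
      real := fun j => by
        have := freq_bar j
        by_cases hj : freq j = 0
        · rw [hy0 j hj, hy0 _ (by rw [this, hj, neg_zero])]; simp
        · have hj' : freq (fun k => bar (j k)) ≠ 0 := by rw [this]; exact neg_ne_zero.2 hj
          simp only [y, if_neg hj, if_neg hj', hW.real, this]
          rw [Int.cast_neg, div_neg, map_div₀, map_mul, Complex.conj_I, map_intCast,
            neg_mul, neg_div] }
  have hupd : ∀ i, i ≠ m → Function.update χ m y i = χ i := fun i hi => Function.update_of_ne hi _ _
  have hupm : Function.update χ m y m = y := Function.update_self _ _ _
  have hz : Function.update χ m y 0 = 0 := by rw [hupd 0 hm.ne]; exact h.zero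
  have hfu : ∀ i, i ≠ m → freqMul (Function.update χ m y) i = freqMul χ i := by
    intro i hi; unfold freqMul; rw [hupd i hi]
  have hfm : ∀ j, freqMul (Function.update χ m y) m j = if freq j = 0 then 0 else -W j := by
    intro j; unfold freqMul; rw [hupm]; exact hyI j
  -- brackets in degree `2 k + 2` do not see the new term if `k ≤ m`
  have hit : ∀ k ≤ m, ∀ n, (ad (Function.update χ m y))^[n + 1] P k = (ad χ)^[n + 1] P k ∧
      (ad (Function.update χ m y))^[n + 1] (freqMul (Function.update χ m y)) k =
        (ad χ)^[n + 1] (freqMul χ) k := by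
    intro k hk n
    refine ⟨iterate_ad_congr hz h.zero hP0 hP0 (fun i hi => hupd i (by omega)) (fun _ _ => rfl)
        (Nat.succ_ne_zero n), iterate_ad_congr hz h.zero (freqMul_zero hz) (freqMul_zero h.zero)
        (fun i hi => hupd i (by omega)) (fun i hi => hfu i (by omega)) (Nat.succ_ne_zero n)⟩
  have hlt : ∀ k < m, lieSeries P (Function.update χ m y) k = lieSeries P χ k := by
    intro k hk
    rw [lieSeries_eq_add, lieSeries_eq_add, hfu k hk.ne]
    congr 1
    exact Finset.sum_congr rfl fun n _ => by rw [(hit k hk.le n).1, (hit k hk.le n).2]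
  have hWm : lieSeries P (Function.update χ m y) m = W + freqMul (Function.update χ m y) m := by
    rw [hWdef, lieSeries_eq_add, lieSeries_eq_add P χ, freqMul_zero (h.eq_zero m le_rfl), add_zero]
    refine (add_right_comm _ _ _).trans ?_
    congr 2
    exact Finset.sum_congr rfl fun n _ => by rw [(hit m le_rfl n).1, (hit m le_rfl n).2]
  have hWmj : ∀ j, lieSeries P (Function.update χ m y) m j = if freq j = 0 then W j else 0 := by
    intro j
    rw [hWm, Pi.add_apply, hfm]
    split_ifs <;> simp
  refine ⟨Function.update χ m y, hz, ?_, ?_, ?_, ?_, ?_, ?_⟩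
  · intro i hi; rw [hupd i (by omega)]; exact h.eq_zero i (by omega)
  · intro i
    by_cases hi : i = m
    · subst hi; rw [hupm]; exact hyH
    · rw [hupd i hi]; exact h.isHam i
  · intro i
    by_cases hi : i = m
    · subst hi
      refine IsHamCoef.freqMul_of_bound (A := coefBound C₀ i) (by rw [hupm]; exact hyH) fun j => ?_
      rw [hfm]
      split_ifs
      · rw [norm_zero]; exact coefBound_nonneg hC i
      · rw [norm_neg]; exact hW.bound j
    · rw [hfu i hi]; exact h.isHam_freqMul i
  · intro i j hj
    by_cases hi : i = m
    · subst hi; rw [hupm]; exact hy0 j hj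
    · rw [hupd i hi]; exact h.eq_zero_of_freq i j hj
  · intro k hk0 hk j hj
    by_cases hkm : k = m
    · subst hkm; rw [hWmj, if_neg hj]
    · rw [hlt k (by omega)]; exact h.lieSeries_eq_zero k hk0 (by omega) j hj
  · intro k hk0 hk
    by_cases hkm : k = m
    · subst hkm
      exact
        { bound := fun j => by
            rw [hWmj]
            split_ifs
            · exact hW.bound j
            · rw [norm_zero]; exact coefBound_nonneg hC k
          charge_eq := fun j hj => hW.charge_eq j fun hw => hj (by rw [hWmj, hw, ite_self])
          mom_eq := fun j hj => hW.mom_eq j fun hw => hj (by rw [hWmj, hw, ite_self])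
          real := fun j => by
            rw [hWmj, hWmj, freq_bar, hW.real]
            by_cases hj : freq j = 0 <;> simp [hj] }
    · rw [hlt k (by omega)]; exact h.isHam_lieSeries k hk0 (by omega)

theorem exists_isNormalizing (hC : 1 ≤ C₀) (hP0 : P 0 = 0)
    (hP : ∀ k, IsHamCoef (P k) (C₀ ^ k)) {m : ℕ} (hm : 1 ≤ m) : ∃ χ, IsNormalizing P C₀ m χ := by
  induction m, hm using Nat.le_induction with
  | base =>
    have hz : freqMul 0 = 0 := by funext k j; simp [freqMul]
    refine ⟨0, rfl, fun _ _ => rfl, fun i => isHamCoef_zero.mono (coefBound_nonneg hC i),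
      fun i => ?_, fun _ _ _ => rfl, fun k h0 h1 => by omega, fun k h0 h1 => by omega⟩
    rw [hz]; exact isHamCoef_zero.mono (coefBound_nonneg hC i)
  | succ m hm ih =>
    obtain ⟨χ, hχ⟩ := ih
    exact hχ.succ hC (by omega) hP0 hP

end

end

/-! ### Convergent sums of homogeneous polynomials -/

section

open scoped Nat

variable {ρ θ : ℝ}

section

variable [hI : GevreyIndex ρ θ]

theorem evalC_eq_tsum {n : ℕ} {f : Coef n} {B : ℝ} (hf : IsHamCoef f B) (u : Gevrey ρ θ) :
    evalC ρ θ f u = ∑' j, f j * ∏ k, coord u (j k) := formL_apply hf.bound _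

theorem summable_evalC_terms {n : ℕ} {f : Coef n} {B : ℝ} (hf : IsHamCoef f B) (u : Gevrey ρ θ) :
    Summable fun j => f j * ∏ k, coord u (j k) := summable_monomial hf.bound fun _ => u

theorem evalC_add {n : ℕ} {f g : Coef n} {A B : ℝ} (hf : IsHamCoef f A) (hg : IsHamCoef g B)
    (u : Gevrey ρ θ) : evalC ρ θ (f + g) u = evalC ρ θ f u + evalC ρ θ g u := by
  rw [evalC_eq_tsum (hf.add hg), evalC_eq_tsum hf, evalC_eq_tsum hg,
    ← (summable_evalC_terms hf u).tsum_add (summable_evalC_terms hg u)]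
  exact tsum_congr fun j => add_mul _ _ _

theorem evalC_smul {n : ℕ} {f : Coef n} {A : ℝ} (hf : IsHamCoef f A) (c : ℝ)
    (u : Gevrey ρ θ) : evalC ρ θ (c • f) u = c * evalC ρ θ f u := by
  rw [evalC_eq_tsum (hf.smul c), evalC_eq_tsum hf, ← tsum_mul_left]
  refine tsum_congr fun j => ?_
  rw [Pi.smul_apply, Complex.real_smul, mul_assoc]

theorem evalC_zero {n : ℕ} (u : Gevrey ρ θ) : evalC ρ θ (0 : Coef n) u = 0 := by
  rw [evalC_eq_tsum isHamCoef_zero]; simp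

theorem evalC_sum {ι : Type*} (s : Finset ι) {n : ℕ} {f : ι → Coef n} {B : ι → ℝ}
    (hf : ∀ i ∈ s, IsHamCoef (f i) (B i)) (u : Gevrey ρ θ) :
    evalC ρ θ (∑ i ∈ s, f i) u = ∑ i ∈ s, evalC ρ θ (f i) u := by
  classical
  induction s using Finset.induction_on with
  | empty => simp [evalC_zero]
  | insert i s hi ih =>
    rw [Finset.sum_insert hi, Finset.sum_insert hi, ← ih fun k hk => hf k (Finset.mem_insert_of_mem hk)]
    exact evalC_add (hf i (Finset.mem_insert_self _ _))
      (IsHamCoef.sum s fun k hk => hf k (Finset.mem_insert_of_mem hk)) u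

variable (ρ θ) in
/-- The value of the formal sum `F` at `u`. -/
def evalGraded (F : Graded) (u : Gevrey ρ θ) : ℂ := ∑' k, evalC ρ θ (F k) u

theorem natCast_add_le (k : ℕ) : ((2 * k + 1 : ℕ) : ℝ) + 1 ≤ 2 * 2 ^ k := by
  have : k + 1 ≤ 2 ^ k := Nat.lt_two_pow_self
  have h : ((k : ℝ) + 1) ≤ 2 ^ k := by exact_mod_cast this
  push_cast; linarith

theorem pow_arity (t x : ℝ) (k : ℕ) : t ^ k * x ^ (2 * k + 1) = x * (t * x ^ 2) ^ k := by
  rw [mul_pow, ← pow_mul, pow_succ]; ring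

variable {F : Graded} {A t : ℝ}

theorem norm_evalC_grade_le (hA : 0 ≤ A) (ht : 0 ≤ t) (hF : ∀ k, IsHamCoef (F k) (A * t ^ k))
    {u : Gevrey ρ θ} {q : ℝ} (hq : t * (algConst ρ θ * ‖u‖) ^ 2 ≤ q) (k : ℕ) :
    ‖evalC ρ θ (F k) u‖ ≤ A * (algConst ρ θ * ‖u‖) ^ 2 * q ^ k := by
  have ha := algConst_pos ρ θ
  refine (norm_evalC_le (hF k) u).trans ?_
  calc A * t ^ k * (algConst ρ θ * ‖u‖) ^ (2 * k + 1 + 1)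
      = A * (algConst ρ θ * ‖u‖) ^ 2 * (t * (algConst ρ θ * ‖u‖) ^ 2) ^ k := by
        rw [pow_succ, mul_assoc A, ← mul_assoc (t ^ k), pow_arity]; ring
    _ ≤ _ := by gcongr

theorem summable_evalC (hA : 0 ≤ A) (ht : 0 ≤ t) (hF : ∀ k, IsHamCoef (F k) (A * t ^ k))
    {u : Gevrey ρ θ} (hu : t * (algConst ρ θ * ‖u‖) ^ 2 ≤ 1 / 2) :
    Summable fun k => ‖evalC ρ θ (F k) u‖ :=
  Summable.of_nonneg_of_le (fun _ => norm_nonneg _) (norm_evalC_grade_le hA ht hF hu)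
    (summable_geometric_two.mul_left _)

theorem norm_evalGraded_le (hA : 0 ≤ A) (ht : 0 ≤ t) (hF : ∀ k, IsHamCoef (F k) (A * t ^ k))
    {u : Gevrey ρ θ} (hu : t * (algConst ρ θ * ‖u‖) ^ 2 ≤ 1 / 2) :
    ‖evalGraded ρ θ F u‖ ≤ A * (2 * (algConst ρ θ * ‖u‖) ^ 2) := by
  refine (tsum_of_norm_bounded (hasSum_geometric_two.mul_left _)
    (norm_evalC_grade_le hA ht hF hu)).trans (le_of_eq ?_)
  ring

theorem norm_evalDeriv_grade_le (hA : 0 ≤ A) (ht : 0 ≤ t)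
    (hF : ∀ k, IsHamCoef (F k) (A * t ^ k)) {u : Gevrey ρ θ} {R : ℝ} (hu : ‖u‖ ≤ R)
    (hR : t * (algConst ρ θ * R) ^ 2 ≤ 1 / 4) (k : ℕ) :
    ‖evalDeriv (F k) u‖ ≤ 2 * A * algConst ρ θ * (algConst ρ θ * R) * (1 / 2) ^ k := by
  have ha := algConst_pos ρ θ
  have hR0 : 0 ≤ R := (norm_nonneg _).trans hu
  refine (norm_evalDeriv_le (hF k) u).trans ?_
  rw [Nat.add_sub_cancel]
  calc ((2 * k + 1 + 1 : ℕ) : ℝ) * (A * t ^ k * algConst ρ θ ^ (2 * k + 1 + 1)) * ‖u‖ ^ (2 * k + 1)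
      ≤ (2 * 2 ^ k) * (A * t ^ k * algConst ρ θ ^ (2 * k + 1 + 1)) * R ^ (2 * k + 1) := by
        have := natCast_add_le k
        push_cast at this ⊢
        gcongr
    _ = 2 * A * algConst ρ θ * (2 ^ k * (t ^ k * (algConst ρ θ * R) ^ (2 * k + 1))) := by
        rw [pow_succ (algConst ρ θ), mul_pow]; ring
    _ = 2 * A * algConst ρ θ * (algConst ρ θ * R) * (2 * (t * (algConst ρ θ * R) ^ 2)) ^ k := by
        rw [pow_arity, mul_pow 2]; ring
    _ ≤ _ := by
        gcongr
        linarith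

theorem summable_evalDeriv (hA : 0 ≤ A) (ht : 0 ≤ t)
    (hF : ∀ k, IsHamCoef (F k) (A * t ^ k)) {u : Gevrey ρ θ}
    (hu : t * (algConst ρ θ * ‖u‖) ^ 2 ≤ 1 / 4) : Summable fun k => ‖evalDeriv (F k) u‖ :=
  Summable.of_nonneg_of_le (fun _ => norm_nonneg _) (norm_evalDeriv_grade_le hA ht hF le_rfl hu)
    (summable_geometric_two.mul_left _)

theorem hasFDerivAt_evalGraded (hA : 0 ≤ A) (ht : 0 ≤ t)
    (hF : ∀ k, IsHamCoef (F k) (A * t ^ k)) {R : ℝ}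
    (hR : t * (algConst ρ θ * R) ^ 2 ≤ 1 / 4) {u : Gevrey ρ θ} (hu : ‖u‖ < R) :
    HasFDerivAt (evalGraded ρ θ F) (∑' k, evalDeriv (F k) u) u := by
  have ha := algConst_pos ρ θ
  have hR0 : 0 < R := (norm_nonneg _).trans_lt hu
  refine hasFDerivAt_tsum_of_isPreconnected
    (summable_geometric_two.mul_left (2 * A * algConst ρ θ * (algConst ρ θ * R)))
    Metric.isOpen_ball (convex_ball (0 : Gevrey ρ θ) R).isPreconnected
    (fun k y _ => hasFDerivAt_evalC (F k) y) (fun k y hy => ?_) (Metric.mem_ball_self hR0)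
    ?_ (by simpa using hu)
  · exact norm_evalDeriv_grade_le hA ht hF (by simpa using (mem_ball_zero_iff.1 hy).le) hR k
  · exact (summable_evalC hA ht hF (by simp)).of_norm

theorem norm_hamVec_grade_le (hA : 0 ≤ A) (ht : 0 ≤ t)
    (hF : ∀ k, IsHamCoef (F k) (A * t ^ k)) {u : Gevrey ρ θ} {q : ℝ}
    (hq : 2 * (t * (algConst ρ θ * ‖u‖) ^ 2) ≤ q) (k : ℕ) :
    ‖hamVec ρ θ (F k) u‖ ≤ 2 * A * (algConst ρ θ * ‖u‖) * q ^ k := by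
  have ha := algConst_pos ρ θ
  refine (norm_hamVec_le (hF k) u).trans ?_
  calc (((2 * k + 1 : ℕ) : ℝ) + 1) * (A * t ^ k) * (algConst ρ θ * ‖u‖) ^ (2 * k + 1)
      ≤ (2 * 2 ^ k) * (A * t ^ k) * (algConst ρ θ * ‖u‖) ^ (2 * k + 1) := by
        gcongr
        exact natCast_add_le k
    _ = 2 * A * (2 ^ k * (t ^ k * (algConst ρ θ * ‖u‖) ^ (2 * k + 1))) := by ring
    _ = 2 * A * (algConst ρ θ * ‖u‖) * (2 * (t * (algConst ρ θ * ‖u‖) ^ 2)) ^ k := by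
        rw [pow_arity, mul_pow 2]; ring
    _ ≤ _ := by gcongr

/-! ### The Lie series -/

variable {χ : Graded} {m : ℕ}

variable (ρ θ) in
/-- The Hamiltonian vector field of the terms of the generator `χ` of index less than `m`. -/
def genField (m : ℕ) (χ : Graded) : Gevrey ρ θ → Gevrey ρ θ :=
  polyField (Finset.range m) fun k => vecL ρ θ (hamCoef (χ k))

theorem genField_apply (u : Gevrey ρ θ) :
    genField ρ θ m χ u = ∑ k ∈ Finset.range m, hamVec ρ θ (χ k) u := rfl

/-- The derivative of the sum of `F` along the Hamiltonian vector field of `χ` is the sum of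
`{F, χ}`: a rearrangement of a double series. -/
theorem evalGraded_ad {B : ℕ → ℝ} (hA : 0 ≤ A) (ht : 0 ≤ t)
    (hF : ∀ k, IsHamCoef (F k) (A * t ^ k)) (hχ : ∀ k, IsHamCoef (χ k) (B k))
    (hχm : ∀ k, m ≤ k → χ k = 0) {u : Gevrey ρ θ}
    (hu : t * (algConst ρ θ * ‖u‖) ^ 2 ≤ 1 / 4) :
    (∑' k, evalDeriv (F k) u) (genField ρ θ m χ u) = evalGraded ρ θ (ad χ F) u := by
  have hs := summable_evalDeriv hA ht hF hu
  have hX0 : ∀ i ∉ Finset.range m, hamVec ρ θ (χ i) u = 0 := by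
    intro i hi
    have h0 : IsHamCoef (χ i) 0 := by
      rw [hχm i (by simpa using hi)]; exact isHamCoef_zero
    exact norm_le_zero_iff.1 ((norm_hamVec_le h0 u).trans (by simp))
  have hXs : Summable fun i => ‖hamVec ρ θ (χ i) u‖ :=
    summable_of_ne_finset_zero fun i hi => by rw [hX0 i hi, norm_zero]
  have hX : genField ρ θ m χ u = ∑' i, hamVec ρ θ (χ i) u := by
    rw [genField_apply, tsum_eq_sum hX0]
  have hd : Summable fun x : ℕ × ℕ => evalDeriv (F x.1) u (hamVec ρ θ (χ x.2) u) := by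
    refine Summable.of_norm_bounded (hs.mul_of_nonneg hXs (fun _ => norm_nonneg _)
      fun _ => norm_nonneg _) fun x => ?_
    exact ContinuousLinearMap.le_opNorm _ _
  have e1 : (∑' k, evalDeriv (F k) u) (genField ρ θ m χ u) =
      ∑' x : ℕ × ℕ, evalDeriv (F x.1) u (hamVec ρ θ (χ x.2) u) := by
    rw [hd.tsum_prod, hX,
      ← ContinuousLinearMap.apply_apply (𝕜 := ℝ) (∑' i, hamVec ρ θ (χ i) u) (∑' k, evalDeriv (F k) u),
      ContinuousLinearMap.map_tsum _ hs.of_norm]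
    refine tsum_congr fun k => ?_
    rw [ContinuousLinearMap.apply_apply, ContinuousLinearMap.map_tsum _ hXs.of_norm]
  rw [e1, ← Finset.HasAntidiagonal.sigmaAntidiagonalEquivProd.tsum_eq]
  have hd' := Finset.HasAntidiagonal.sigmaAntidiagonalEquivProd.summable_iff.2 hd
  refine (Summable.tsum_sigma' (fun k => (hasSum_fintype _).summable) hd').trans ?_
  refine tsum_congr fun k => ?_
  rw [tsum_fintype, ad]
  have hb : ∀ i : Fin (k + 1), IsHamCoef (bracket (p := 2 * (k - i) + 1) (q := 2 * i + 1)
      (N := 2 * k + 1 + 1) (by omega) (F (k - i)) (χ i)) _ := fun i =>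
    isHamCoef_bracket _ (hF (k - i)) (hχ i)
  rw [evalC_sum Finset.univ fun i _ => hb i]
  refine Eq.trans ?_ (Finset.sum_congr rfl fun (i : Fin (k + 1)) _ =>
    evalDeriv_hamVec _ (hF (k - i)) (hχ i) u)
  rw [Fin.sum_univ_eq_sum_range
      (fun i => evalDeriv (F (k - i)) u (hamVec ρ θ (χ i) u)) (k + 1)]
  refine Eq.trans ?_ (Finset.Nat.sum_antidiagonal_eq_sum_range_succ
    (fun a b => evalDeriv (F b) u (hamVec ρ θ (χ a) u)) k)
  rw [← Finset.Nat.sum_antidiagonal_swap]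
  exact Finset.sum_attach (Finset.HasAntidiagonal.antidiagonal k)
    fun x => evalDeriv (F x.1) u (hamVec ρ θ (χ x.2) u)

end

/-- A Taylor expansion with the derivatives of all orders prescribed. -/
theorem tendsto_taylor_of_hasDerivAt {h : ℕ → ℝ → ℂ} {B : ℝ}
    (hd : ∀ n, ∀ t ∈ Set.Icc (0 : ℝ) 1, HasDerivAt (h n) (h (n + 1) t) t)
    (hb : ∀ n, ∀ t ∈ Set.Icc (0 : ℝ) 1, ‖h (n + 1) t‖ ≤ B * (n + 1)! * (1 / 2) ^ n) :
    Filter.Tendsto (fun N => ∑ n ∈ Finset.range N, (n ! : ℂ)⁻¹ * h n 0) Filter.atTop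
      (nhds (h 0 1)) := by
  let ψ : ℕ → ℝ → ℂ := fun N t => ∑ n ∈ Finset.range (N + 1), (n ! : ℂ)⁻¹ * ((1 - t : ℂ) ^ n * h n t)
  have hψ : ∀ N, ∀ t ∈ Set.Icc (0 : ℝ) 1,
      HasDerivAt (ψ N) ((N ! : ℂ)⁻¹ * ((1 - t : ℂ) ^ N * h (N + 1) t)) t := by
    intro N t ht
    have hl : ∀ n : ℕ, HasDerivAt (fun t : ℝ => (1 - t : ℂ) ^ (n + 1))
        (-((n + 1 : ℂ) * (1 - t) ^ n)) t := by
      intro n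
      have h1 : HasDerivAt (fun t : ℝ => (1 - t : ℂ)) (-1) t := by
        simpa using (Complex.ofRealCLM.hasDerivAt (x := t)).const_sub 1
      refine (h1.pow (n + 1)).congr_deriv ?_
      push_cast; simp
    induction N with
    | zero => simpa [ψ] using hd 0 t ht
    | succ N ih =>
      have h1 := ih.add (((hl N).mul (hd (N + 1) t ht)).const_mul (((N + 1)! : ℂ)⁻¹))
      have e : ψ (N + 1) = fun t => ψ N t +
          (((N + 1)! : ℂ)⁻¹) * ((1 - t : ℂ) ^ (N + 1) * h (N + 1) t) := by
        funext t; simp only [ψ]; rw [Finset.sum_range_succ _ (N + 1)]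
      rw [e]
      refine h1.congr_deriv ?_
      rw [Nat.factorial_succ]
      have hN : ((N : ℂ) + 1) ≠ 0 := by exact_mod_cast Nat.succ_ne_zero N
      have hN' : (N ! : ℂ) ≠ 0 := by exact_mod_cast Nat.factorial_ne_zero N
      push_cast
      field_simp
      ring
  have h0 : ∀ N, ψ N 0 = ∑ n ∈ Finset.range (N + 1), (n ! : ℂ)⁻¹ * h n 0 := by
    intro N; simp [ψ]
  have h1 : ∀ N, ψ N 1 = h 0 1 := by
    intro N
    simp only [ψ]
    rw [Finset.sum_range_succ']
    simp
  have hle : ∀ N, ‖(∑ n ∈ Finset.range (N + 1), (n ! : ℂ)⁻¹ * h n 0) - h 0 1‖ ≤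
      B * ((N + 1) * (1 / 2) ^ N) := by
    intro N
    rw [← h0, ← h1 N, norm_sub_rev]
    refine norm_image_sub_le_of_norm_deriv_le_segment_01'
      (fun t ht => (hψ N t ht).hasDerivWithinAt) fun t ht => ?_
    have ht' : t ∈ Set.Icc (0 : ℝ) 1 := ⟨ht.1, ht.2.le⟩
    have e1 : ‖(1 - t : ℂ)‖ ≤ 1 := by
      have : (1 - t : ℂ) = ((1 - t : ℝ) : ℂ) := by push_cast; rfl
      rw [this, Complex.norm_real, Real.norm_eq_abs, abs_of_nonneg (by linarith [ht.2])]
      linarith [ht.1]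
    rw [norm_mul, norm_mul, norm_inv, norm_pow, Complex.norm_natCast]
    have hN' : (N ! : ℝ) ≠ 0 := by exact_mod_cast Nat.factorial_ne_zero N
    calc (N ! : ℝ)⁻¹ * (‖(1 - t : ℂ)‖ ^ N * ‖h (N + 1) t‖)
        ≤ (N ! : ℝ)⁻¹ * (1 * (B * (N + 1)! * (1 / 2) ^ N)) := by
          gcongr
          · exact pow_le_one₀ (norm_nonneg _) e1
          · exact hb N t ht'
      _ = _ := by
          rw [Nat.factorial_succ]; push_cast; field_simp
  rw [← Filter.tendsto_add_atTop_iff_nat 1, tendsto_iff_norm_sub_tendsto_zero]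
  refine squeeze_zero (fun _ => norm_nonneg _) hle ?_
  have h2 := tendsto_self_mul_const_pow_of_lt_one (r := (1 / 2 : ℝ)) (by norm_num) (by norm_num)
  have h3 := tendsto_pow_atTop_nhds_zero_of_lt_one (r := (1 / 2 : ℝ)) (by norm_num) (by norm_num)
  have h4 := (h2.add h3).const_mul B
  rw [add_zero, mul_zero] at h4
  refine h4.congr fun N => ?_
  ring

end

/-! ### Growth and convergence of the Lie series -/

section

open scoped Nat

variable {ρ θ : ℝ}

section

variable {P χ : Graded} {C₀ : ℝ} {m : ℕ}

theorem sum_half_pow_le (N : ℕ) : ∑ n ∈ Finset.range N, (1 / 2 : ℝ) ^ n ≤ 2 :=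
  (summable_geometric_two.sum_le_tsum _ fun n _ => by positivity).trans tsum_geometric_two.le

theorem sum_half_pow_pos_le (N : ℕ) :
    ∑ k ∈ Finset.range N, (if k = 0 then 0 else (1 / 2 : ℝ) ^ k) ≤ 1 := by
  have h4 := sum_half_pow_le (N + 1)
  rw [Finset.sum_range_succ'] at h4
  rcases N with _ | N
  · simp
  · rw [Finset.sum_range_succ']
    simp only [Nat.succ_ne_zero, if_false, if_true]
    rw [Finset.sum_range_succ] at h4
    have : (0 : ℝ) ≤ (1 / 2) ^ (N + 1) := by positivity
    linarith

/-- The powers of `k / (2 m)` produced by `n` brackets are absorbed by `n!` and by a factor `3 ^ k`. -/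
theorem pow_div_le (n k : ℕ) {m : ℕ} (hm : 0 < m) :
    ((k : ℝ) / (2 * m)) ^ n ≤ n ! * (1 / 2) ^ n * 3 ^ k := by
  have hm' : (1 : ℝ) ≤ m := by exact_mod_cast hm
  have h1 : (k : ℝ) ^ n / n ! ≤ Real.exp k := Real.pow_div_factorial_le_exp _ (Nat.cast_nonneg k) n
  have h2 : Real.exp k ≤ 3 ^ k := by
    rw [← mul_one (k : ℝ), Real.exp_nat_mul]
    exact pow_le_pow_left₀ (Real.exp_pos _).le Real.exp_one_lt_three.le k
  have h3 : (0 : ℝ) < n ! := by exact_mod_cast n.factorial_pos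
  rw [div_le_iff₀ h3] at h1
  calc ((k : ℝ) / (2 * m)) ^ n ≤ ((k : ℝ) / (2 * 1)) ^ n := by gcongr
    _ = k ^ n * (1 / 2) ^ n := by rw [mul_one, div_eq_mul_one_div, mul_pow]
    _ ≤ (3 ^ k * n !) * (1 / 2) ^ n := by
        gcongr
        exact h1.trans (by gcongr)
    _ = _ := by ring

theorem inv_eight_cube_le {m : ℕ} (hm : 0 < m) : (8 * (m : ℝ) ^ 3)⁻¹ ≤ 1 / 8 := by
  have hm' : (1 : ℝ) ≤ m := by exact_mod_cast hm
  have := one_le_pow₀ hm' (n := 3)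
  rw [one_div]
  exact inv_anti₀ (by norm_num) (by linarith)

theorem IsNormalizing.isHam_iterate_P_weak (h : IsNormalizing P C₀ m χ) (hC : 1 ≤ C₀) (hm : 0 < m)
    (hP0 : P 0 = 0) (hP : ∀ k, IsHamCoef (P k) (C₀ ^ k)) (n k : ℕ) :
    IsHamCoef ((ad χ)^[n] P k) (1 / 8 * n ! * (1 / 2) ^ n * (24 * m ^ 3 * C₀) ^ k) := by
  refine (h.isHam_iterate_P hC hm hP0 hP n k).mono ?_
  calc _ ≤ 1 / 8 * (8 * m ^ 3 * C₀) ^ k * (n ! * (1 / 2) ^ n * 3 ^ k) := by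
        gcongr
        · exact inv_eight_cube_le hm
        · exact pow_div_le n k hm
    _ = 1 / 8 * n ! * (1 / 2) ^ n * (3 * (8 * m ^ 3 * C₀)) ^ k := by rw [mul_pow 3]; ring
    _ = _ := by ring_nf

theorem IsNormalizing.isHam_iterate_freqMul_weak (h : IsNormalizing P C₀ m χ) (hC : 1 ≤ C₀)
    (hm : 0 < m) (n k : ℕ) :
    IsHamCoef ((ad χ)^[n] (freqMul χ) k)
      (1 / 8 * n ! * (1 / 2) ^ n * (24 * m ^ 3 * C₀) ^ k) := by
  refine (h.isHam_iterate_freqMul hC hm n k).mono ?_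
  calc _ ≤ 1 / 8 * (8 * m ^ 3 * C₀) ^ k * (n ! * (1 / 2) ^ n * 3 ^ k) := by
        gcongr
        · exact inv_eight_cube_le hm
        · exact pow_div_le n k hm
    _ = 1 / 8 * n ! * (1 / 2) ^ n * (3 * (8 * m ^ 3 * C₀)) ^ k := by rw [mul_pow 3]; ring
    _ = _ := by ring_nf

theorem abs_inv_factorial_mul (n : ℕ) : |(n ! : ℝ)⁻¹| * n ! = 1 := by
  have : (n ! : ℝ) ≠ 0 := by exact_mod_cast n.factorial_ne_zero
  rw [abs_of_nonneg (by positivity), inv_mul_cancel₀ this]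

theorem inv_factorial_succ_mul_le (n : ℕ) : |((n + 1)! : ℝ)⁻¹| * n ! ≤ 1 := by
  rw [abs_of_nonneg (by positivity)]
  have h : (0 : ℝ) < (n + 1)! := by exact_mod_cast (n + 1).factorial_pos
  rw [inv_mul_le_iff₀ h, mul_one]
  exact_mod_cast Nat.factorial_le (Nat.le_succ n)

theorem IsNormalizing.isHam_term (h : IsNormalizing P C₀ m χ) (hC : 1 ≤ C₀) (hm : 0 < m)
    (hP0 : P 0 = 0) (hP : ∀ k, IsHamCoef (P k) (C₀ ^ k)) (n k : ℕ) :
    IsHamCoef ((n ! : ℝ)⁻¹ • (ad χ)^[n] P k + ((n + 1)! : ℝ)⁻¹ • (ad χ)^[n] (freqMul χ) k)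
      (1 / 4 * (1 / 2) ^ n * (24 * m ^ 3 * C₀) ^ k) := by
  refine (((h.isHam_iterate_P_weak hC hm hP0 hP n k).smul _).add
    ((h.isHam_iterate_freqMul_weak hC hm n k).smul _)).mono ?_
  have e1 := abs_inv_factorial_mul n
  have e2 := inv_factorial_succ_mul_le n
  have e3 : (0 : ℝ) ≤ 1 / 8 * (1 / 2) ^ n * (24 * m ^ 3 * C₀) ^ k := by positivity
  calc _ = (|(n ! : ℝ)⁻¹| * n !) * (1 / 8 * (1 / 2) ^ n * (24 * m ^ 3 * C₀) ^ k) +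
        (|((n + 1)! : ℝ)⁻¹| * n !) * (1 / 8 * (1 / 2) ^ n * (24 * m ^ 3 * C₀) ^ k) := by ring
    _ ≤ 1 * (1 / 8 * (1 / 2) ^ n * (24 * m ^ 3 * C₀) ^ k) +
        1 * (1 / 8 * (1 / 2) ^ n * (24 * m ^ 3 * C₀) ^ k) := by gcongr; exact e1.le
    _ = _ := by ring

/-- The Lie series grows geometrically in all degrees, beyond those that are normalized. -/
theorem IsNormalizing.isHam_lieSeries_all (h : IsNormalizing P C₀ m χ) (hC : 1 ≤ C₀) (hm : 0 < m)
    (hP0 : P 0 = 0) (hP : ∀ k, IsHamCoef (P k) (C₀ ^ k)) (k : ℕ) :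
    IsHamCoef (lieSeries P χ k) (1 * (24 * m ^ 3 * C₀) ^ k) := by
  refine (IsHamCoef.sum (Finset.range (k + 1)) fun n _ => h.isHam_term hC hm hP0 hP n k).mono ?_
  rw [← Finset.sum_mul, ← Finset.mul_sum]
  have := sum_half_pow_le (k + 1)
  gcongr
  linarith

/-- The generator has no terms of degree less than four, hence its vector field is cubic. -/
theorem IsNormalizing.isHam_add_one (h : IsNormalizing P C₀ m χ) (hC : 1 ≤ C₀) {k : ℕ}
    (hk : k + 1 < m) : IsHamCoef (χ (k + 1)) (C₀ * (8 * m ^ 3 * C₀) ^ k) := by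
  refine (h.isHam (k + 1)).mono ?_
  rw [coefBound, Nat.add_sub_cancel]
  calc (8 * ((k + 1 : ℕ) : ℝ) ^ 3) ^ k * C₀ ^ (k + 1)
      ≤ (8 * (m : ℝ) ^ 3) ^ k * C₀ ^ (k + 1) := by gcongr
    _ = _ := by rw [mul_pow _ C₀]; ring

variable [hI : GevreyIndex ρ θ]

/-- The smallness of the radius `R` that makes all the series converge. -/
structure IsSmallRadius (ρ θ : ℝ) [GevreyIndex ρ θ] (C₀ : ℝ) (m : ℕ) (R : ℝ) : Prop where
  ratio_le : 24 * m ^ 3 * C₀ * (algConst ρ θ * R) ^ 2 ≤ 1 / 8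
  deriv_le : 192 * C₀ * algConst ρ θ ^ 3 * R ^ 2 ≤ 1

theorem IsNormalizing.norm_genField_le (h : IsNormalizing P C₀ m χ) (hC : 1 ≤ C₀) {R : ℝ}
    (hR : IsSmallRadius ρ θ C₀ m R) {u : Gevrey ρ θ} (hu : ‖u‖ ≤ R) :
    ‖genField ρ θ m χ u‖ ≤ 8 * C₀ * algConst ρ θ ^ 3 * ‖u‖ ^ 3 := by
  have ha := algConst_pos ρ θ
  have hx : 8 * m ^ 3 * C₀ * (algConst ρ θ * ‖u‖) ^ 2 ≤ 1 / 24 := by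
    have h1 := hR.ratio_le
    have h2 : 8 * m ^ 3 * C₀ * (algConst ρ θ * ‖u‖) ^ 2 ≤ 8 * m ^ 3 * C₀ * (algConst ρ θ * R) ^ 2 := by
      gcongr
    linarith
  rw [genField_apply]
  refine (norm_sum_le _ _).trans ?_
  have hterm : ∀ k ∈ Finset.range m, ‖hamVec ρ θ (χ k) u‖ ≤
      if k = 0 then 0 else 8 * C₀ * (algConst ρ θ * ‖u‖) ^ 3 * (1 / 2) ^ k := by
    intro k hk
    rcases k with _ | k
    · rw [if_pos rfl, h.zero]
      exact (norm_hamVec_le isHamCoef_zero u).trans (by simp)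
    · rw [if_neg (Nat.succ_ne_zero k)]
      refine (norm_hamVec_le (h.isHam_add_one hC (Finset.mem_range.1 hk)) u).trans ?_
      calc _ ≤ (2 * 2 ^ (k + 1)) * (C₀ * (8 * m ^ 3 * C₀) ^ k) *
            (algConst ρ θ * ‖u‖) ^ (2 * (k + 1) + 1) := by
            gcongr
            exact natCast_add_le (k + 1)
        _ = 4 * C₀ * (algConst ρ θ * ‖u‖) ^ 2 * (2 ^ k * ((8 * m ^ 3 * C₀) ^ k *
            (algConst ρ θ * ‖u‖) ^ (2 * k + 1))) := by
            rw [show 2 * (k + 1) + 1 = 2 * k + 1 + 2 by ring]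
            generalize algConst ρ θ * ‖u‖ = y
            generalize (8 * (m : ℝ) ^ 3 * C₀) ^ k = z
            ring
        _ = 4 * C₀ * (algConst ρ θ * ‖u‖) ^ 3 *
            (2 * (8 * m ^ 3 * C₀ * (algConst ρ θ * ‖u‖) ^ 2)) ^ k := by
            rw [pow_arity, mul_pow 2]; ring
        _ ≤ 4 * C₀ * (algConst ρ θ * ‖u‖) ^ 3 * (1 / 2) ^ k := by
            gcongr
            linarith
        _ = _ := by rw [pow_succ (1 / 2 : ℝ)]; ring
  refine (Finset.sum_le_sum hterm).trans ?_
  have h2 : ∀ k, (if k = 0 then 0 else 8 * C₀ * (algConst ρ θ * ‖u‖) ^ 3 * (1 / 2) ^ k) =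
      8 * C₀ * (algConst ρ θ * ‖u‖) ^ 3 * (if k = 0 then 0 else (1 / 2 : ℝ) ^ k) := by
    intro k; split_ifs <;> simp
  simp_rw [h2]
  rw [← Finset.mul_sum]
  have h3 := sum_half_pow_pos_le m
  calc _ ≤ 8 * C₀ * (algConst ρ θ * ‖u‖) ^ 3 * 1 := by gcongr
    _ = _ := by ring

theorem IsNormalizing.norm_genField_deriv_le (h : IsNormalizing P C₀ m χ) (hC : 1 ≤ C₀) {R : ℝ}
    (hR : IsSmallRadius ρ θ C₀ m R) {u : Gevrey ρ θ} (hu : ‖u‖ ≤ R) :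
    ‖polyFieldDeriv (Finset.range m) (fun k => vecL ρ θ (hamCoef (χ k))) u‖ ≤ 1 / 8 := by
  have ha := algConst_pos ρ θ
  have hx : 8 * m ^ 3 * C₀ * (algConst ρ θ * ‖u‖) ^ 2 ≤ 1 / 24 := by
    have h1 := hR.ratio_le
    have h2 : 8 * m ^ 3 * C₀ * (algConst ρ θ * ‖u‖) ^ 2 ≤ 8 * m ^ 3 * C₀ * (algConst ρ θ * R) ^ 2 := by
      gcongr
    linarith
  refine (norm_sum_le _ _).trans ?_
  have hterm : ∀ k ∈ Finset.range m, ‖diagDeriv (vecL ρ θ (hamCoef (χ k))) u‖ ≤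
      if k = 0 then 0 else 24 * C₀ * algConst ρ θ ^ 3 * ‖u‖ ^ 2 * (1 / 2) ^ k := by
    intro k hk
    refine (norm_diagDeriv_le _ u).trans ?_
    rcases k with _ | k
    · rw [if_pos rfl]
      have h1 : IsHamCoef (χ 0) 0 := by rw [h.zero]; exact isHamCoef_zero
      have h2 := norm_hamL_le (ρ := ρ) (θ := θ) h1
      rw [mul_zero, zero_mul] at h2
      rw [norm_le_zero_iff.1 h2]; simp
    · rw [if_neg (Nat.succ_ne_zero k), Nat.add_sub_cancel]
      have h1 := norm_hamL_le (ρ := ρ) (θ := θ) (h.isHam_add_one hC (Finset.mem_range.1 hk))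
      have h6 : (2 * (k : ℝ) + 3) * (k + 2) ≤ 6 * 4 ^ k := by
        have h7 : (k : ℝ) + 1 ≤ 2 ^ k := by exact_mod_cast Nat.lt_two_pow_self (n := k)
        have h8 : (4 : ℝ) ^ k = 2 ^ k * 2 ^ k := by rw [← mul_pow]; norm_num
        rw [h8]
        nlinarith [sq_nonneg (k : ℝ)]
      calc ((2 * (k + 1) + 1 : ℕ) : ℝ) * ‖vecL ρ θ (hamCoef (χ (k + 1)))‖ * ‖u‖ ^ (2 * (k + 1))
          ≤ ((2 * (k + 1) + 1 : ℕ) : ℝ) * ((((2 * (k + 1) + 1 : ℕ) : ℝ) + 1) *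
            (C₀ * (8 * m ^ 3 * C₀) ^ k) * algConst ρ θ ^ (2 * (k + 1) + 1)) *
            ‖u‖ ^ (2 * (k + 1)) := by gcongr
        _ = ((2 * (k : ℝ) + 3) * (k + 2)) * (2 * C₀ * algConst ρ θ ^ 3 * ‖u‖ ^ 2 *
            (8 * m ^ 3 * C₀ * (algConst ρ θ * ‖u‖) ^ 2) ^ k) := by
            rw [mul_pow _ ((algConst ρ θ * ‖u‖) ^ 2), ← pow_mul, mul_pow (algConst ρ θ)]
            generalize (8 * (m : ℝ) ^ 3 * C₀) ^ k = z
            push_cast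
            ring
        _ ≤ (6 * 4 ^ k) * (2 * C₀ * algConst ρ θ ^ 3 * ‖u‖ ^ 2 *
            (8 * m ^ 3 * C₀ * (algConst ρ θ * ‖u‖) ^ 2) ^ k) := by gcongr
        _ = 12 * C₀ * algConst ρ θ ^ 3 * ‖u‖ ^ 2 *
            (4 * (8 * m ^ 3 * C₀ * (algConst ρ θ * ‖u‖) ^ 2)) ^ k := by
            rw [mul_pow 4]; ring
        _ ≤ 12 * C₀ * algConst ρ θ ^ 3 * ‖u‖ ^ 2 * (1 / 2) ^ k := by
            gcongr
            linarith
        _ = _ := by rw [pow_succ (1 / 2 : ℝ)]; ring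
  refine (Finset.sum_le_sum hterm).trans ?_
  have h2 : ∀ k, (if k = 0 then 0 else 24 * C₀ * algConst ρ θ ^ 3 * ‖u‖ ^ 2 * (1 / 2) ^ k) =
      24 * C₀ * algConst ρ θ ^ 3 * ‖u‖ ^ 2 * (if k = 0 then 0 else (1 / 2 : ℝ) ^ k) := by
    intro k; split_ifs <;> simp
  simp_rw [h2]
  rw [← Finset.mul_sum]
  have h3 := sum_half_pow_pos_le m
  have h5 := hR.deriv_le
  calc _ ≤ 24 * C₀ * algConst ρ θ ^ 3 * ‖u‖ ^ 2 * 1 := by gcongr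
    _ ≤ 24 * C₀ * algConst ρ θ ^ 3 * R ^ 2 * 1 := by gcongr
    _ ≤ _ := by linarith

/-- The Lie series represents the pullback of `H₀ + P` by the time-one map of the generator. -/
theorem IsNormalizing.pullback_eq (h : IsNormalizing P C₀ m χ) (hC : 1 ≤ C₀) (hm : 0 < m)
    (hP0 : P 0 = 0) (hP : ∀ k, IsHamCoef (P k) (C₀ ^ k)) {R : ℝ}
    (hR : IsSmallRadius ρ θ C₀ m R) {γ : ℝ → Gevrey ρ θ}
    (hγR : ∀ t ∈ Set.Icc (0 : ℝ) 1, ‖γ t‖ < R)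
    (hγ : ∀ t ∈ Set.Icc (0 : ℝ) 1, HasDerivAt γ (genField ρ θ m χ (γ t)) t) :
    (H0 (γ 1) : ℂ) + evalGraded ρ θ P (γ 1) =
      H0 (γ 0) + evalGraded ρ θ (lieSeries P χ) (γ 0) := by
  have ha := algConst_pos ρ θ
  set T : ℝ := 24 * m ^ 3 * C₀ with hT
  have hT0 : 0 ≤ T := by positivity
  set D := freqMul χ with hDdef
  have hbP := h.isHam_iterate_P_weak hC hm hP0 hP
  have hbD := h.isHam_iterate_freqMul_weak hC hm
  have hfac : ∀ n : ℕ, (0 : ℝ) ≤ 1 / 8 * n ! * (1 / 2) ^ n := fun n => by positivity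
  have hsm : T * (algConst ρ θ * R) ^ 2 ≤ 1 / 8 := hR.ratio_le
  have hsmu : ∀ u : Gevrey ρ θ, ‖u‖ ≤ R → T * (algConst ρ θ * ‖u‖) ^ 2 ≤ 1 / 8 := by
    intro u hu
    refine le_trans ?_ hsm
    gcongr
  -- differentiation of a sum along the flow
  have hder : ∀ (F : Graded) (n : ℕ), (∀ k, IsHamCoef (F k) (1 / 8 * n ! * (1 / 2) ^ n * T ^ k)) →
      ∀ t ∈ Set.Icc (0 : ℝ) 1, HasDerivAt (fun t => evalGraded ρ θ F (γ t))
        (evalGraded ρ θ (ad χ F) (γ t)) t := by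
    intro F n hF t ht
    have hγt := hγR t ht
    have h1 := hasFDerivAt_evalGraded (hfac n) hT0 hF (hsm.trans (by norm_num)) hγt
    rw [← evalGraded_ad (hfac n) hT0 hF h.isHam h.eq_zero ((hsmu _ hγt.le).trans (by norm_num))]
    exact h1.comp_hasDerivAt t (hγ t ht)
  have hbound : ∀ (F : Graded) (n : ℕ), (∀ k, IsHamCoef (F k) (1 / 8 * n ! * (1 / 2) ^ n * T ^ k)) →
      ∀ t ∈ Set.Icc (0 : ℝ) 1, ‖evalGraded ρ θ F (γ t)‖ ≤
        (algConst ρ θ * R) ^ 2 * n ! * (1 / 2) ^ n := by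
    intro F n hF t ht
    have hγt := hγR t ht
    refine (norm_evalGraded_le (hfac n) hT0 hF ((hsmu _ hγt.le).trans (by norm_num))).trans ?_
    have h1 : (algConst ρ θ * ‖γ t‖) ^ 2 ≤ (algConst ρ θ * R) ^ 2 := by gcongr
    have h2 : (0 : ℝ) ≤ n ! * (1 / 2) ^ n := by positivity
    nlinarith [mul_nonneg h2 (sq_nonneg (algConst ρ θ * R)), mul_le_mul_of_nonneg_left h1 h2]
  -- the expansion of `P`
  have hTP := tendsto_taylor_of_hasDerivAt (h := fun n t => evalGraded ρ θ ((ad χ)^[n] P) (γ t))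
    (B := (algConst ρ θ * R) ^ 2) (fun n t ht => by
      have := hder _ n (hbP n) t ht
      rwa [← Function.iterate_succ_apply' (ad χ)] at this) (fun n t ht => by
      refine (hbound _ (n + 1) (hbP (n + 1)) t ht).trans ?_
      rw [pow_succ (1 / 2 : ℝ)]
      have : (0 : ℝ) ≤ (algConst ρ θ * R) ^ 2 * (n + 1)! * (1 / 2) ^ n := by positivity
      linarith)
  -- the expansion of `H₀`
  have hTH := tendsto_taylor_of_hasDerivAt (h := fun n t => match n with
      | 0 => (H0 (γ t) : ℂ)
      | n + 1 => evalGraded ρ θ ((ad χ)^[n] D) (γ t))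
    (B := (algConst ρ θ * R) ^ 2) (fun n t ht => by
      rcases n with _ | n
      · simp only [Function.iterate_zero, id]
        have h1 := (hasFDerivAt_H0 (γ t)).comp_hasDerivAt t (hγ t ht)
        refine h1.congr_deriv ?_
        rw [genField_apply, map_sum]
        have e : ∀ k, H0Deriv (γ t) (hamVec ρ θ (χ k) (γ t)) = evalC ρ θ (D k) (γ t) :=
          fun k => H0Deriv_hamVec (h.isHam k) (h.isHam_freqMul k).bound (fun j => rfl) _
        simp_rw [e]
        rw [evalGraded, tsum_eq_sum fun k hk => ?_]
        rw [hDdef, freqMul_zero (h.eq_zero k (by simpa using hk)), evalC_zero]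
      · have := hder _ n (hbD n) t ht
        rwa [← Function.iterate_succ_apply' (ad χ)] at this) (fun n t ht => by
      refine (hbound _ n (hbD n) t ht).trans ?_
      gcongr
      omega)
  set z := γ 0 with hz
  have hzR : ‖z‖ < R := hγR 0 (by simp)
  have hz8 := hsmu z hzR.le
  -- both expansions as one double series
  let S : ℕ → ℕ → ℂ := fun n k => evalC ρ θ
    ((n ! : ℝ)⁻¹ • (ad χ)^[n] P k + ((n + 1)! : ℝ)⁻¹ • (ad χ)^[n] D k) z
  have hS : ∀ n k, ‖S n k‖ ≤ (1 / 2) ^ n * ((1 / 4 * (algConst ρ θ * ‖z‖) ^ 2) * (1 / 2) ^ k) := by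
    intro n k
    refine (norm_evalC_grade_le (A := 1 / 4 * (1 / 2) ^ n) (q := 1 / 2) (by positivity) hT0
      (F := fun k => (n ! : ℝ)⁻¹ • (ad χ)^[n] P k + ((n + 1)! : ℝ)⁻¹ • (ad χ)^[n] D k)
      (h.isHam_term hC hm hP0 hP n) (hz8.trans (by norm_num)) k).trans (le_of_eq ?_)
    ring
  have hSs : Summable (Function.uncurry S) := by
    refine Summable.of_norm_bounded (Summable.mul_of_nonneg summable_geometric_two
      (summable_geometric_two.mul_left (1 / 4 * (algConst ρ θ * ‖z‖) ^ 2))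
      (fun n => by positivity) (fun n => by positivity)) fun x => hS x.1 x.2
  have hSn : ∀ n, ∑' k, S n k = (n ! : ℂ)⁻¹ * evalGraded ρ θ ((ad χ)^[n] P) z +
      ((n + 1)! : ℂ)⁻¹ * evalGraded ρ θ ((ad χ)^[n] D) z := by
    intro n
    have s1 := (summable_evalC (hfac n) hT0 (hbP n) (hz8.trans (by norm_num))).of_norm
    have s2 := (summable_evalC (hfac n) hT0 (hbD n) (hz8.trans (by norm_num))).of_norm
    rw [evalGraded, evalGraded, ← tsum_mul_left, ← tsum_mul_left,
      ← (s1.mul_left _).tsum_add (s2.mul_left _)]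
    refine tsum_congr fun k => ?_
    simp only [S]
    rw [evalC_add ((hbP n k).smul _) ((hbD n k).smul _), evalC_smul (hbP n k), evalC_smul (hbD n k)]
    push_cast; rfl
  have hSk : ∀ k, ∑' n, S n k = evalC ρ θ (lieSeries P χ k) z := by
    intro k
    rw [lieSeries, evalC_sum (Finset.range (k + 1)) fun n _ => h.isHam_term hC hm hP0 hP n k]
    refine tsum_eq_sum fun n hn => ?_
    have hkn : k ≤ n := by simp at hn; omega
    simp only [S]
    rw [iterate_ad_eq_zero h.zero hP0 hkn, iterate_ad_eq_zero h.zero (freqMul_zero h.zero) hkn,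
      smul_zero, smul_zero, add_zero, evalC_zero]
  have hlim := hTP.add ((Filter.tendsto_add_atTop_iff_nat 1).2 hTH)
  have hfin : Filter.Tendsto (fun N => (H0 z : ℂ) + ∑ n ∈ Finset.range N, ∑' k, S n k) Filter.atTop
      (nhds ((H0 z : ℂ) + ∑' n, ∑' k, S n k)) :=
    (hSs.prod.hasSum.tendsto_sum_nat).const_add _
  have hcomm := hSs.tsum_comm
  have e : (H0 z : ℂ) + ∑' n, ∑' k, S n k = H0 z + evalGraded ρ θ (lieSeries P χ) z := by
    rw [← hcomm]; simp only [hSk]; rfl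
  rw [← e]
  refine tendsto_nhds_unique (hlim.congr fun N => ?_) hfin |>.symm ▸ ?_
  · rw [Finset.sum_range_succ']
    simp only [hSn, Finset.sum_add_distrib]
    simp
    ring
  · simp [add_comm]

end

end

/-! ### The normal form transformation and the remainder -/

section

open scoped Nat

variable {ρ θ : ℝ}

theorem sympl_single (a : ℤ) (c : ℂ) (w : Gevrey ρ θ) :
    sympl (single ρ θ a c) w = -Complex.I * (c * conj (w a) - conj c * w a) := by
  have h1 : (single ρ θ a c : ℤ → ℂ) a = c := Pi.single_eq_same (M := fun _ => ℂ) a c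
  have h2 : ∀ b, b ≠ a → (single ρ θ a c : ℤ → ℂ) b = 0 := fun b hb => Pi.single_eq_of_ne (M := fun _ => ℂ) hb c
  rw [sympl, tsum_eq_single a fun b hb => by rw [h2 b hb]; simp, h1]

instance : Nontrivial (Gevrey ρ θ) := by
  refine ⟨⟨single ρ θ 0 1, 0, fun h => ?_⟩⟩
  have h1 : (single ρ θ 0 1 : ℤ → ℂ) 0 = 1 := Pi.single_eq_same (M := fun _ => ℂ) (0 : ℤ) (1 : ℂ)
  rw [h] at h1
  exact zero_ne_one h1

/-- A real function whose derivative is represented by `X` through the symplectic form has `X` as its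
Hamiltonian vector. -/
theorem isHamVectorAt_of_hasFDerivAt {F : Gevrey ρ θ → ℝ} {u X : Gevrey ρ θ}
    {F' : Gevrey ρ θ →L[ℝ] ℝ} (h : HasFDerivAt F F' u) (hX : ∀ v, F' v = (sympl v X).re) :
    IsHamVectorAt F u X := by
  refine ⟨h.differentiableAt, fun a => ?_⟩
  rw [dBar, h.fderiv, hX, hX, sympl_single, sympl_single]
  apply Complex.ext <;> simp

section

variable {P χ : Graded} {C₀ : ℝ} {m : ℕ} [hI : GevreyIndex ρ θ]

/-- The time-one map of the generator is the normal form transformation. -/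
theorem IsNormalizing.exists_transformation (h : IsNormalizing P C₀ m χ) (hC : 1 ≤ C₀) (hm : 0 < m)
    (hP0 : P 0 = 0) (hP : ∀ k, IsHamCoef (P k) (C₀ ^ k)) {ε : ℝ} (hε : 0 < ε)
    (hR : IsSmallRadius ρ θ C₀ m (4 * ε)) :
    ∃ Φ : OpenPartialHomeomorph (Gevrey ρ θ) (Gevrey ρ θ), Φ.source = Metric.ball 0 (3 * ε) ∧
      Φ.target ⊆ Metric.ball 0 (4 * ε) ∧ IsCanonical Φ ∧
      NearIdentity Φ Φ.source (512 * C₀ * algConst ρ θ ^ 3) 2 ∧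
      NearIdentity Φ.symm Φ.target (512 * C₀ * algConst ρ θ ^ 3) 2 ∧
      ∀ z ∈ Metric.ball (0 : Gevrey ρ θ) (3 * ε),
        (H0 (Φ z) : ℂ) + evalGraded ρ θ P (Φ z) = H0 z + evalGraded ρ θ (lieSeries P χ) z := by
  have ha := algConst_pos ρ θ
  have hX0 : genField ρ θ m χ 0 = 0 := by
    have := h.norm_genField_le hC hR (u := 0) (by simpa using by positivity)
    simpa using this
  obtain ⟨Φ, γ, hsrc, hΦ, hΦs, hγ, hA, hB⟩ := exists_timeOneMap (F := ℂ) (Finset.range m)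
    (fun k => vecL ρ θ (hamCoef (χ k))) hε
    (fun u hu => h.norm_genField_deriv_le hC hR (mem_ball_zero_iff.1 hu).le) hX0
  set C := 8 * C₀ * algConst ρ θ ^ 3 with hCdef
  have hC0 : 0 < C := by positivity
  -- the displacement is controlled by the vector field along the integral curve
  have hdisp : ∀ z ∈ Φ.source, ‖z - Φ z‖ ≤ 8 * C * ‖z‖ ^ 3 := by
    intro z hz
    obtain ⟨h0, h1, hcurve⟩ := hγ z hz
    rw [← h1, norm_sub_rev]
    conv_lhs => rw [← h0]
    rw [h0]
    have key := norm_image_sub_le_of_norm_deriv_le_segment_01' (f := γ z)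
      (f' := fun t => genField ρ θ m χ (γ z t)) (C := 8 * C * ‖z‖ ^ 3)
      (fun t ht => (hcurve t ht).2.2.hasDerivWithinAt) fun t ht => by
        obtain ⟨c1, c2, -⟩ := hcurve t ⟨ht.1, ht.2.le⟩
        refine (h.norm_genField_le hC hR c2.le).trans ?_
        calc C * ‖γ z t‖ ^ 3 ≤ C * (2 * ‖z‖) ^ 3 := by gcongr
          _ = _ := by ring
    rwa [h0] at key
  have hinv : ∀ z ∈ Φ.source, ‖z‖ ≤ 2 * ‖Φ z‖ := by
    intro z hz
    have h1 := hdisp z hz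
    have hz3 : ‖z‖ < 3 * ε := by rw [hsrc] at hz; simpa using hz
    have h2 : 8 * C * ‖z‖ ^ 2 ≤ 1 / 2 := by
      have h3 := hR.deriv_le
      have h4 : ‖z‖ ^ 2 ≤ (4 * ε) ^ 2 := by gcongr; linarith
      have h5 : 8 * C * ‖z‖ ^ 2 ≤ 8 * C * (4 * ε) ^ 2 := by gcongr
      rw [hCdef] at h5 ⊢
      linarith
    have h3 : ‖z‖ ≤ ‖Φ z‖ + ‖z - Φ z‖ := by
      have := norm_add_le (Φ z) (z - Φ z)
      rwa [add_sub_cancel] at this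
    have h4 : 8 * C * ‖z‖ ^ 3 ≤ 1 / 2 * ‖z‖ := by
      calc 8 * C * ‖z‖ ^ 3 = 8 * C * ‖z‖ ^ 2 * ‖z‖ := by ring
        _ ≤ _ := by gcongr
    linarith
  refine ⟨Φ, hsrc, ?_, ⟨hΦ, hΦs, fun z hz v w => ?_⟩, ?_, ?_, ?_⟩
  · intro w hw
    obtain ⟨-, h1, hcurve⟩ := hγ _ (Φ.map_target hw)
    have := (hcurve 1 (by simp)).2.1
    rw [h1, Φ.right_inv hw] at this
    simpa using this
  · have := hB (symplL ρ θ) (fun u v w => ?_) z hz v w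
    · simpa only [symplL_apply] using this
    · rw [polyFieldDeriv, symplL_apply, symplL_apply, ← symplL_apply, ← symplL_apply]
      simp only [sum_apply, map_sum]
      rw [← Finset.sum_add_distrib]
      refine Finset.sum_eq_zero fun k _ => ?_
      rw [symplL_apply, symplL_apply]
      exact sympl_diagDeriv (h.isHam k) u v w
  · intro z hz
    obtain ⟨A, hA1, -, hA3⟩ := hA z hz
    refine ⟨(hdisp z hz).trans ?_, A, hA1, hA3⟩
    have : 0 ≤ ‖z‖ ^ 3 := by positivity
    rw [hCdef]
    nlinarith [mul_nonneg hC0.le this]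
  · intro w hw
    have hz := Φ.map_target hw
    obtain ⟨A, hA1, hA2, -⟩ := hA _ hz
    refine ⟨?_, A.symm, Φ.hasFDerivAt_symm hw hA1, by simpa using hA2⟩
    have h1 := hdisp _ hz
    have h2 := hinv _ hz
    rw [Φ.right_inv hw] at h1 h2
    rw [norm_sub_rev]
    refine h1.trans ?_
    calc 8 * C * ‖Φ.symm w‖ ^ 3 ≤ 8 * C * (2 * ‖w‖) ^ 3 := by gcongr
      _ = _ := by rw [hCdef]; ring
  · intro z hz
    rw [← hsrc] at hz
    obtain ⟨h0, h1, hcurve⟩ := hγ z hz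
    have := h.pullback_eq hC hm hP0 hP hR (γ := γ z) (fun t ht => (hcurve t ht).2.1)
      (fun t ht => (hcurve t ht).2.2)
    rwa [h0, h1] at this

/-- The terms of index at least `m` of a formal sum. -/
def tail (m : ℕ) (W : Graded) : Graded := fun k => if k < m then 0 else W k

theorem isHamCoef_tail {W : Graded} {T : ℝ} (hT : 0 ≤ T) (hW : ∀ k, IsHamCoef (W k) (1 * T ^ k))
    (k : ℕ) : IsHamCoef (tail m W k) (1 * T ^ k) := by
  unfold tail
  split_ifs
  · exact isHamCoef_zero.mono (by positivity)
  · exact hW k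

theorem evalGraded_eq_sum_add_tail {W : Graded} {T : ℝ} (hT : 0 ≤ T)
    (hW : ∀ k, IsHamCoef (W k) (1 * T ^ k)) {u : Gevrey ρ θ}
    (hu : T * (algConst ρ θ * ‖u‖) ^ 2 ≤ 1 / 2) :
    evalGraded ρ θ W u = ∑ k ∈ Finset.range m, evalC ρ θ (W k) u + evalGraded ρ θ (tail m W) u := by
  have s1 := (summable_evalC zero_le_one hT hW hu).of_norm
  have s2 := (summable_evalC zero_le_one hT (isHamCoef_tail (m := m) hT hW) hu).of_norm
  rw [evalGraded, evalGraded, ← s1.sum_add_tsum_nat_add m, ← s2.sum_add_tsum_nat_add m]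
  have e1 : ∑ k ∈ Finset.range m, evalC ρ θ (tail m W k) u = 0 :=
    Finset.sum_eq_zero fun k hk => by
      rw [tail, if_pos (Finset.mem_range.1 hk), evalC_zero]
  rw [e1, zero_add]
  congr 1
  refine tsum_congr fun k => ?_
  rw [tail, if_neg (by omega)]

/-- The Hamiltonian vector field of the terms of high order is estimated by a geometric series. -/
theorem exists_isHamVectorAt_tail {W : Graded} {T : ℝ} (hT : 0 ≤ T)
    (hW : ∀ k, IsHamCoef (W k) (1 * T ^ k)) {R : ℝ}
    (hR : T * (algConst ρ θ * R) ^ 2 ≤ 1 / 4) {u : Gevrey ρ θ} (hu : ‖u‖ < R) :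
    ∃ X : Gevrey ρ θ, IsHamVectorAt (fun u => (evalGraded ρ θ (tail m W) u).re) u X ∧
      ‖X‖ ≤ 4 * (algConst ρ θ * ‖u‖) * (2 * (T * (algConst ρ θ * ‖u‖) ^ 2)) ^ m := by
  have ha := algConst_pos ρ θ
  have hF := isHamCoef_tail (m := m) hT hW
  have hq : T * (algConst ρ θ * ‖u‖) ^ 2 ≤ 1 / 4 := by
    refine le_trans ?_ hR
    gcongr
  set q := 2 * (T * (algConst ρ θ * ‖u‖) ^ 2) with hqdef
  have hq0 : 0 ≤ q := by positivity
  have hq2 : q ≤ 1 / 2 := by linarith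
  have hle := norm_hamVec_grade_le (q := q) zero_le_one hT hF (u := u) le_rfl
  have hs : Summable fun k => hamVec ρ θ (tail m W k) u :=
    Summable.of_norm_bounded ((summable_geometric_of_lt_one hq0 (by linarith)).mul_left _) hle
  refine ⟨∑' k, hamVec ρ θ (tail m W k) u, ?_, ?_⟩
  · have h1 := hasFDerivAt_evalGraded zero_le_one hT hF hR hu
    have h2 := Complex.reCLM.hasFDerivAt.comp u h1
    refine isHamVectorAt_of_hasFDerivAt h2 fun v => ?_
    rw [← symplL_apply, ContinuousLinearMap.map_tsum _ hs, ContinuousLinearMap.comp_apply,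
      ← ContinuousLinearMap.apply_apply (𝕜 := ℝ) v (∑' k, evalDeriv (tail m W k) u),
      ContinuousLinearMap.map_tsum _ (summable_evalDeriv zero_le_one hT hF hq).of_norm,
      Complex.reCLM_apply]
    congr 1
    refine tsum_congr fun k => ?_
    rw [ContinuousLinearMap.apply_apply, symplL_apply]
    exact evalDeriv_eq_sympl (hF k) u v
  · have e1 : ∑ k ∈ Finset.range m, hamVec ρ θ (tail m W k) u = 0 :=
      Finset.sum_eq_zero fun k hk => by
        have h0 : IsHamCoef (tail m W k) 0 := by
          rw [tail, if_pos (Finset.mem_range.1 hk)]; exact isHamCoef_zero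
        exact norm_le_zero_iff.1 ((norm_hamVec_le h0 u).trans (by simp))
    rw [← hs.sum_add_tsum_nat_add m, e1, zero_add]
    refine (tsum_of_norm_bounded (hasSum_geometric_two.mul_left
      (2 * (algConst ρ θ * ‖u‖) * q ^ m)) fun k => ?_).trans (le_of_eq (by ring))
    refine (hle (k + m)).trans ?_
    calc _ = 2 * (algConst ρ θ * ‖u‖) * q ^ m * q ^ k := by rw [pow_add]; ring
      _ ≤ _ := by gcongr

end

end

/-! ### The Taylor polynomials of the nonlinearity -/

section

variable {ρ θ : ℝ}

/-- The number of sign patterns of length `n` with sum zero. -/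
def signCount (n : ℕ) : ℕ := Fintype.card {δ : Fin n → ℤˣ // ∑ i, (δ i : ℤ) = 0}

theorem signCount_pos (k : ℕ) : 0 < signCount (2 * k + 1 + 1) := by
  refine Fintype.card_pos_iff.2 ⟨⟨fun i => (-1) ^ (i : ℕ), ?_⟩⟩
  push_cast
  rw [Fin.sum_univ_eq_sum_range (fun i => (-1 : ℤ) ^ i), neg_one_geom_sum, if_pos]
  exact ⟨k + 1, by ring⟩

/-- The symmetric coefficients of the polynomial `c / (2 π) ∫ |u|ⁿ`, `n` even: all the sign patterns
of total charge zero represent the same monomials, and `c` is divided equally among them. -/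
def nlsCoef (n : ℕ) (c : ℝ) : Coef n := fun j =>
  if charge j = 0 ∧ mom j = 0 then ((c / signCount n : ℝ) : ℂ) else 0

theorem isHamCoef_nlsCoef (n : ℕ) (c : ℝ) : IsHamCoef (nlsCoef n c) |c| where
  bound j := by
    unfold nlsCoef
    split_ifs
    · rw [Complex.norm_real, Real.norm_eq_abs, abs_div, Nat.abs_cast]
      rcases Nat.eq_zero_or_pos (signCount n) with h | h
      · rw [h]; simp
      · exact div_le_self (abs_nonneg c) (by exact_mod_cast h)
    · simp
  charge_eq j h := by
    by_contra hc
    exact h (if_neg fun h => hc h.1)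
  mom_eq j h := by
    by_contra hc
    exact h (if_neg fun h => hc h.2)
  real j := by
    simp only [nlsCoef, charge_bar, mom_bar, neg_eq_zero]
    split_ifs
    · exact (Complex.conj_ofReal _).symm
    · simp

/-- The Fourier series of `u` (for the sign `1`) and of `ū` (for the sign `-1`). -/
theorem tsum_coord_exp (u : Gevrey ρ θ) (d : ℤˣ) (x : ℝ) :
    ∑' a : ℤ, coord u (d, a) * Complex.exp (Complex.I * ((d : ℤ) * a : ℤ) * x) =
      if d = 1 then toFunction u x else conj (toFunction u x) := by
  rcases Int.units_eq_one_or d with rfl | rfl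
  · simp [coord_one, toFunction]
  · rw [if_neg (by decide), toFunction, Complex.conj_tsum]
    refine tsum_congr fun a => ?_
    rw [coord_neg_one, map_mul, ← Complex.exp_conj]
    simp

section

variable [hI : GevreyIndex ρ θ]

theorem summable_norm_apply (u : Gevrey ρ θ) : Summable fun a : ℤ => ‖u a‖ :=
  ((summable_norm_coord u).prod_factor (1 : ℤˣ)).congr fun _ => norm_coord u _

theorem norm_exp_mode (a : ℤ) (x : ℝ) : ‖Complex.exp (Complex.I * a * x)‖ = 1 := by
  rw [Complex.norm_exp]
  simp

theorem continuous_toFunction (u : Gevrey ρ θ) : Continuous (toFunction u) := by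
  refine continuous_tsum (fun a => by fun_prop) (summable_norm_apply u) fun a x => ?_
  rw [norm_mul, norm_exp_mode, mul_one]

theorem norm_toFunction_le (u : Gevrey ρ θ) (x : ℝ) : ‖toFunction u x‖ ≤ algConst ρ θ * ‖u‖ := by
  have h1 : ‖toFunction u x‖ ≤ ∑' a : ℤ, ‖u a‖ :=
    tsum_of_norm_bounded (summable_norm_apply u).hasSum fun a => by
      rw [norm_mul, norm_exp_mode, mul_one]
  have h2 := tsum_norm_coord_le u
  rw [units_tsum (summable_norm_coord u)] at h2
  have h3 : ∑' a : ℤ, ‖coord u (1, a)‖ = ∑' a : ℤ, ‖u a‖ := tsum_congr fun a => norm_coord u _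
  have h4 : 0 ≤ ∑' a : ℤ, ‖coord u (-1, a)‖ := tsum_nonneg fun _ => norm_nonneg _
  linarith

theorem prod_sign_eq {n : ℕ} {δ : Fin (2 * n) → ℤˣ} (hδ : ∑ i, (δ i : ℤ) = 0) (y : ℂ) :
    (∏ i, if δ i = 1 then y else conj y) = ((‖y‖ ^ 2) ^ n : ℝ) := by
  set p := (Finset.univ.filter fun i => δ i = 1).card with hp
  set q := (Finset.univ.filter fun i => ¬ δ i = 1).card with hq
  have h1 : p + q = 2 * n := by
    rw [hp, hq, Finset.card_filter_add_card_filter_not]; simp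
  have h2 : (p : ℤ) - q = 0 := by
    rw [← hδ, ← Finset.sum_filter_add_sum_filter_not Finset.univ fun i => δ i = 1]
    rw [Finset.sum_congr rfl (g := fun _ => (1 : ℤ)) fun i hi => by
        rw [(Finset.mem_filter.1 hi).2]; rfl,
      Finset.sum_congr (s₁ := Finset.univ.filter fun i => ¬ δ i = 1) rfl (g := fun _ => (-1 : ℤ))
        fun i hi => by
        rcases Int.units_eq_one_or (δ i) with h | h
        · exact absurd h (Finset.mem_filter.1 hi).2
        · rw [h]; rfl]
    simp [← hp, ← hq]
    ring
  have h3 : p = n := by omega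
  have h4 : q = n := by omega
  rw [Finset.prod_ite, Finset.prod_const, Finset.prod_const, ← hp, ← hq, h3, h4, ← mul_pow,
    Complex.mul_conj, Complex.normSq_eq_norm_sq]
  push_cast; rfl

theorem integral_exp_mode (a : ℤ) :
    (1 / (2 * Real.pi) : ℂ) * ∫ x in (0 : ℝ)..(2 * Real.pi), Complex.exp (Complex.I * a * x) =
      if a = 0 then 1 else 0 := by
  have hpi : (Real.pi : ℂ) ≠ 0 := by exact_mod_cast Real.pi_ne_zero
  split_ifs with h
  · subst h
    simp
    field_simp
  · have hc : Complex.I * (a : ℂ) ≠ 0 := mul_ne_zero Complex.I_ne_zero (by exact_mod_cast h)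
    rw [integral_exp_mul_complex hc]
    have : Complex.exp (Complex.I * a * ((2 * Real.pi : ℝ) : ℂ)) = 1 := by
      rw [Complex.exp_eq_one_iff]
      exact ⟨a, by push_cast; ring⟩
    rw [this]
    simp

theorem mom_pair {n : ℕ} (δ : Fin n → ℤˣ) (a : Fin n → ℤ) :
    mom (fun i => (δ i, a i)) = ∑ i, ((δ i : ℤ) * a i) := rfl

/-- The contribution of one sign pattern to the integral of a power of `|u|`: termwise integration of
an absolutely convergent multiple Fourier series. -/
theorem tsum_sign_eq (u : Gevrey ρ θ) {n : ℕ} {δ : Fin (2 * n) → ℤˣ} (hδ : ∑ i, (δ i : ℤ) = 0) :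
    ∑' a : Fin (2 * n) → ℤ, (if mom (fun i => (δ i, a i)) = 0 then (1 : ℂ) else 0) *
        ∏ i, coord u (δ i, a i) =
      ((1 / (2 * Real.pi) * ∫ x in (0 : ℝ)..(2 * Real.pi), (‖toFunction u x‖ ^ 2) ^ n : ℝ) : ℂ) := by
  let f : (Fin (2 * n) → ℤ) → C(ℝ, ℂ) := fun a =>
    ⟨fun x => (∏ i, coord u (δ i, a i)) *
      Complex.exp (Complex.I * (mom (fun i => (δ i, a i)) : ℤ) * x), by fun_prop⟩
  have hs : ∀ i, Summable fun a : ℤ => ‖coord u (δ i, a)‖ := fun i =>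
    (summable_norm_coord u).prod_factor (δ i)
  have hsum := (summable_norm_prod (fun i a => coord u (δ i, a)) hs).1
  have hf : Summable fun a => ‖(f a).restrict
      (⟨Set.uIcc 0 (2 * Real.pi), isCompact_uIcc⟩ : TopologicalSpace.Compacts ℝ)‖ := by
    refine Summable.of_nonneg_of_le (fun _ => norm_nonneg _) (fun a => ?_) hsum
    refine (ContinuousMap.norm_le _ (norm_nonneg _)).2 fun x => ?_
    simp only [f, ContinuousMap.restrict_apply, ContinuousMap.coe_mk]
    rw [norm_mul, norm_exp_mode, mul_one]
  have h1 := intervalIntegral.tsum_intervalIntegral_eq_of_summable_norm hf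
  have h2 : ∀ x : ℝ, ∑' a, f a x = (((‖toFunction u x‖ ^ 2) ^ n : ℝ) : ℂ) := by
    intro x
    rw [← prod_sign_eq hδ, ← Finset.prod_congr rfl fun i _ => tsum_coord_exp u (δ i) x]
    have h3 := (summable_norm_prod (fun i (a : ℤ) => coord u (δ i, a) *
      Complex.exp (Complex.I * ((δ i : ℤ) * a : ℤ) * x)) fun i => (hs i).congr fun a => by
        rw [norm_mul, norm_exp_mode, mul_one]).2
    rw [← h3]
    refine tsum_congr fun a => ?_
    rw [Finset.prod_mul_distrib, ← Complex.exp_sum]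
    simp only [f, ContinuousMap.coe_mk]
    congr 2
    rw [mom_pair, Int.cast_sum, Finset.mul_sum, Finset.sum_mul]
  simp_rw [h2] at h1
  rw [Complex.ofReal_mul, ← intervalIntegral.integral_ofReal, ← h1, ← tsum_mul_left]
  refine tsum_congr fun a => ?_
  simp only [f, ContinuousMap.coe_mk]
  rw [intervalIntegral.integral_const_mul, mul_left_comm]
  push_cast
  rw [integral_exp_mode, mul_comm]

theorem charge_pair {n : ℕ} (δ : Fin n → ℤˣ) (a : Fin n → ℤ) :
    charge (fun i => (δ i, a i)) = ∑ i, (δ i : ℤ) := rfl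

/-- Sums over multi-indices as sums over sign patterns and Fourier modes. -/
theorem tsum_signs {n : ℕ} {F : (Fin n → Mode) → ℂ} (hF : Summable F) :
    ∑' j, F j = ∑ δ : Fin n → ℤˣ, ∑' a : Fin n → ℤ, F fun i => (δ i, a i) := by
  let e := (Equiv.arrowProdEquivProdArrow (Fin n) (fun _ => ℤˣ) (fun _ => ℤ)).symm
  have h : Summable fun x => F (e x) := e.summable_iff.2 hF
  rw [← e.tsum_eq, h.tsum_prod, tsum_fintype]
  rfl

/-- The polynomial with the coefficients `nlsCoef` is the mean value of `c |u|^{2 k + 2}`. -/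
theorem evalC_nlsCoef (u : Gevrey ρ θ) (k : ℕ) (c : ℝ) :
    evalC ρ θ (nlsCoef (2 * k + 1 + 1) c) u =
      ((c * (1 / (2 * Real.pi) * ∫ x in (0 : ℝ)..(2 * Real.pi),
        (‖toFunction u x‖ ^ 2) ^ (k + 1)) : ℝ) : ℂ) := by
  have hP := isHamCoef_nlsCoef (2 * k + 1 + 1) c
  have hN : ((signCount (2 * k + 1 + 1) : ℝ) : ℂ) ≠ 0 := by exact_mod_cast (signCount_pos k).ne'
  rw [evalC_eq_tsum hP, tsum_signs (summable_evalC_terms hP u)]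
  set J : ℂ := ((1 / (2 * Real.pi) * ∫ x in (0 : ℝ)..(2 * Real.pi),
        (‖toFunction u x‖ ^ 2) ^ (k + 1) : ℝ) : ℂ) with hJ
  have h : ∀ δ : Fin (2 * k + 1 + 1) → ℤˣ, (∑' a : Fin (2 * k + 1 + 1) → ℤ,
      nlsCoef (2 * k + 1 + 1) c (fun i => (δ i, a i)) * ∏ i, coord u (δ i, a i)) =
      if ∑ i, (δ i : ℤ) = 0 then ((c / signCount (2 * k + 1 + 1) : ℝ) : ℂ) * J else 0 := by
    intro δ
    split_ifs with hδ
    · rw [hJ, ← tsum_sign_eq u (n := k + 1) hδ, ← tsum_mul_left]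
      refine tsum_congr fun a => ?_
      rw [← mul_assoc]
      congr 1
      simp only [nlsCoef, charge_pair, hδ, true_and]
      by_cases hm : mom (n := 2 * k + 1 + 1) (fun i => (δ i, a i)) = 0
      · exact (if_pos hm).trans ((mul_one _).symm.trans (congrArg _ (if_pos hm).symm))
      · exact (if_neg hm).trans ((mul_zero _).symm.trans (congrArg _ (if_neg hm).symm))
    · rw [← tsum_zero]
      refine tsum_congr fun a => ?_
      rw [nlsCoef, if_neg (by rw [charge_pair]; exact fun h => hδ h.1), zero_mul]
  simp_rw [h]
  rw [← Finset.sum_filter, Finset.sum_const, nsmul_eq_mul, ← Fintype.card_subtype]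
  change (signCount (2 * k + 1 + 1) : ℂ) * _ = _
  rw [Complex.ofReal_mul, ← hJ]
  push_cast at hN ⊢
  field_simp

/-- The Taylor polynomials of the nonlinear part of the Hamiltonian up to the degree `2 r`. -/
def nlsGraded (φ : ℝ → ℝ) (r : ℕ) : Graded := fun k =>
  if k ≠ 0 ∧ k < r then nlsCoef (2 * k + 1 + 1) (iteratedDeriv k φ 0 / ((k + 1).factorial : ℝ)) else 0

theorem isHamCoef_nlsGraded {φ : ℝ → ℝ} {C₀ : ℝ} (hC : 1 ≤ C₀)
    (h : ∀ l : ℕ, 2 ≤ l → |iteratedDeriv (l - 1) φ 0 / (l.factorial : ℝ)| < C₀ ^ (l - 1))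
    (r k : ℕ) : IsHamCoef (nlsGraded φ r k) (C₀ ^ k) := by
  unfold nlsGraded
  split_ifs with hk
  · refine (isHamCoef_nlsCoef _ _).mono ?_
    have := h (k + 1) (by omega)
    rw [Nat.add_sub_cancel] at this
    exact this.le
  · exact isHamCoef_zero.mono (by positivity)

/-- The Hamiltonian of the equation is `H₀` plus its Taylor polynomials plus the remainder, in any
ball in which the nonlinearity is continuous. -/
theorem hamiltonian_eq {φ : ℝ → ℝ} {δ : ℝ} (hφ : ContinuousOn φ (Set.Icc 0 δ)) (r : ℕ)
    {u : Gevrey ρ θ} (hu : (algConst ρ θ * ‖u‖) ^ 2 ≤ δ) :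
    (hamiltonian φ u : ℂ) = H0 u + evalGraded ρ θ (nlsGraded φ r) u + taylorRemainder φ r u := by
  have hδ : 0 ≤ δ := (sq_nonneg _).trans hu
  have hcont : Continuous fun x => ‖toFunction u x‖ ^ 2 := (continuous_toFunction u).norm.pow 2
  have hmem : ∀ x, ‖toFunction u x‖ ^ 2 ∈ Set.Icc 0 δ := fun x =>
    ⟨by positivity, le_trans (by gcongr; exact norm_toFunction_le u x) hu⟩
  have hprim : ContinuousOn (primitive φ) (Set.Icc 0 δ) := by
    have := intervalIntegral.continuousOn_primitive_interval (μ := MeasureTheory.volume) (f := φ)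
      (a := 0) (b := δ) (by
        rw [Set.uIcc_of_le hδ]; exact hφ.integrableOn_compact isCompact_Icc)
    rwa [Set.uIcc_of_le hδ] at this
  have hg : Continuous fun x => primitive φ (‖toFunction u x‖ ^ 2) :=
    hprim.comp_continuous hcont hmem
  have hpoly : ∀ l, Continuous fun x => iteratedDeriv (l - 1) φ 0 / (l.factorial : ℝ) *
      (‖toFunction u x‖ ^ 2) ^ l := fun l => continuous_const.mul (hcont.pow l)
  have e1 : evalGraded ρ θ (nlsGraded φ r) u =
      ((∑ l ∈ Finset.Icc 2 r, iteratedDeriv (l - 1) φ 0 / (l.factorial : ℝ) *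
        (1 / (2 * Real.pi) * ∫ x in (0 : ℝ)..(2 * Real.pi), (‖toFunction u x‖ ^ 2) ^ l) : ℝ) : ℂ) := by
    rw [evalGraded, tsum_eq_sum (s := Finset.Ico 1 r) fun k hk => by
      rw [nlsGraded, if_neg (fun h => hk (Finset.mem_Ico.2 ⟨by omega, h.2⟩)), evalC_zero]]
    rw [Complex.ofReal_sum]
    refine Finset.sum_bij (fun k _ => k + 1) (fun k hk => ?_) (fun _ _ _ _ h => by omega)
      (fun l hl => ?_) fun k hk => ?_
    · simp at hk ⊢; omega
    · refine ⟨l - 1, ?_, ?_⟩ <;> simp at hl ⊢ <;> omega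
    · simp only [Finset.mem_Ico] at hk
      rw [nlsGraded, if_pos ⟨by omega, hk.2⟩, evalC_nlsCoef, Nat.add_sub_cancel]
  rw [e1, hamiltonian, taylorRemainder, intervalIntegral.integral_sub (hg.intervalIntegrable _ _)
    ((continuous_finsetSum _ fun l _ => hpoly l).intervalIntegrable _ _),
    intervalIntegral.integral_finsetSum fun l _ => (hpoly l).intervalIntegrable _ _]
  simp_rw [intervalIntegral.integral_const_mul]
  have e2 : ∀ l, iteratedDeriv (l - 1) φ 0 / (l.factorial : ℝ) *
      (1 / (2 * Real.pi) * ∫ x in (0 : ℝ)..(2 * Real.pi), (‖toFunction u x‖ ^ 2) ^ l) =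
      1 / (2 * Real.pi) * (iteratedDeriv (l - 1) φ 0 / (l.factorial : ℝ) *
        ∫ x in (0 : ℝ)..(2 * Real.pi), (‖toFunction u x‖ ^ 2) ^ l) := fun l => by ring
  simp_rw [e2]
  rw [← Finset.mul_sum, mul_sub]
  push_cast
  ring

end

end

/-! ### Rearrangements of finite sequences -/

section

variable {ρ θ : ℝ}

section Rearrangement

open Equiv

variable {α : Type*} [DecidableEq α] {n : ℕ}

theorem map_univ_eq_iff (f g : Fin n → α) :
    Finset.univ.val.map f = Finset.univ.val.map g ↔ ∃ σ : Perm (Fin n), f = g ∘ σ := by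
  constructor
  · intro h
    have hc : ∀ b, Fintype.card {a // f a = b} = Fintype.card {a // g a = b} := by
      intro b
      have h1 := congrArg (Multiset.count b) h
      rw [Multiset.count_map, Multiset.count_map] at h1
      rw [Fintype.card_subtype, Fintype.card_subtype]
      simp only [eq_comm (b := b)]
      exact h1
    refine ⟨(Equiv.sigmaFiberEquiv f).symm.trans ((Equiv.sigmaCongrRight fun b =>
      Fintype.equivOfCardEq (hc b)).trans (Equiv.sigmaFiberEquiv g)), funext fun i => ?_⟩
    exact (Fintype.equivOfCardEq (hc (f i)) ⟨i, rfl⟩).2.symm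
  · rintro ⟨σ, rfl⟩
    have h1 : (Finset.univ.val.map σ : Multiset (Fin n)) = Finset.univ.val := by simp
    conv_rhs => rw [← h1]
    rw [Multiset.map_map]

/-- The number of the rearrangements of a finite sequence. -/
def orbitCount (x : Fin n → α) : ℕ := (Finset.univ.image fun π : Perm (Fin n) => x ∘ π).card

/-- The number of the permutations that fix a finite sequence. -/
def stabCount (x : Fin n → α) : ℕ := (Finset.univ.filter fun π : Perm (Fin n) => x ∘ π = x).card

theorem orbitCount_mul_stabCount (x : Fin n → α) : orbitCount x * stabCount x = n.factorial := by
  have h := Finset.card_eq_sum_card_image (fun π : Perm (Fin n) => x ∘ π) Finset.univ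
  rw [Finset.card_univ, Fintype.card_perm, Fintype.card_fin] at h
  rw [h, orbitCount, ← smul_eq_mul, ← Finset.sum_const]
  refine Finset.sum_congr rfl fun y hy => ?_
  obtain ⟨σ, -, rfl⟩ := Finset.mem_image.1 hy
  refine Finset.card_bij (fun π _ => π * σ) (fun π hπ => ?_) (fun _ _ _ _ h => mul_right_cancel h)
    fun τ hτ => ⟨τ * σ⁻¹, ?_, by simp⟩
  · simp only [Finset.mem_filter, Finset.mem_univ, true_and] at hπ ⊢
    conv_rhs => rw [← hπ]
    rfl
  · simp only [Finset.mem_filter, Finset.mem_univ, true_and] at hτ ⊢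
    rw [Perm.coe_mul, ← Function.comp_assoc, hτ, Function.comp_assoc, ← Perm.coe_mul]
    simp

open Classical in
/-- A sum over the rearrangements of a sequence, for a summand that does not depend on the order. -/
theorem tsum_orbit (x : Fin n → α) {F : (Fin n → α) → ℂ} {v : ℂ}
    (hF : ∀ π : Perm (Fin n), F (x ∘ π) = v) :
    ∑' y, (if ∃ π : Perm (Fin n), y = x ∘ π then F y else 0) = orbitCount x * v := by
  rw [tsum_eq_sum (s := Finset.univ.image fun π : Perm (Fin n) => x ∘ π) fun y hy =>
    if_neg fun ⟨π, hπ⟩ => hy (Finset.mem_image.2 ⟨π, Finset.mem_univ _, hπ.symm⟩)]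
  rw [Finset.sum_congr rfl (g := fun _ => v) fun y hy => ?_, Finset.sum_const, nsmul_eq_mul,
    orbitCount]
  obtain ⟨π, -, rfl⟩ := Finset.mem_image.1 hy
  rw [if_pos ⟨π, rfl⟩, hF]

theorem stabCount_two (x : Fin 2 → α) : stabCount x = if x 0 = x 1 then 2 else 1 := by
  have h : (Finset.univ : Finset (Perm (Fin 2))) = {1, swap 0 1} := by decide
  rw [stabCount, Finset.card_filter, h, Finset.sum_insert (by decide), Finset.sum_singleton]
  by_cases h1 : x 0 = x 1 <;> simp [funext_iff, Fin.forall_fin_two, h1, eq_comm]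

theorem stabCount_three (x : Fin 3 → α) : stabCount x = 1 + (if x 0 = x 1 then 1 else 0) +
    (if x 0 = x 2 then 1 else 0) + (if x 1 = x 2 then 1 else 0) +
    (if x 0 = x 1 ∧ x 1 = x 2 then 2 else 0) := by
  have h : (Finset.univ : Finset (Perm (Fin 3))) = {1, swap 0 1, swap 0 2, swap 1 2,
      swap 0 1 * swap 1 2, swap 1 2 * swap 0 1} := by decide
  have e : ∀ π : Perm (Fin 3), x ∘ π = x ↔ x (π 0) = x 0 ∧ x (π 1) = x 1 ∧ x (π 2) = x 2 := by
    intro π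
    simp [funext_iff, Fin.forall_fin_succ]
  rw [stabCount, Finset.card_filter, h, Finset.sum_insert (by decide), Finset.sum_insert (by decide),
    Finset.sum_insert (by decide), Finset.sum_insert (by decide), Finset.sum_insert (by decide),
    Finset.sum_singleton]
  simp only [e]
  have v1 : (swap 0 1 : Perm (Fin 3)) 0 = 1 ∧ (swap 0 1 : Perm (Fin 3)) 1 = 0 ∧
    (swap 0 1 : Perm (Fin 3)) 2 = 2 := by decide
  have v2 : (swap 0 2 : Perm (Fin 3)) 0 = 2 ∧ (swap 0 2 : Perm (Fin 3)) 1 = 1 ∧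
    (swap 0 2 : Perm (Fin 3)) 2 = 0 := by decide
  have v3 : (swap 1 2 : Perm (Fin 3)) 0 = 0 ∧ (swap 1 2 : Perm (Fin 3)) 1 = 2 ∧
    (swap 1 2 : Perm (Fin 3)) 2 = 1 := by decide
  simp only [Perm.coe_mul, Function.comp_apply, v1, v2, v3, Perm.coe_one, id]
  grind

theorem orbitCount_two (x : Fin 2 → α) : orbitCount x = 2 - (if x 0 = x 1 then 1 else 0) := by
  have h := orbitCount_mul_stabCount x
  rw [stabCount_two] at h
  split_ifs at h ⊢ <;> simp [Nat.factorial] at h ⊢ <;> omega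

theorem orbitCount_three (x : Fin 3 → α) : (orbitCount x : ℝ) = 6 - 3 * ((if x 0 = x 1 then 1 else 0) +
    (if x 0 = x 2 then 1 else 0) + (if x 1 = x 2 then 1 else 0)) +
    4 * (if x 0 = x 1 ∧ x 1 = x 2 then 1 else 0) := by
  have h := orbitCount_mul_stabCount x
  rw [stabCount_three] at h
  have h' : (orbitCount x : ℝ) * (1 + (if x 0 = x 1 then 1 else 0) +
    (if x 0 = x 2 then 1 else 0) + (if x 1 = x 2 then 1 else 0) +
    (if x 0 = x 1 ∧ x 1 = x 2 then 2 else 0)) = 6 := by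
    exact_mod_cast h
  by_cases h1 : x 0 = x 1 <;> by_cases h2 : x 0 = x 2 <;> by_cases h3 : x 1 = x 2 <;>
    simp_all <;> linarith

/-- Sequences that pair off with their conjugates. -/
def Matched (j : Fin n → Mode) : Prop := ∃ σ : Perm (Fin n), j = (fun i => bar (j i)) ∘ σ

theorem matched_iff (j : Fin n → Mode) : Matched j ↔
    Finset.univ.val.map j = Finset.univ.val.map fun i => bar (j i) := (map_univ_eq_iff _ _).symm

theorem Matched.comp {j : Fin n → Mode} (h : Matched j) (τ : Perm (Fin n)) : Matched (j ∘ τ) := by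
  obtain ⟨σ, hσ⟩ := h
  refine ⟨τ⁻¹ * σ * τ, funext fun i => ?_⟩
  have := congrFun hσ (τ i)
  simp only [Function.comp_apply, Perm.coe_mul] at this ⊢
  rw [this]; simp

theorem matched_comp_iff {j : Fin n → Mode} (τ : Perm (Fin n)) : Matched (j ∘ τ) ↔ Matched j := by
  refine ⟨fun h => ?_, fun h => h.comp τ⟩
  have := h.comp τ⁻¹
  rwa [Function.comp_assoc, ← Perm.coe_mul, mul_inv_cancel, Perm.coe_one, Function.comp_id] at this

theorem charge_comp (j : Fin n → Mode) (σ : Perm (Fin n)) : charge (j ∘ σ) = charge j :=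
  Equiv.sum_comp σ fun i => ((j i).1 : ℤ)

theorem mom_comp (j : Fin n → Mode) (σ : Perm (Fin n)) : mom (j ∘ σ) = mom j :=
  Equiv.sum_comp σ fun i => ((j i).1 : ℤ) * (j i).2

theorem freq_comp (j : Fin n → Mode) (σ : Perm (Fin n)) : freq (j ∘ σ) = freq j :=
  Equiv.sum_comp σ fun i => ((j i).1 : ℤ) * (j i).2 ^ 2

theorem Matched.resonant {j : Fin n → Mode} (h : Matched j) :
    charge j = 0 ∧ mom j = 0 ∧ freq j = 0 := by
  obtain ⟨σ, hσ⟩ := h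
  have h1 : charge j = -charge j := by
    conv_lhs => rw [hσ]
    rw [charge_comp, charge_bar]
  have h2 : mom j = -mom j := by
    conv_lhs => rw [hσ]
    rw [mom_comp, mom_bar]
  have h3 : freq j = -freq j := by
    conv_lhs => rw [hσ]
    rw [freq_comp, freq_bar]
  omega

theorem Matched.bar {j : Fin n → Mode} (h : Matched j) : Matched fun i => bar (j i) := by
  obtain ⟨σ, hσ⟩ := h
  refine ⟨σ, funext fun i => ?_⟩
  have := congrFun hσ i
  simp only [Function.comp_apply] at this ⊢
  rw [this]

theorem matched_bar_iff {j : Fin n → Mode} : Matched (fun i => GevreyNLS.bar (j i)) ↔ Matched j :=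
  ⟨fun h => by simpa using h.bar, fun h => h.bar⟩

theorem map_univ_append {β : Type*} {p q : ℕ} (x : Fin p → β) (y : Fin q → β) :
    Finset.univ.val.map (Fin.append x y) = Finset.univ.val.map x + Finset.univ.val.map y := by
  have h := fun {m : ℕ} (f : Fin m → β) => (show Finset.univ.val.map f = (List.ofFn f : Multiset β) by
    rw [Fin.univ_val_map])
  rw [h, h, h, List.ofFn_fin_append, Multiset.coe_add]

/-- If `x` contains no pair of conjugate modes, then its partners in a matching lie in `y`. -/
theorem matched_append_iff {p : ℕ} {x y : Fin p → Mode} (h : ∀ i k, x i ≠ bar (x k)) :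
    Matched (Fin.append x y) ↔ ∃ π : Perm (Fin p), y = (fun i => bar (x i)) ∘ π := by
  have hb : (fun i => bar (Fin.append x y i)) =
      Fin.append (fun i => bar (x i)) fun i => bar (y i) := by
    funext i
    refine Fin.addCases (fun i => ?_) (fun i => ?_) i <;>
      simp only [Fin.append_left, Fin.append_right]
  rw [matched_iff, hb, map_univ_append, map_univ_append, ← map_univ_eq_iff]
  constructor
  · intro hM
    symm
    refine Multiset.eq_of_le_of_card_le (Multiset.le_iff_count.2 fun o => ?_) (by simp)
    have hinv : ∀ (z : Fin p → Mode) (o : Mode), (Finset.univ.val.map fun i => bar (z i)).count o =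
        (Finset.univ.val.map z).count (bar o) := by
      intro z o
      have : (Finset.univ.val.map fun i => bar (z i)) = (Finset.univ.val.map z).map bar := by
        rw [Multiset.map_map]; rfl
      rw [this]
      have h2 := Multiset.count_map_eq_count' bar (Finset.univ.val.map z)
        (fun a b hab => by simpa using congrArg bar hab) (bar o)
      rwa [bar_bar] at h2
    by_cases ho : o ∈ Finset.univ.val.map fun i => bar (x i)
    · have h1 := congrArg (Multiset.count o) hM
      rw [Multiset.count_add, Multiset.count_add] at h1
      have h0 : (Finset.univ.val.map x).count o = 0 := by
        rw [Multiset.count_eq_zero]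
        intro hx
        obtain ⟨i, -, rfl⟩ := Multiset.mem_map.1 hx
        obtain ⟨k, -, hk⟩ := Multiset.mem_map.1 ho
        exact h i k hk.symm
      omega
    · rw [Multiset.count_eq_zero.2 ho]; exact Nat.zero_le _
  · intro hM
    have h2 : (Finset.univ.val.map fun i => bar (y i)) = Finset.univ.val.map x := by
      have : (Finset.univ.val.map fun i => bar (y i)) = (Finset.univ.val.map y).map bar := by
        rw [Multiset.map_map]; rfl
      rw [this, hM, Multiset.map_map]
      simp
    rw [hM, h2, add_comm]

end Rearrangement

/-! ### Sums over multi-indices of total charge zero -/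

/-- The multi-index with the modes `x` of charge `1` and the modes `y` of charge `-1`. -/
def pairIdx {n : ℕ} (x y : Fin n → ℤ) : Fin (n + n) → Mode :=
  Fin.append (fun k => (1, x k)) fun k => (-1, y k)

theorem matched_pairIdx_iff {n : ℕ} {x y : Fin n → ℤ} :
    Matched (pairIdx x y) ↔ ∃ π : Equiv.Perm (Fin n), y = x ∘ π := by
  rw [pairIdx, matched_append_iff fun i k h => by simp [bar] at h]
  refine exists_congr fun π => ?_
  simp [funext_iff, bar]

theorem exists_perm_of_charge_eq_zero {n : ℕ} {δ δ' : Fin n → ℤˣ} (h : ∑ i, (δ i : ℤ) = 0)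
    (h' : ∑ i, (δ' i : ℤ) = 0) : ∃ σ : Equiv.Perm (Fin n), δ = δ' ∘ σ := by
  rw [← map_univ_eq_iff]
  have key : ∀ δ : Fin n → ℤˣ, ∑ i, (δ i : ℤ) = 0 → ∀ d : ℤˣ,
      2 * (Finset.univ.filter fun i => d = δ i).card = n := by
    intro δ hδ d
    have h1 : ∑ i, (d : ℤ) * (δ i : ℤ) = 0 := by rw [← Finset.mul_sum, hδ, mul_zero]
    have h2 : ∀ i, (d : ℤ) * (δ i : ℤ) = 2 * (if d = δ i then 1 else 0) - 1 := by
      intro i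
      rcases Int.units_eq_one_or d with rfl | rfl <;> rcases Int.units_eq_one_or (δ i) with h | h <;>
        rw [h] <;> decide
    simp_rw [h2] at h1
    rw [Finset.sum_sub_distrib, ← Finset.mul_sum, ← Finset.sum_filter, Finset.sum_const,
      Finset.sum_const] at h1
    simp at h1
    omega
  refine Multiset.ext.2 fun d => ?_
  rw [Multiset.count_map, Multiset.count_map]
  have h1 := key δ h d
  have h2 := key δ' h' d
  have e : ∀ δ : Fin n → ℤˣ, (Multiset.filter (fun i => d = δ i) Finset.univ.val).card =
      (Finset.univ.filter fun i => d = δ i).card := fun δ => rfl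
  rw [e, e]
  omega

/-- The sum of a symmetric family over the multi-indices of charge zero: all the sign patterns
contribute equally. -/
theorem tsum_charge_zero {n : ℕ} {F : (Fin (n + n) → Mode) → ℂ} (hF : Summable F)
    (hsymm : ∀ j (σ : Equiv.Perm (Fin (n + n))), F (j ∘ σ) = F j)
    (h0 : ∀ j, charge j ≠ 0 → F j = 0) :
    ∑' j, F j = signCount (n + n) * ∑' x : Fin n → ℤ, ∑' y : Fin n → ℤ, F (pairIdx x y) := by
  let δ₀ : Fin (n + n) → ℤˣ := Fin.append (fun _ => 1) fun _ => -1
  have hδ₀ : ∑ i, (δ₀ i : ℤ) = 0 := by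
    simp only [δ₀, Fin.sum_univ_add, Fin.append_left, Fin.append_right]; simp
  let e := (Equiv.arrowProdEquivProdArrow (Fin (n + n)) (fun _ => ℤˣ) (fun _ => ℤ)).symm
  have hs : ∀ δ : Fin (n + n) → ℤˣ, Summable fun a : Fin (n + n) → ℤ => F fun i => (δ i, a i) := fun δ =>
    (e.summable_iff.2 hF).prod_factor δ
  have hS : ∑' a : Fin (n + n) → ℤ, F (fun i => (δ₀ i, a i)) =
      ∑' x : Fin n → ℤ, ∑' y : Fin n → ℤ, F (pairIdx x y) := by
    have h1 := (Fin.appendEquiv (α := ℤ) n n).summable_iff.2 (hs δ₀)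
    rw [← (Fin.appendEquiv (α := ℤ) n n).tsum_eq]
    refine (h1.tsum_prod).trans ?_
    refine tsum_congr fun x => tsum_congr fun y => ?_
    simp only [Function.comp_apply]
    congr 1
    funext i
    refine Fin.addCases (fun i => ?_) (fun i => ?_) i <;>
      simp only [δ₀, pairIdx, Fin.appendEquiv, Equiv.coe_fn_mk, Fin.append_left, Fin.append_right]
  rw [tsum_signs hF]
  have hδ : ∀ δ : Fin (n + n) → ℤˣ, ∑' a : Fin (n + n) → ℤ, F (fun i => (δ i, a i)) =
      if ∑ i, (δ i : ℤ) = 0 then ∑' x : Fin n → ℤ, ∑' y : Fin n → ℤ, F (pairIdx x y) else 0 := by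
    intro δ
    split_ifs with h
    · obtain ⟨σ, hσ⟩ := exists_perm_of_charge_eq_zero h hδ₀
      rw [← hS, ← (Equiv.arrowCongr σ.symm (Equiv.refl ℤ)).tsum_eq]
      refine tsum_congr fun a => ?_
      rw [← hsymm (fun i => (δ₀ i, a i)) σ, hσ]
      rfl
    · rw [← tsum_zero]
      exact tsum_congr fun a => h0 _ h
  simp_rw [hδ]
  rw [← Finset.sum_filter, Finset.sum_const, nsmul_eq_mul, ← Fintype.card_subtype]
  rfl

end

/-! ### Sums of products of actions -/

section

variable {ρ θ : ℝ}

theorem signCount_four : signCount 4 = 6 := by decide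

theorem signCount_six : signCount 6 = 20 := by decide +kernel

section

variable {I : ℤ → ℝ}

theorem summable_prod_actions (hI : Summable fun a => ‖I a‖) (n : ℕ) :
    Summable fun x : Fin n → ℤ => ‖∏ k, I (x k)‖ :=
  (summable_norm_prod (fun _ => I) fun _ => hI).1

theorem tsum_prod_actions (hI : Summable fun a => ‖I a‖) (n : ℕ) :
    ∑' x : Fin n → ℤ, ∏ k, I (x k) = (∑' a, I a) ^ n := by
  rw [(summable_norm_prod (fun _ => I) fun _ => hI).2]
  simp

theorem tsum_const_seq {n : ℕ} [NeZero n] (F : (Fin n → ℤ) → ℝ) (p : (Fin n → ℤ) → Prop)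
    [DecidablePred p] (hp : ∀ x, p x ↔ ∀ k, x k = x 0) :
    ∑' x, (if p x then F x else 0) = ∑' a : ℤ, F fun _ => a := by
  have hg : Function.Injective fun (a : ℤ) (_ : Fin n) => a := fun a b h => congrFun h 0
  rw [← hg.tsum_eq]
  · exact tsum_congr fun a => if_pos ((hp _).2 fun _ => rfl)
  · intro x hx
    have : p x := by by_contra h; exact hx (if_neg h)
    exact ⟨x 0, funext fun k => ((hp x).1 this k).symm⟩

theorem tsum_pair_seq (i : Fin 3) (F : (Fin 3 → ℤ) → ℝ) :
    ∑' x : Fin 3 → ℤ, (if x (i.succAbove 0) = x (i.succAbove 1) then F x else 0) =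
      ∑' p : ℤ × ℤ, F (i.insertNth p.1 fun _ : Fin 2 => p.2) := by
  have hg : Function.Injective fun p : ℤ × ℤ => (i.insertNth p.1 fun _ : Fin 2 => p.2 : Fin 3 → ℤ) := by
    intro p q h
    have h1 := congrFun h i
    have h2 := congrFun h (i.succAbove 0)
    simp only [Fin.insertNth_apply_same, Fin.insertNth_apply_succAbove] at h1 h2
    exact Prod.ext h1 h2
  rw [← hg.tsum_eq]
  · exact tsum_congr fun p => if_pos (by simp only [Fin.insertNth_apply_succAbove])
  · intro x hx
    have h : x (i.succAbove 0) = x (i.succAbove 1) := by by_contra h; exact hx (if_neg h)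
    refine ⟨(x i, x (i.succAbove 0)), ?_⟩
    refine funext fun k => ?_
    refine Fin.succAboveCases i ?_ (fun k => ?_) k
    · simp
    · simp only [Fin.insertNth_apply_succAbove]
      fin_cases k
      · rfl
      · exact h

theorem summable_ite {ι : Type*} {f : ι → ℝ} (hf : Summable fun x => ‖f x‖) (p : ι → Prop)
    [DecidablePred p] : Summable fun x => if p x then f x else 0 :=
  Summable.of_norm_bounded hf fun x => by split_ifs <;> simp

theorem tsum_orbitCount_two (hI : Summable fun a => ‖I a‖) :
    ∑' x : Fin 2 → ℤ, (orbitCount x : ℝ) * ∏ k, I (x k) = 2 * (∑' a, I a) ^ 2 - ∑' a, I a ^ 2 := by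
  have hs := summable_prod_actions hI 2
  have e : ∀ x : Fin 2 → ℤ, (orbitCount x : ℝ) * ∏ k, I (x k) =
      2 * (∏ k, I (x k)) - if x 0 = x 1 then ∏ k, I (x k) else 0 := by
    intro x
    rw [orbitCount_two]
    split_ifs <;> norm_num
    ring
  simp_rw [e]
  rw [(hs.of_norm.mul_left 2).tsum_sub (summable_ite hs fun x => x 0 = x 1), tsum_mul_left,
    tsum_prod_actions hI, tsum_const_seq (fun x => ∏ k, I (x k)) (fun x => x 0 = x 1) fun x => by
      simp [Fin.forall_fin_two, eq_comm]]
  simp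

theorem summable_norm_sq_actions (hI : Summable fun a => ‖I a‖) : Summable fun a => ‖I a ^ 2‖ := by
  have h := (hI.mul_norm hI)
  have hg : Function.Injective fun a : ℤ => (a, a) := fun a b h => (Prod.ext_iff.1 h).1
  refine (h.comp_injective hg).congr fun a => ?_
  simp [sq]

theorem tsum_pair_actions (hI : Summable fun a => ‖I a‖) (i : Fin 3) :
    ∑' x : Fin 3 → ℤ, (if x (i.succAbove 0) = x (i.succAbove 1) then ∏ k, I (x k) else 0) =
      (∑' a, I a) * ∑' a, I a ^ 2 := by
  rw [tsum_pair_seq i, tsum_mul_tsum_of_summable_norm hI (summable_norm_sq_actions hI)]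
  refine tsum_congr fun p => ?_
  rw [Fin.prod_univ_succAbove _ i]
  simp [sq]

theorem tsum_orbitCount_three (hI : Summable fun a => ‖I a‖) :
    ∑' x : Fin 3 → ℤ, (orbitCount x : ℝ) * ∏ k, I (x k) =
      6 * (∑' a, I a) ^ 3 - 9 * (∑' a, I a) * (∑' a, I a ^ 2) + 4 * ∑' a, I a ^ 3 := by
  have hs := summable_prod_actions hI 3
  have e : ∀ x : Fin 3 → ℤ, (orbitCount x : ℝ) * ∏ k, I (x k) =
      6 * (∏ k, I (x k)) - 3 * (if x 0 = x 1 then ∏ k, I (x k) else 0) -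
      3 * (if x 0 = x 2 then ∏ k, I (x k) else 0) - 3 * (if x 1 = x 2 then ∏ k, I (x k) else 0) +
      4 * (if x 0 = x 1 ∧ x 1 = x 2 then ∏ k, I (x k) else 0) := by
    intro x
    rw [orbitCount_three]
    split_ifs <;> ring
  have s01 := summable_ite hs fun x => x 0 = x 1
  have s02 := summable_ite hs fun x => x 0 = x 2
  have s12 := summable_ite hs fun x => x 1 = x 2
  have s012 := summable_ite hs fun x => x 0 = x 1 ∧ x 1 = x 2
  have e01 := tsum_pair_actions hI 2
  have e02 := tsum_pair_actions hI 1
  have e12 := tsum_pair_actions hI 0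
  have e012 := tsum_const_seq (fun x : Fin 3 → ℤ => ∏ k, I (x k))
    (fun x => x 0 = x 1 ∧ x 1 = x 2) fun x => by
      rw [Fin.forall_fin_succ, Fin.forall_fin_two]
      constructor
      · rintro ⟨h1, h2⟩; exact ⟨rfl, h1.symm, (h1.trans h2).symm⟩
      · rintro ⟨-, h1, h2⟩; exact ⟨h1.symm, h1.trans h2.symm⟩
  change ∑' x : Fin 3 → ℤ, (if x 0 = x 1 then ∏ k, I (x k) else 0) = _ at e01
  change ∑' x : Fin 3 → ℤ, (if x 0 = x 2 then ∏ k, I (x k) else 0) = _ at e02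
  change ∑' x : Fin 3 → ℤ, (if x 1 = x 2 then ∏ k, I (x k) else 0) = _ at e12
  simp_rw [e]
  rw [((((hs.of_norm.mul_left 6).sub (s01.mul_left 3)).sub (s02.mul_left 3)).sub
      (s12.mul_left 3)).tsum_add (s012.mul_left 4),
    (((hs.of_norm.mul_left 6).sub (s01.mul_left 3)).sub (s02.mul_left 3)).tsum_sub (s12.mul_left 3),
    ((hs.of_norm.mul_left 6).sub (s01.mul_left 3)).tsum_sub (s02.mul_left 3),
    (hs.of_norm.mul_left 6).tsum_sub (s01.mul_left 3), tsum_mul_left, tsum_mul_left, tsum_mul_left,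
    tsum_mul_left, tsum_mul_left, tsum_prod_actions hI, e01, e02, e12, e012]
  simp
  ring

end

/-! ### The integrable terms of degree four -/

theorem prod_pairIdx (u : Gevrey ρ θ) {n : ℕ} (x : Fin n → ℤ) (π : Equiv.Perm (Fin n)) :
    ∏ k, coord u (pairIdx x (x ∘ π) k) = ((∏ k, action u (x k) : ℝ) : ℂ) := by
  rw [Fin.prod_univ_add]
  simp only [pairIdx, Fin.append_left, Fin.append_right, coord_one, coord_neg_one,
    Function.comp_apply]
  rw [Equiv.prod_comp π fun k => conj (u (x k)), ← Finset.prod_mul_distrib, Complex.ofReal_prod]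
  refine Finset.prod_congr rfl fun k _ => ?_
  rw [Complex.mul_conj, Complex.normSq_eq_norm_sq, action]

theorem prod_coord_comp (u : Gevrey ρ θ) {n : ℕ} (j : Fin n → Mode) (σ : Equiv.Perm (Fin n)) :
    ∏ k, coord u ((j ∘ σ) k) = ∏ k, coord u (j k) := Equiv.prod_comp σ fun k => coord u (j k)

section

variable [hI : GevreyIndex ρ θ]

theorem summable_action (u : Gevrey ρ θ) : Summable fun a => ‖action u a‖ := by
  have h := (summable_norm_apply u).mul_norm (summable_norm_apply u)
  have hg : Function.Injective fun a : ℤ => (a, a) := fun a b h => (Prod.ext_iff.1 h).1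
  refine (h.comp_injective hg).congr fun a => ?_
  simp [action, sq]

open Classical in
/-- The sum of all the monomials that are products of actions. -/
theorem tsum_matched (u : Gevrey ρ θ) (n : ℕ) (c : ℝ) :
    ∑' j : Fin (n + n) → Mode, (if Matched j then (c : ℂ) else 0) * ∏ k, coord u (j k) =
      ((signCount (n + n) * (c * ∑' x : Fin n → ℤ, (orbitCount x : ℝ) * ∏ k, action u (x k)) : ℝ)
        : ℂ) := by
  have hb : ∀ j : Fin (n + n) → Mode, ‖(if Matched j then (c : ℂ) else 0)‖ ≤ |c| := by
    intro j; split_ifs <;> simp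
  have hs : Summable fun j : Fin (n + n) → Mode =>
      (if Matched j then (c : ℂ) else 0) * ∏ k, coord u (j k) := summable_monomial hb fun _ => u
  rw [tsum_charge_zero hs]
  · push_cast
    congr 1
    rw [← tsum_mul_left]
    refine tsum_congr fun x => ?_
    have h := tsum_orbit x (F := fun y => (c : ℂ) * ∏ k, coord u (pairIdx x y k))
      (v := c * ((∏ k, action u (x k) : ℝ) : ℂ)) fun π => by rw [prod_pairIdx]
    rw [mul_left_comm]
    push_cast at h
    rw [← h]
    refine tsum_congr fun y => ?_
    simp only [matched_pairIdx_iff, ite_mul, zero_mul]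
  · intro j σ
    simp only [matched_comp_iff]
    rw [prod_coord_comp]
  · intro j hj
    rw [if_neg fun h => hj h.resonant.1, zero_mul]

end

theorem exists_pairIdx {n : ℕ} {j : Fin (n + n) → Mode} (h : charge j = 0) :
    ∃ (x y : Fin n → ℤ) (σ : Equiv.Perm (Fin (n + n))), j = pairIdx x y ∘ σ := by
  let δ₀ : Fin (n + n) → ℤˣ := Fin.append (fun _ => 1) fun _ => -1
  have hδ₀ : ∑ i, (δ₀ i : ℤ) = 0 := by
    simp only [δ₀, Fin.sum_univ_add, Fin.append_left, Fin.append_right]; simp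
  obtain ⟨σ, hσ⟩ := exists_perm_of_charge_eq_zero (δ := fun i => (j i).1) h hδ₀
  refine ⟨fun k => (j (σ.symm (Fin.castAdd n k))).2, fun k => (j (σ.symm (Fin.natAdd n k))).2, σ,
    funext fun i => ?_⟩
  obtain ⟨i, rfl⟩ := σ.symm.surjective i
  have h1 := congrFun hσ (σ.symm i)
  simp only [Function.comp_apply, Equiv.apply_symm_apply] at h1 ⊢
  refine Prod.ext (h1.trans ?_) ?_
  · refine Fin.addCases (fun i => ?_) (fun i => ?_) i <;>
      simp only [δ₀, pairIdx, Fin.append_left, Fin.append_right]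
  · refine Fin.addCases (fun i => ?_) (fun i => ?_) i <;>
      simp only [pairIdx, Fin.append_left, Fin.append_right]

theorem mom_pairIdx {n : ℕ} (x y : Fin n → ℤ) : mom (pairIdx x y) = ∑ k, x k - ∑ k, y k := by
  simp only [mom, Fin.sum_univ_add, pairIdx, Fin.append_left, Fin.append_right]
  simp [sub_eq_add_neg]

theorem freq_pairIdx {n : ℕ} (x y : Fin n → ℤ) :
    freq (pairIdx x y) = ∑ k, x k ^ 2 - ∑ k, y k ^ 2 := by
  simp only [freq, Fin.sum_univ_add, pairIdx, Fin.append_left, Fin.append_right]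
  simp [sub_eq_add_neg]

/-- The resonances of order four are trivial: two numbers are determined up to their order by their
sum and by the sum of their squares. -/
theorem matched_of_resonant_four {j : Fin (2 + 2) → Mode} (hc : charge j = 0) (hm : mom j = 0)
    (hf : freq j = 0) : Matched j := by
  obtain ⟨x, y, σ, rfl⟩ := exists_pairIdx hc
  rw [mom_comp, mom_pairIdx] at hm
  rw [freq_comp, freq_pairIdx] at hf
  rw [matched_comp_iff, matched_pairIdx_iff]
  rw [Fin.sum_univ_two, Fin.sum_univ_two] at hm hf
  have h1 : (y 0 - x 0) * (y 0 - x 1) = 0 := by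
    have : y 1 = x 0 + x 1 - y 0 := by linarith
    rw [this] at hf
    linarith
  rcases mul_eq_zero.1 h1 with h | h
  · refine ⟨1, funext fun k => ?_⟩
    fin_cases k
    · simp; linarith
    · simp; linarith
  · refine ⟨Equiv.swap 0 1, funext fun k => ?_⟩
    fin_cases k
    · simp; linarith
    · simp; linarith

theorem lieSeries_one {P χ : Graded} (hχ0 : χ 0 = 0) (hP0 : P 0 = 0) :
    lieSeries P χ 1 = P 1 + freqMul χ 1 := by
  rw [lieSeries_eq_add, Finset.sum_range_one, iterate_ad_eq_zero hχ0 hP0 le_rfl,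
    iterate_ad_eq_zero hχ0 (freqMul_zero hχ0) le_rfl]
  simp

theorem IsNormalizing.lieSeries_one_apply {P χ : Graded} {C₀ : ℝ} {m : ℕ}
    (h : IsNormalizing P C₀ m χ) (hm : 1 < m) (hP0 : P 0 = 0) (j : Fin (2 * 1 + 1 + 1) → Mode) :
    lieSeries P χ 1 j = if freq j = 0 then P 1 j else 0 := by
  split_ifs with hj
  · rw [lieSeries_one h.zero hP0, Pi.add_apply, freqMul, hj]
    simp
  · exact h.lieSeries_eq_zero 1 one_ne_zero hm j hj

open Classical in
theorem nlsCoef_of_matched {n : ℕ} (c : ℝ) (j : Fin n → Mode) :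
    (if Matched j then nlsCoef n c j else 0) =
      if Matched j then ((c / signCount n : ℝ) : ℂ) else 0 := by
  split_ifs with h
  · exact if_pos ⟨h.resonant.1, h.resonant.2.1⟩
  · rfl

/-- The quartic terms of the transformed Hamiltonian. -/
theorem evalC_lieSeries_one [hI : GevreyIndex ρ θ] {P χ : Graded} {C₀ : ℝ} {m : ℕ}
    (h : IsNormalizing P C₀ m χ) (hm : 1 < m) (hP0 : P 0 = 0) {c : ℝ}
    (hP1 : P 1 = nlsCoef (2 * 1 + 1 + 1) c) (u : Gevrey ρ θ) :
    evalC ρ θ (lieSeries P χ 1) u =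
      ((c * (2 * (∑' a, action u a) ^ 2 - ∑' a, action u a ^ 2) : ℝ) : ℂ) := by
  classical
  rw [evalC_eq_tsum (h.isHam_lieSeries 1 one_ne_zero hm), ← tsum_orbitCount_two (summable_action u)]
  have e : ∀ j : Fin (2 + 2) → Mode, lieSeries P χ 1 j =
      if Matched j then ((c / signCount (2 + 2) : ℝ) : ℂ) else 0 := by
    intro j
    rw [h.lieSeries_one_apply hm hP0, hP1]
    by_cases hj : Matched j
    · rw [if_pos hj]
      refine (if_pos hj.resonant.2.2).trans ?_
      exact if_pos ⟨hj.resonant.1, hj.resonant.2.1⟩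
    · rw [if_neg hj]
      by_cases hf : freq (n := 2 + 2) j = 0
      · refine (if_pos hf).trans (if_neg fun hcm => hj ?_)
        exact matched_of_resonant_four hcm.1 hcm.2 hf
      · exact if_neg hf
  have h4 : ((signCount (2 + 2) : ℕ) : ℝ) = 6 := by exact_mod_cast signCount_four
  have key := tsum_matched u 2 (c / signCount (2 + 2))
  refine Eq.trans (tsum_congr fun j => ?_) (key.trans ?_)
  · exact congrArg (· * _) (e j)
  · congr 1
    rw [h4]; ring

end

/-! ### The integrable terms of degree six -/

section

variable {ρ θ : ℝ}

section ActionSums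

variable {I : ℤ → ℝ}

theorem abs_inv_mul_le (a b : ℤ) : |((a : ℝ) * b)⁻¹| ≤ 1 := by
  rcases eq_or_ne (a * b) 0 with h | h
  · have : (a : ℝ) * b = 0 := by exact_mod_cast h
    rw [this]; simp
  · have h1 : (1 : ℝ) ≤ |(a : ℝ) * b| := by exact_mod_cast Int.one_le_abs h
    rw [abs_inv]
    exact inv_le_one_of_one_le₀ h1

theorem summable_exchange (hI : Summable fun a => ‖I a‖) :
    Summable fun x : Fin 3 → ℤ =>
      ‖(∏ k, I (x k)) * (((x 0 - x 1 : ℤ) : ℝ) * (x 0 - x 2 : ℤ))⁻¹‖ := by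
  refine Summable.of_nonneg_of_le (fun _ => norm_nonneg _) (fun x => ?_) (summable_prod_actions hI 3)
  rw [norm_mul]
  exact mul_le_of_le_one_right (norm_nonneg _) (abs_inv_mul_le _ _)

/-- The partial fraction identity
`1 / ((a - b) (a - c)) + 1 / ((c - a) (c - b)) + 1 / ((b - c) (b - a)) = 0`. -/
theorem exchange_cyclic (a b c : ℤ) (A : ℝ) :
    (if b = c then 0 else A * (((a - b : ℤ) : ℝ) * (a - c : ℤ))⁻¹) +
      (if a = b then 0 else A * (((c - a : ℤ) : ℝ) * (c - b : ℤ))⁻¹) +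
      (if c = a then 0 else A * (((b - c : ℤ) : ℝ) * (b - a : ℤ))⁻¹) = 0 := by
  rcases eq_or_ne b c with rfl | h12
  · simp
  rcases eq_or_ne a b with rfl | h01
  · simp
  rcases eq_or_ne c a with rfl | h20
  · simp
  rw [if_neg h12, if_neg h01, if_neg h20]
  have e1 : (b : ℝ) - c ≠ 0 := sub_ne_zero.2 (by exact_mod_cast h12)
  have e2 : (a : ℝ) - b ≠ 0 := sub_ne_zero.2 (by exact_mod_cast h01)
  have e3 : (c : ℝ) - a ≠ 0 := sub_ne_zero.2 (by exact_mod_cast h20)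
  have e4 : (c : ℝ) - b ≠ 0 := by rw [← neg_sub]; exact neg_ne_zero.2 e1
  have e5 : (b : ℝ) - a ≠ 0 := by rw [← neg_sub]; exact neg_ne_zero.2 e2
  have e6 : (a : ℝ) - c ≠ 0 := by rw [← neg_sub]; exact neg_ne_zero.2 e3
  push_cast
  field_simp
  ring

/-- The contributions of three distinct modes cancel. -/
theorem tsum_exchange_distinct (hI : Summable fun a => ‖I a‖) :
    ∑' x : Fin 3 → ℤ, (if x 1 = x 2 then 0 else
      (∏ k, I (x k)) * (((x 0 - x 1 : ℤ) : ℝ) * (x 0 - x 2 : ℤ))⁻¹) = 0 := by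
  obtain ⟨U, hU⟩ : ∃ U : (Fin 3 → ℤ) → ℝ, ∀ x, U x = if x 1 = x 2 then 0 else
      (∏ k, I (x k)) * (((x 0 - x 1 : ℤ) : ℝ) * (x 0 - x 2 : ℤ))⁻¹ := ⟨_, fun _ => rfl⟩
  have hs : Summable U := by
    refine Summable.of_norm_bounded (summable_exchange hI) fun x => ?_
    rw [hU]
    split_ifs
    · rw [norm_zero]; exact norm_nonneg _
    · exact le_rfl
  obtain ⟨e, he⟩ : ∃ e : (Fin 3 → ℤ) ≃ (Fin 3 → ℤ), ∀ x, e x 0 = x 2 ∧ e x 1 = x 0 ∧ e x 2 = x 1 :=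
    ⟨Equiv.arrowCongr (finRotate 3) (Equiv.refl ℤ), fun _ => ⟨rfl, rfl, rfl⟩⟩
  have h1 : ∑' x, U (e x) = ∑' x, U x := e.tsum_eq U
  have h2 : ∑' x, U (e (e x)) = ∑' x, U x := (e.tsum_eq fun x => U (e x)).trans h1
  have s1 : Summable fun x => U (e x) := e.summable_iff.2 hs
  have s2 : Summable fun x => U (e (e x)) := e.summable_iff.2 s1
  have h3 : ∀ x, U x + U (e x) + U (e (e x)) = 0 := by
    intro x
    have hp : ∀ x, ∏ k, I (e x k) = ∏ k, I (x k) := fun x => by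
      rw [Fin.prod_univ_three, Fin.prod_univ_three, (he x).1, (he x).2.1, (he x).2.2]; ring
    rw [hU, hU, hU, hp (e x), hp, (he (e x)).1, (he (e x)).2.1, (he (e x)).2.2, (he x).1, (he x).2.1,
      (he x).2.2]
    exact exchange_cyclic _ _ _ _
  -- three times the sum is zero, because the cyclic shift `e` does not change it
  have h4 := (hs.add s1).tsum_add s2
  rw [hs.tsum_add s1, h1, h2] at h4
  simp only [h3, tsum_zero] at h4
  rw [← tsum_congr hU]
  linarith

/-- The sum over the triples of modes of the exchange coefficients: only the triples with two equal
entries contribute. -/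
theorem tsum_exchange (hI : Summable fun a => ‖I a‖) :
    ∑' x : Fin 3 → ℤ, (if x 1 = x 2 then (3 : ℝ) else 6) *
      ((∏ k, I (x k)) * (((x 0 - x 1 : ℤ) : ℝ) * (x 0 - x 2 : ℤ))⁻¹) =
      3 * ∑' p : {p : ℤ × ℤ // p.1 ≠ p.2}, I p.1.1 ^ 2 * I p.1.2 / ((p.1.1 : ℝ) - (p.1.2 : ℝ)) ^ 2 := by
  set T : (Fin 3 → ℤ) → ℝ := fun x =>
    (∏ k, I (x k)) * (((x 0 - x 1 : ℤ) : ℝ) * (x 0 - x 2 : ℤ))⁻¹ with hT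
  have hs := summable_exchange hI
  have e : ∀ x : Fin 3 → ℤ, (if x 1 = x 2 then (3 : ℝ) else 6) * T x =
      6 * (if x 1 = x 2 then 0 else T x) + 3 * (if x 1 = x 2 then T x else 0) := by
    intro x; split_ifs <;> ring
  have s1 : Summable fun x : Fin 3 → ℤ => if x 1 = x 2 then 0 else T x :=
    Summable.of_norm_bounded hs fun x => by
      split_ifs
      · rw [norm_zero]; exact norm_nonneg _
      · exact le_rfl
  have s2 : Summable fun x : Fin 3 → ℤ => if x 1 = x 2 then T x else 0 :=
    Summable.of_norm_bounded hs fun x => by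
      split_ifs
      · exact le_rfl
      · rw [norm_zero]; exact norm_nonneg _
  have h1 : ∑' x : Fin 3 → ℤ, (if x 1 = x 2 then T x else 0) =
      ∑' p : ℤ × ℤ, T ((0 : Fin 3).insertNth p.1 fun _ : Fin 2 => p.2) := tsum_pair_seq 0 T
  refine (tsum_congr e).trans ?_
  rw [(s1.mul_left 6).tsum_add (s2.mul_left 3), tsum_mul_left, tsum_mul_left,
    tsum_exchange_distinct hI, h1, mul_zero, zero_add]
  congr 1
  rw [← (Equiv.prodComm ℤ ℤ).tsum_eq]
  have h2 := tsum_subtype {p : ℤ × ℤ | p.1 ≠ p.2} fun p : ℤ × ℤ =>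
    I p.1 ^ 2 * I p.2 / ((p.1 : ℝ) - (p.2 : ℝ)) ^ 2
  refine Eq.trans (tsum_congr fun p => ?_) h2.symm
  have hp : T ((0 : Fin 3).insertNth p.2 fun _ : Fin 2 => p.1) =
      I p.1 ^ 2 * I p.2 / ((p.1 : ℝ) - (p.2 : ℝ)) ^ 2 := by
    have e0 : ((0 : Fin 3).insertNth p.2 fun _ : Fin 2 => p.1 : Fin 3 → ℤ) 0 = p.2 := rfl
    have e1 : ((0 : Fin 3).insertNth p.2 fun _ : Fin 2 => p.1 : Fin 3 → ℤ) 1 = p.1 := rfl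
    have e2 : ((0 : Fin 3).insertNth p.2 fun _ : Fin 2 => p.1 : Fin 3 → ℤ) 2 = p.1 := rfl
    simp only [hT, Fin.prod_univ_three, e0, e1, e2]
    rw [div_eq_mul_inv]
    push_cast
    ring
  refine hp.trans ?_
  by_cases h : p.1 = p.2
  · rw [Set.indicator_of_notMem (by simp [h]), h]; simp
  · rw [Set.indicator_of_mem (by simpa using h)]

end ActionSums

/-- The contraction of two copies of the quartic polynomial, one of them divided by its frequencies;
`c` is the value of its nonzero coefficients. -/
def exchange (c : ℝ) (x y : Fin 3 → Mode) : ℂ :=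
  8 * (((complMode x).1 : ℤ) : ℂ) *
    (if charge ((0 : Fin 4).insertNth (complMode x) x : Fin 4 → Mode) = 0 ∧
        mom ((0 : Fin 4).insertNth (complMode x) x : Fin 4 → Mode) = 0 then (c : ℂ) else 0) *
    (if charge ((0 : Fin 4).insertNth (bar (complMode x)) y : Fin 4 → Mode) = 0 ∧
        mom ((0 : Fin 4).insertNth (bar (complMode x)) y : Fin 4 → Mode) = 0 then (c : ℂ) else 0) /
    (freq ((0 : Fin 4).insertNth (bar (complMode x)) y : Fin 4 → Mode) : ℂ)

/-- A triple of modes, the one at the position `i` having the sign `s` and the other two the opposite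
sign. -/
def tripleIdx (i : Fin 3) (s : ℤˣ) (a : Fin 3 → ℤ) : Fin 3 → Mode :=
  i.insertNth (s, a 0) fun k : Fin 2 => (-s, a k.succ)

theorem charge_tripleIdx (i : Fin 3) (s : ℤˣ) (a : Fin 3 → ℤ) :
    charge (tripleIdx i s a) = -(s : ℤ) := by
  rw [tripleIdx, charge_insertNth, charge, Fin.sum_univ_two]
  push_cast; ring

theorem mom_tripleIdx (i : Fin 3) (s : ℤˣ) (a : Fin 3 → ℤ) :
    mom (tripleIdx i s a) = (s : ℤ) * (a 0 - a 1 - a 2) := by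
  rw [tripleIdx, mom_insertNth, mom, Fin.sum_univ_two]
  push_cast
  ring

theorem freq_tripleIdx (i : Fin 3) (s : ℤˣ) (a : Fin 3 → ℤ) :
    freq (tripleIdx i s a) = (s : ℤ) * (a 0 ^ 2 - a 1 ^ 2 - a 2 ^ 2) := by
  rw [tripleIdx, freq_insertNth, freq, Fin.sum_univ_two]
  push_cast
  ring

theorem complMode_tripleIdx (i : Fin 3) (s : ℤˣ) (a : Fin 3 → ℤ) :
    complMode (tripleIdx i s a) = (s, a 1 + a 2 - a 0) := by
  rw [complMode, charge_tripleIdx, mom_tripleIdx]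
  rcases Int.units_eq_one_or s with rfl | rfl
  · simp; ring
  · simp; ring

/-- The denominator factorizes: `2 (a₀ - a₁) (a₀ - a₂)` is the frequency of the quartic monomial. -/
theorem exchange_eq (c : ℝ) (i : Fin 3) (s : ℤˣ) (a : Fin 3 → ℤ) {y : Fin 3 → Mode}
    (hc : charge y = -charge (tripleIdx i s a)) (hm : mom y = -mom (tripleIdx i s a))
    (hf : freq y = -freq (tripleIdx i s a)) :
    exchange c (tripleIdx i s a) y =
      ((-4 * c ^ 2 * (((a 0 - a 1 : ℤ) : ℝ) * (a 0 - a 2 : ℤ))⁻¹ : ℝ) : ℂ) := by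
  rw [charge_tripleIdx, neg_neg] at hc
  rw [mom_tripleIdx] at hm
  rw [freq_tripleIdx] at hf
  rw [exchange, complMode_tripleIdx, if_pos, if_pos]
  · rw [freq_insertNth, hf]
    have h1 : (((bar (s, a 1 + a 2 - a 0)).1 : ℤˣ) : ℤ) * (bar (s, a 1 + a 2 - a 0)).2 ^ 2 +
        -((s : ℤ) * (a 0 ^ 2 - a 1 ^ 2 - a 2 ^ 2)) =
        -2 * s * ((a 0 - a 1) * (a 0 - a 2)) := by
      simp only [bar]; push_cast; ring
    rw [h1]
    have hs : ((s : ℤ) : ℂ) ≠ 0 := by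
      rcases Int.units_eq_one_or s with rfl | rfl <;> simp
    push_cast
    by_cases h2 : ((a 0 : ℂ) - a 1) * ((a 0 : ℂ) - a 2) = 0
    · rw [h2]; simp
    · field_simp
      ring
  · rw [charge_insertNth, mom_insertNth, hc, hm]
    simp only [bar]; push_cast
    constructor <;> ring
  · rw [charge_insertNth, mom_insertNth, charge_tripleIdx, mom_tripleIdx]
    constructor <;> ring

theorem exchange_eq_zero (c : ℝ) {x : Fin 3 → Mode} (y : Fin 3 → Mode)
    (h : ¬ (charge x = 1 ∨ charge x = -1)) : exchange c x y = 0 := by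
  rw [exchange, if_neg]
  · simp
  · rintro ⟨h1, -⟩
    rw [charge_insertNth] at h1
    rcases Int.units_eq_one_or (complMode x).1 with h2 | h2 <;> rw [h2] at h1 <;> push_cast at h1
    · exact h (Or.inr (by linarith))
    · exact h (Or.inl (by linarith))

theorem orbitCount_tripleIdx (i : Fin 3) (s : ℤˣ) (a : Fin 3 → ℤ) :
    (orbitCount (fun k => bar (tripleIdx i s a k)) : ℝ) = if a 1 = a 2 then 3 else 6 := by
  rw [orbitCount_three]
  have hs : s ≠ -s := by rcases Int.units_eq_one_or s with rfl | rfl <;> decide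
  have hs' : -s ≠ s := hs.symm
  fin_cases i
  · have e0 : tripleIdx 0 s a 0 = (s, a 0) := rfl
    have e1 : tripleIdx 0 s a 1 = (-s, a 1) := rfl
    have e2 : tripleIdx 0 s a 2 = (-s, a 2) := rfl
    simp only [Fin.zero_eta, e0, e1, e2, bar, Prod.mk.injEq, neg_neg, hs', false_and, if_false,
      true_and]
    split_ifs <;> norm_num
  · have e0 : tripleIdx 1 s a 0 = (-s, a 1) := rfl
    have e1 : tripleIdx 1 s a 1 = (s, a 0) := rfl
    have e2 : tripleIdx 1 s a 2 = (-s, a 2) := rfl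
    simp only [Fin.mk_one, e0, e1, e2, bar, Prod.mk.injEq, neg_neg, hs', hs, false_and, if_false,
      true_and]
    split_ifs <;> norm_num
  · have e0 : tripleIdx 2 s a 0 = (-s, a 1) := rfl
    have e1 : tripleIdx 2 s a 1 = (-s, a 2) := rfl
    have e2 : tripleIdx 2 s a 2 = (s, a 0) := rfl
    simp only [Fin.reduceFinMk, e0, e1, e2, bar, Prod.mk.injEq, neg_neg, hs, false_and, if_false,
      true_and, and_false]
    split_ifs <;> norm_num

theorem tripleIdx_ne_bar {i : Fin 3} {s : ℤˣ} {a : Fin 3 → ℤ} (h1 : a 0 ≠ a 1) (h2 : a 0 ≠ a 2)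
    (k l : Fin 3) : tripleIdx i s a k ≠ bar (tripleIdx i s a l) := by
  have hs : s ≠ -s := by rcases Int.units_eq_one_or s with rfl | rfl <;> decide
  have ht : ∀ k, tripleIdx i s a k = (s, a 0) ∨ tripleIdx i s a k = (-s, a 1) ∨
      tripleIdx i s a k = (-s, a 2) := by
    intro k
    refine Fin.succAboveCases i ?_ (fun k => ?_) k
    · left; simp [tripleIdx]
    · right
      simp only [tripleIdx, Fin.insertNth_apply_succAbove]
      fin_cases k
      · left; rfl
      · right; rfl
  rcases ht k with h | h | h <;> rcases ht l with h' | h' | h' <;> rw [h, h'] <;>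
    simp [bar, hs, hs.symm, h1, h2, h1.symm, h2.symm]

theorem prod_coord_tripleIdx (u : Gevrey ρ θ) (i : Fin 3) (s : ℤˣ) (a : Fin 3 → ℤ) :
    (∏ k, coord u (tripleIdx i s a k)) * ∏ k, coord u (bar (tripleIdx i s a k)) =
      ((∏ k, action u (a k) : ℝ) : ℂ) := by
  have h : ∀ o : Mode, coord u o * coord u (bar o) = (action u o.2 : ℂ) := by
    intro o
    rw [coord_bar, Complex.mul_conj, Complex.normSq_eq_norm_sq, norm_coord, action]
  rw [← Finset.prod_mul_distrib]
  simp_rw [h]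
  rw [Fin.prod_univ_succAbove _ i, Fin.prod_univ_three]
  simp [tripleIdx]
  ring

theorem exists_eq_insertNth (δ : Fin 3 → ℤˣ) (h : ∑ i, (δ i : ℤ) = 1 ∨ ∑ i, (δ i : ℤ) = -1) :
    ∃ (i : Fin 3) (s : ℤˣ), δ = i.insertNth s fun _ : Fin 2 => -s := by
  revert δ
  decide

theorem card_sign_triples : (Finset.univ.filter fun δ : Fin 3 → ℤˣ =>
    ∑ i, (δ i : ℤ) = 1 ∨ ∑ i, (δ i : ℤ) = -1).card = 6 := by
  decide

open Classical in
/-- The sum over the partners of a triple of modes. -/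
theorem tsum_exchange_inner (u : Gevrey ρ θ) (c : ℝ) (i : Fin 3) (s : ℤˣ) (a : Fin 3 → ℤ) :
    ∑' y : Fin 3 → Mode, (if Matched (Fin.append (tripleIdx i s a) y) then
        exchange c (tripleIdx i s a) y else 0) *
        ((∏ k, coord u (tripleIdx i s a k)) * ∏ k, coord u (y k)) =
      ((-4 * c ^ 2 * ((if a 1 = a 2 then (3 : ℝ) else 6) *
        ((∏ k, action u (a k)) * (((a 0 - a 1 : ℤ) : ℝ) * (a 0 - a 2 : ℤ))⁻¹)) : ℝ) : ℂ) := by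
  set x := tripleIdx i s a with hx
  have hex : ∀ y, Matched (Fin.append x y) → exchange c x y =
      ((-4 * c ^ 2 * (((a 0 - a 1 : ℤ) : ℝ) * (a 0 - a 2 : ℤ))⁻¹ : ℝ) : ℂ) := by
    intro y hy
    have h1 : charge (Fin.append x y) = charge x + charge y := by
      simp only [charge, Fin.sum_univ_add, Fin.append_left, Fin.append_right]
    have h2 : mom (Fin.append x y) = mom x + mom y := by
      simp only [mom, Fin.sum_univ_add, Fin.append_left, Fin.append_right]
    have h3 : freq (Fin.append x y) = freq x + freq y := by
      simp only [freq, Fin.sum_univ_add, Fin.append_left, Fin.append_right]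
    obtain ⟨r1, r2, r3⟩ := hy.resonant
    exact exchange_eq c i s a (by rw [← hx]; omega) (by rw [← hx]; omega) (by rw [← hx]; omega)
  -- the partners of a triple without cancelling modes are the rearrangements of its conjugate; for
  -- the other triples the frequency vanishes, and so does the coefficient, as a quotient by zero
  by_cases h : a 0 ≠ a 1 ∧ a 0 ≠ a 2
  · have horb := tsum_orbit (fun k => bar (x k))
      (F := fun y => ((-4 * c ^ 2 * (((a 0 - a 1 : ℤ) : ℝ) * (a 0 - a 2 : ℤ))⁻¹ : ℝ) : ℂ) *
        ((∏ k, coord u (x k)) * ∏ k, coord u (y k)))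
      (v := ((-4 * c ^ 2 * (((a 0 - a 1 : ℤ) : ℝ) * (a 0 - a 2 : ℤ))⁻¹ : ℝ) : ℂ) *
        ((∏ k, action u (a k) : ℝ) : ℂ)) fun π => by
          rw [prod_coord_comp, hx, prod_coord_tripleIdx]
    have hn : (orbitCount (fun k => bar (x k)) : ℂ) = ((if a 1 = a 2 then (3 : ℝ) else 6 : ℝ) : ℂ) := by
      rw [← orbitCount_tripleIdx i s a]; push_cast; rfl
    rw [hn] at horb
    refine Eq.trans (tsum_congr fun y => ?_) (horb.trans ?_)
    · have hiff := matched_append_iff (y := y) (tripleIdx_ne_bar (i := i) (s := s) h.1 h.2)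
      by_cases hy : Matched (Fin.append x y)
      · rw [if_pos hy, if_pos (hiff.1 hy), hex y hy]
      · rw [if_neg hy, if_neg fun h => hy (hiff.2 h), zero_mul]
    · push_cast; ring
  · have hz : (((a 0 - a 1 : ℤ) : ℝ) * (a 0 - a 2 : ℤ)) = 0 := by
      rw [not_and_or, not_not, not_not] at h
      rcases h with h | h <;> rw [h] <;> simp
    rw [hz, inv_zero, mul_zero, mul_zero, mul_zero, Complex.ofReal_zero]
    refine (tsum_congr fun y => ?_).trans tsum_zero
    split_ifs with hy
    · rw [hex y hy, hz]; simp
    · rw [zero_mul]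

section

variable [hI : GevreyIndex ρ θ]

open Classical in
/-- The integrable monomials produced by the bracket of the quartic polynomial with its generator. -/
theorem tsum_exchange_matched (u : Gevrey ρ θ) {B : ℝ} (c : ℝ) {Q : Coef (3 + 3)}
    (hB : ∀ j, ‖Q j‖ ≤ B) (hQ : ∀ x y, Q (Fin.append x y) =
      if Matched (Fin.append x y) then exchange c x y else 0) :
    ∑' j, Q j * ∏ k, coord u (j k) =
      ((-72 * c ^ 2 * ∑' p : {p : ℤ × ℤ // p.1 ≠ p.2}, action u p.1.1 ^ 2 * action u p.1.2 /
        ((p.1.1 : ℝ) - (p.1.2 : ℝ)) ^ 2 : ℝ) : ℂ) := by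
  have hs : Summable fun j => Q j * ∏ k, coord u (j k) := summable_monomial hB fun _ => u
  have hs' := (Fin.appendEquiv (α := Mode) 3 3).summable_iff.2 hs
  rw [← (Fin.appendEquiv (α := Mode) 3 3).tsum_eq]
  refine (hs'.tsum_prod).trans ?_
  have hsx : Summable fun x => ∑' y, ((fun j => Q j * ∏ k, coord u (j k)) ∘
    (Fin.appendEquiv (α := Mode) 3 3)) (x, y) := hs'.prod
  rw [tsum_signs hsx]
  set S : ℂ := ∑' a : Fin 3 → ℤ, ((-4 * c ^ 2 * ((if a 1 = a 2 then (3 : ℝ) else 6) *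
        ((∏ k, action u (a k)) * (((a 0 - a 1 : ℤ) : ℝ) * (a 0 - a 2 : ℤ))⁻¹)) : ℝ) : ℂ) with hS
  have hterm : ∀ x : Fin 3 → Mode, ∑' y, ((fun j => Q j * ∏ k, coord u (j k)) ∘
      (Fin.appendEquiv (α := Mode) 3 3)) (x, y) =
      ∑' y, (if Matched (Fin.append x y) then exchange c x y else 0) *
        ((∏ k, coord u (x k)) * ∏ k, coord u (y k)) := by
    intro x
    refine tsum_congr fun y => ?_
    simp only [Function.comp_apply, Fin.appendEquiv, Equiv.coe_fn_mk]
    rw [hQ, Fin.prod_univ_add]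
    simp only [Fin.append_left, Fin.append_right]
  have hδ : ∀ δ : Fin 3 → ℤˣ, (∑' a : Fin 3 → ℤ, ∑' y, ((fun j => Q j * ∏ k, coord u (j k)) ∘
      (Fin.appendEquiv (α := Mode) 3 3)) (fun k => (δ k, a k), y)) =
      if ∑ i, (δ i : ℤ) = 1 ∨ ∑ i, (δ i : ℤ) = -1 then S else 0 := by
    intro δ
    simp_rw [hterm]
    split_ifs with h
    -- `i` is the position of the sign that occurs once, and `e` moves the entry `0` there
    · obtain ⟨i, s, rfl⟩ := exists_eq_insertNth δ h
      let e : (Fin 3 → ℤ) ≃ (Fin 3 → ℤ) :=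
        (Fin.consEquiv fun _ : Fin 3 => ℤ).symm.trans (Fin.insertNthEquiv (fun _ => ℤ) i)
      rw [← e.tsum_eq, hS]
      refine tsum_congr fun a => ?_
      rw [← tsum_exchange_inner u c i s a]
      have he : (fun k => ((i.insertNth s (fun _ : Fin 2 => -s) : Fin 3 → ℤˣ) k, e a k)) =
          tripleIdx i s a := by
        funext k
        refine Fin.succAboveCases i ?_ (fun k => ?_) k
        · simp [tripleIdx, e, Fin.insertNthEquiv, Fin.consEquiv]
        · simp [tripleIdx, e, Fin.insertNthEquiv, Fin.consEquiv, Fin.tail]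
      have hk := fun k => congrFun he k
      simp only [hk]
    · refine (tsum_congr fun a => ?_).trans tsum_zero
      refine (tsum_congr fun y => ?_).trans tsum_zero
      rw [exchange_eq_zero c (x := fun k => (δ k, a k)) y h, ite_self, zero_mul]
  simp_rw [hδ]
  rw [← Finset.sum_filter, Finset.sum_const, card_sign_triples, hS, ← Complex.ofReal_tsum,
    tsum_mul_left, tsum_exchange (summable_action u)]
  push_cast
  simp
  ring

end

end

/-! ### The integrable part of the sixth degree terms -/

section

variable {ρ θ : ℝ}

theorem ad_two {χ F : Graded} (hχ0 : χ 0 = 0) (hF0 : F 0 = 0) :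
    ad χ F 2 = bracket (p := 3) (q := 3) (N := 6) rfl (F 1) (χ 1) := by
  have h0 : ∀ h, bracket (p := 2 * (2 - 0) + 1) (q := 2 * 0 + 1) (N := 2 * 2 + 1 + 1) h (F (2 - 0)) (χ 0) = 0 :=
    fun h => by rw [hχ0, bracket_zero_right]
  have h2 : ∀ h, bracket (p := 2 * (2 - 2) + 1) (q := 2 * 2 + 1) (N := 2 * 2 + 1 + 1) h (F (2 - 2)) (χ 2) = 0 :=
    fun h => by
      have : F (2 - 2) = 0 := hF0
      rw [this, bracket_zero_left]
  unfold ad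
  rw [Fin.sum_univ_three]
  refine (congrArg₂ (· + ·) (congrArg₂ (· + ·) (h0 _) rfl) (h2 _)).trans ?_
  rw [zero_add, add_zero]
  rfl

theorem lieSeries_two {P χ : Graded} (hχ0 : χ 0 = 0) (hP0 : P 0 = 0) :
    lieSeries P χ 2 = P 2 + freqMul χ 2 + (ad χ P 2 + (2⁻¹ : ℝ) • ad χ (freqMul χ) 2) := by
  rw [lieSeries_eq_add, Finset.sum_range_succ, Finset.sum_range_one,
    iterate_ad_eq_zero hχ0 hP0 le_rfl, iterate_ad_eq_zero hχ0 (freqMul_zero hχ0) le_rfl]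
  simp [Nat.factorial]

/-- The solution of the homological equation in degree four. For `freq j = 0` both sides vanish, the
right-hand side as a quotient by zero. -/
theorem IsNormalizing.generator_one_apply {P χ : Graded} {C₀ : ℝ} {m : ℕ}
    (h : IsNormalizing P C₀ m χ) (hm : 1 < m) (hP0 : P 0 = 0) (j : Fin (2 * 1 + 1 + 1) → Mode) :
    χ 1 j = Complex.I * P 1 j / freq j := by
  by_cases hj : freq j = 0
  · rw [h.eq_zero_of_freq 1 j hj, hj]; simp
  · have h1 := h.lieSeries_one_apply hm hP0 j
    rw [lieSeries_one h.zero hP0, if_neg hj, Pi.add_apply, freqMul] at h1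
    have hj' : (freq j : ℂ) ≠ 0 := by exact_mod_cast hj
    rw [eq_div_iff hj', eq_neg_of_add_eq_zero_left h1]
    linear_combination (freq j : ℂ) * χ 1 j * Complex.I_mul_I

/-- The resonant coefficients of degree six of the transformed Hamiltonian. Since the generator
solves the homological equation, the two contractions of the quartic polynomial add up to one half
of the first of them. -/
theorem IsNormalizing.lieSeries_two_apply {P χ : Graded} {C₀ : ℝ} {m : ℕ}
    (h : IsNormalizing P C₀ m χ) (hm : 1 < m) (hP0 : P 0 = 0) {c : ℝ}
    (hP1 : P 1 = nlsCoef (2 * 1 + 1 + 1) c) (x y : Fin 3 → Mode)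
    (hj : freq (Fin.append x y) = 0) :
    lieSeries P χ 2 (Fin.append x y : Fin (3 + 3) → Mode) = P 2 (Fin.append x y : Fin (3 + 3) → Mode) + exchange (c / 6) x y := by
  set o := complMode x with ho
  have hfr : freq ((0 : Fin 4).insertNth o x : Fin 4 → Mode) =
      -freq ((0 : Fin 4).insertNth (bar o) y : Fin 4 → Mode) := by
    have h3 : freq (Fin.append x y) = freq x + freq y := by
      simp only [freq, Fin.sum_univ_add, Fin.append_left, Fin.append_right]
    rw [freq_insertNth, freq_insertNth]
    simp only [bar]
    push_cast
    linarith
  -- the coefficients do not depend on the position of the contracted mode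
  obtain ⟨K, hK⟩ : ∃ K : Mode → (Fin 3 → Mode) → ℂ, ∀ o x, K o x =
      if charge ((0 : Fin 4).insertNth o x : Fin 4 → Mode) = 0 ∧
        mom ((0 : Fin 4).insertNth o x : Fin 4 → Mode) = 0 then ((c / 6 : ℝ) : ℂ) else 0 :=
    ⟨_, fun _ _ => rfl⟩
  have hP : ∀ (i : Fin 4) (o : Mode) (x : Fin 3 → Mode), P 1 (i.insertNth o x : Fin 4 → Mode) = K o x := by
    intro i o x
    rw [hP1, hK, nlsCoef, charge_insertNth, mom_insertNth, charge_insertNth, mom_insertNth]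
    have h4 : ((signCount (2 * 1 + 1 + 1) : ℕ) : ℝ) = 6 := by exact_mod_cast signCount_four
    rw [h4]
  have hfi : ∀ (i : Fin 4) (o : Mode) (x : Fin 3 → Mode), freq (i.insertNth o x : Fin 4 → Mode) =
      freq ((0 : Fin 4).insertNth o x : Fin 4 → Mode) := fun i o x => by
    rw [freq_insertNth, freq_insertNth]
  have hχ : ∀ (i : Fin 4) (o : Mode) (x : Fin 3 → Mode), χ 1 (i.insertNth o x : Fin 4 → Mode) =
      Complex.I * K o x / freq ((0 : Fin 4).insertNth o x : Fin 4 → Mode) := by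
    intro i o x
    rw [h.generator_one_apply hm hP0, hP, hfi]
  have hD : ∀ (i : Fin 4) (o : Mode) (x : Fin 3 → Mode), freqMul χ 1 (i.insertNth o x : Fin 4 → Mode) =
      Complex.I * freq ((0 : Fin 4).insertNth o x : Fin 4 → Mode) * (Complex.I * K o x /
        freq ((0 : Fin 4).insertNth o x : Fin 4 → Mode)) := by
    intro i o x
    rw [freqMul, hχ, hfi]
  have hb : ∀ (f : Coef (3 + 1)) (a : ℂ), (∀ i : Fin 4, f (i.insertNth o x : Fin 4 → Mode) = a) →
      bracket (p := 3) (q := 3) (N := 6) rfl f (χ 1) (Fin.append x y) =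
        -Complex.I * ((o.1 : ℤ) : ℂ) * (16 * (a * (Complex.I * K (bar o) y /
          freq ((0 : Fin 4).insertNth (bar o) y : Fin 4 → Mode)))) := by
    intro f a hf
    have hl : leftPart (p := 3) (q := 3) (N := 6) rfl (Fin.append x y) = x :=
      funext fun k => Fin.append_left x y k
    have hr : rightPart (p := 3) (q := 3) (N := 6) rfl (Fin.append x y) = y :=
      funext fun k => Fin.append_right x y k
    rw [bracket, hl, hr, ← ho]
    congr 1
    have e : ∀ i i' : Fin 4, f (i.insertNth o x : Fin 4 → Mode) *
        χ 1 (i'.insertNth (bar o) y : Fin 4 → Mode) = a * (Complex.I * K (bar o) y /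
          freq ((0 : Fin 4).insertNth (bar o) y : Fin 4 → Mode)) := fun i i' => by rw [hf, hχ]
    refine (Finset.sum_congr rfl fun i _ => Finset.sum_congr rfl fun i' _ => e i i').trans ?_
    rw [Finset.sum_const, Finset.sum_const, Finset.card_univ, Fintype.card_fin]
    simp only [nsmul_eq_mul]
    push_cast
    ring
  rw [lieSeries_two h.zero hP0, ad_two h.zero hP0, ad_two h.zero (freqMul_zero h.zero)]
  simp only [Pi.add_apply, Pi.smul_apply]
  have hj0 : freqMul χ 2 (Fin.append x y : Fin (3 + 3) → Mode) = 0 := by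
    have : freq (n := 2 * 2 + 1 + 1) (Fin.append x y : Fin (3 + 3) → Mode) = 0 := hj
    rw [freqMul, this]; simp
  have e1 := hb (P 1) _ fun i => hP i o x
  have e2 := hb (freqMul χ 1) _ fun i => hD i o x
  refine (congrArg₂ (· + ·) (congrArg (P 2 (Fin.append x y : Fin (3 + 3) → Mode) + ·) hj0) (congrArg₂ (· + ·) e1
    (congrArg ((2⁻¹ : ℝ) • ·) e2))).trans ?_
  have hex : exchange (c / 6) x y = 8 * ((o.1 : ℤ) : ℂ) * K o x * K (bar o) y /
      (freq ((0 : Fin 4).insertNth (bar o) y : Fin 4 → Mode) : ℂ) := by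
    rw [exchange, ← ho, hK, hK]
  rw [hex, hfr, add_zero, Complex.real_smul]
  congr 1
  -- for the frequency `0` both sides vanish, as quotients by zero
  generalize (freq ((0 : Fin 4).insertNth (bar o) y : Fin 4 → Mode)) = w
  rcases eq_or_ne w 0 with rfl | hw
  · simp
  · have hw' : (w : ℂ) ≠ 0 := by exact_mod_cast hw
    push_cast
    field_simp
    ring_nf
    simp only [Complex.I_sq, show Complex.I ^ 4 = 1 from Complex.I_pow_four]
    ring

open Classical in
/-- The integrable part of a polynomial. -/
def intPart {n : ℕ} (f : Coef n) : Coef n := fun j => if Matched j then f j else 0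

theorem IsHamCoef.intPart {n : ℕ} {f : Coef n} {B : ℝ} (hf : IsHamCoef f B) :
    IsHamCoef (intPart f) B := by
  classical
  refine ⟨fun j => ?_, fun j hj => ?_, fun j hj => ?_, fun j => ?_⟩
  · unfold GevreyNLS.intPart
    split_ifs
    · exact hf.bound j
    · rw [norm_zero]; exact hf.nonneg
  · exact hf.charge_eq j fun h => hj (by simp [GevreyNLS.intPart, h])
  · exact hf.mom_eq j fun h => hj (by simp [GevreyNLS.intPart, h])
  · unfold GevreyNLS.intPart
    rw [if_congr matched_bar_iff rfl rfl]
    split_ifs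
    · exact hf.real j
    · simp

/-- The integrable terms of degree six of the transformed Hamiltonian. -/
theorem evalC_intPart_lieSeries_two [hI : GevreyIndex ρ θ] {P χ : Graded} {C₀ : ℝ} {m : ℕ}
    (h : IsNormalizing P C₀ m χ) (hm : 2 < m) (hP0 : P 0 = 0) {c c' : ℝ}
    (hP1 : P 1 = nlsCoef (2 * 1 + 1 + 1) c) (hP2 : P 2 = nlsCoef (2 * 2 + 1 + 1) c')
    (u : Gevrey ρ θ) :
    evalC ρ θ (intPart (lieSeries P χ 2)) u =
      ((-2 * c ^ 2 * (∑' p : {p : ℤ × ℤ // p.1 ≠ p.2}, action u p.1.1 ^ 2 * action u p.1.2 /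
          ((p.1.1 : ℝ) - (p.1.2 : ℝ)) ^ 2) +
        c' * (6 * (∑' a, action u a) ^ 3 - 9 * (∑' a, action u a) * (∑' a, action u a ^ 2) +
          4 * ∑' a, action u a ^ 3) : ℝ) : ℂ) := by
  classical
  have hW := h.isHam_lieSeries 2 two_ne_zero hm
  have hP : IsHamCoef (P 2) |c'| := by rw [hP2]; exact isHamCoef_nlsCoef _ _
  have hQ := (hW.add (hP.smul (-1))).intPart
  have hsum : intPart (lieSeries P χ 2) =
      intPart (P 2) + intPart (lieSeries P χ 2 + (-1 : ℝ) • P 2) := by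
    funext j
    simp only [intPart, Pi.add_apply]
    split_ifs
    · simp
    · simp
  rw [hsum, evalC_add hP.intPart hQ]
  have e1 : evalC ρ θ (intPart (P 2)) u = ((c' * (6 * (∑' a, action u a) ^ 3 -
      9 * (∑' a, action u a) * (∑' a, action u a ^ 2) + 4 * ∑' a, action u a ^ 3) : ℝ) : ℂ) := by
    rw [evalC_eq_tsum hP.intPart, ← tsum_orbitCount_three (summable_action u)]
    have h6 : ((signCount (3 + 3) : ℕ) : ℝ) = 20 := by exact_mod_cast signCount_six
    refine Eq.trans (tsum_congr fun j => ?_) ((tsum_matched u 3 (c' / signCount (3 + 3))).trans ?_)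
    · refine congrArg (· * _) ?_
      rw [hP2]
      exact nlsCoef_of_matched c' j
    · congr 1
      rw [h6]; ring
  have e2 : evalC ρ θ (intPart (lieSeries P χ 2 + (-1 : ℝ) • P 2)) u =
      ((-72 * (c / 6) ^ 2 * ∑' p : {p : ℤ × ℤ // p.1 ≠ p.2}, action u p.1.1 ^ 2 * action u p.1.2 /
        ((p.1.1 : ℝ) - (p.1.2 : ℝ)) ^ 2 : ℝ) : ℂ) := by
    rw [evalC_eq_tsum hQ]
    refine tsum_exchange_matched u (c / 6) (Q := intPart (lieSeries P χ 2 + (-1 : ℝ) • P 2))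
      hQ.bound fun x y => ?_
    refine if_ctx_congr Iff.rfl (fun hxy => ?_) fun _ => rfl
    have := h.lieSeries_two_apply (by omega) hP0 hP1 x y hxy.resonant.2.2
    show lieSeries P χ 2 (Fin.append x y : Fin (3 + 3) → Mode) + (-1 : ℝ) • P 2 (Fin.append x y : Fin (3 + 3) → Mode) = _
    rw [this]; simp
  rw [e1, e2]
  push_cast
  ring

end

/-! ### The resonant polynomials -/

section

variable {ρ θ : ℝ}

/-- The polynomial without its integrable part. -/
def nonintPart {n : ℕ} (f : Coef n) : Coef n := f + (-1 : ℝ) • intPart f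

theorem nonintPart_of_matched {n : ℕ} (f : Coef n) {j : Fin n → Mode} (h : Matched j) :
    nonintPart f j = 0 := by
  simp [nonintPart, intPart, h]

theorem nonintPart_of_not_matched {n : ℕ} (f : Coef n) {j : Fin n → Mode} (h : ¬ Matched j) :
    nonintPart f j = f j := by
  simp [nonintPart, intPart, h]

theorem IsHamCoef.nonintPart {n : ℕ} {f : Coef n} {B : ℝ} (hf : IsHamCoef f B) :
    IsHamCoef (nonintPart f) B := by
  have h := hf.add (hf.intPart.smul (-1))
  refine ⟨fun j => ?_, h.charge_eq, h.mom_eq, h.real⟩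
  by_cases hj : Matched j
  · rw [nonintPart_of_matched f hj, norm_zero]; exact hf.nonneg
  · rw [nonintPart_of_not_matched f hj]; exact hf.bound j

theorem matched_of_mem_integrable {l : ℕ} {j : Idx l} (h : j ∈ integrable l) : Matched j := by
  obtain ⟨-, σ, hσ⟩ := h
  exact ⟨σ, funext fun i => Prod.ext (hσ i).1 (hσ i).2⟩

/-- The family of coefficients of a formal sum, indexed by the half of the degree. -/
def coeffFamily (W : Graded) : (l : ℕ) → Idx l → ℂ
  | 0, _ => 0
  | k + 1, j => W k j

theorem hasSum_coeffFamily [GevreyIndex ρ θ] {W : Graded} {B : ℝ} {k : ℕ} (hW : IsHamCoef (W k) B)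
    {s : Set (Idx (k + 1))} (hs : ∀ j, W k j ≠ 0 → j ∈ s) (u : Gevrey ρ θ) :
    HasSum (fun j : ↥s => coeffFamily W (k + 1) j * monomial u j.1)
      (((evalC ρ θ (W k) u).re : ℝ) : ℂ) := by
  rw [← evalC_eq_re hW, evalC_eq_tsum hW]
  have h := (summable_evalC_terms hW u).hasSum
  have hsup : Function.support (fun j : Fin (2 * k + 1 + 1) → Mode => W k j * ∏ i, coord u (j i)) ⊆ s :=
    fun j hj => hs j (left_ne_zero_of_mul hj)
  exact (hasSum_subtype_iff_of_support_subset (s := (s : Set (Fin (2 * k + 1 + 1) → Mode))) hsup).2 h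

theorem lieSeries_zero {P χ : Graded} (hχ0 : χ 0 = 0) (hP0 : P 0 = 0) : lieSeries P χ 0 = 0 := by
  rw [lieSeries_eq_add, hP0, freqMul_zero hχ0]; simp

/-- The formal sum `W` without its integrable terms of degree six. -/
def dropIntegrable (W : Graded) : Graded := Function.update W 2 (nonintPart (W 2))

theorem dropIntegrable_two (W : Graded) : dropIntegrable W 2 = nonintPart (W 2) :=
  Function.update_self _ _ _

theorem dropIntegrable_of_ne (W : Graded) {k : ℕ} (h : k ≠ 2) : dropIntegrable W k = W k :=
  Function.update_of_ne h _ _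

theorem isHamCoef_dropIntegrable {W : Graded} {B : ℝ} {k : ℕ} (hW : IsHamCoef (W k) B) :
    IsHamCoef (dropIntegrable W k) B := by
  rcases eq_or_ne k 2 with rfl | h
  · rw [dropIntegrable_two]; exact hW.nonintPart
  · rw [dropIntegrable_of_ne W h]; exact hW

theorem ne_zero_of_dropIntegrable_ne_zero {W : Graded} {k : ℕ} {j : Fin (2 * k + 1 + 1) → Mode}
    (h : dropIntegrable W k j ≠ 0) : W k j ≠ 0 := by
  rcases eq_or_ne k 2 with rfl | hk
  · rw [dropIntegrable_two] at h
    by_cases hj : Matched j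
    · exact absurd (nonintPart_of_matched _ hj) h
    · rwa [nonintPart_of_not_matched _ hj] at h
  · rwa [dropIntegrable_of_ne W hk] at h

theorem sum_evalC_eq [GevreyIndex ρ θ] {W : Graded} {B : ℕ → ℝ} {r : ℕ} (hr : 3 ≤ r)
    (hW : ∀ k < r, IsHamCoef (W k) (B k)) (hW0 : W 0 = 0) (u : Gevrey ρ θ) :
    ∑ k ∈ Finset.range r, evalC ρ θ (W k) u = evalC ρ θ (W 1) u + evalC ρ θ (intPart (W 2)) u +
      ∑ l ∈ Finset.Icc 3 r, evalC ρ θ (dropIntegrable W (l - 1)) u := by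
  have h2 : evalC ρ θ (W 2) u = evalC ρ θ (intPart (W 2)) u + evalC ρ θ (dropIntegrable W 2) u := by
    have h := hW 2 (by omega)
    rw [dropIntegrable_two, nonintPart, evalC_add h (h.intPart.smul (-1)),
      evalC_smul h.intPart]
    push_cast; ring
  have h3 : ∑ l ∈ Finset.Icc 3 r, evalC ρ θ (dropIntegrable W (l - 1)) u =
      ∑ k ∈ Finset.Ico 2 r, evalC ρ θ (dropIntegrable W k) u := by
    refine Finset.sum_nbij' (fun l => l - 1) (fun k => k + 1) ?_ ?_ ?_ ?_ fun _ _ => rfl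
    · intro l hl; rw [Finset.mem_Icc] at hl; rw [Finset.mem_Ico]; omega
    · intro k hk; rw [Finset.mem_Ico] at hk; rw [Finset.mem_Icc]; omega
    · intro l hl; rw [Finset.mem_Icc] at hl; show l - 1 + 1 = l; omega
    · intro k _; exact Nat.add_sub_cancel k 1
  have h4 : ∑ k ∈ Finset.Ico 3 r, evalC ρ θ (dropIntegrable W k) u =
      ∑ k ∈ Finset.Ico 3 r, evalC ρ θ (W k) u :=
    Finset.sum_congr rfl fun k hk => by
      rw [dropIntegrable_of_ne W (by rw [Finset.mem_Ico] at hk; omega)]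
  rw [h3, Finset.sum_eq_sum_Ico_succ_bot (by omega : 2 < r), h4, Finset.range_eq_Ico,
    Finset.sum_eq_sum_Ico_succ_bot (by omega : 0 < r),
    Finset.sum_eq_sum_Ico_succ_bot (by omega : 1 < r),
    Finset.sum_eq_sum_Ico_succ_bot (by omega : 2 < r), hW0, evalC_zero, h2]
  ring

/-! ### The normal form theorem -/

theorem NearIdentity.mono {ψ : Gevrey ρ θ → Gevrey ρ θ} {s : Set (Gevrey ρ θ)} {C K K' : ℝ}
    (h : NearIdentity ψ s C K) (hK : K ≤ K') : NearIdentity ψ s C K' := fun z hz =>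
  ⟨(h z hz).1, (h z hz).2.imp fun _ hA => ⟨hA.1, hA.2.trans hK⟩⟩

/-- The condition `ε ≤ c r^{-3/2}` makes the radius small. -/
theorem isSmallRadius_of_le [GevreyIndex ρ θ] {C₀ : ℝ} (hC : 1 ≤ C₀) {r : ℕ} (hr : 1 ≤ r) {ε : ℝ}
    (hε : 0 < ε) (h : ε ≤ 1 / (64 * C₀ * algConst ρ θ ^ 2) * (r : ℝ) ^ (-(3 / 2) : ℝ)) :
    IsSmallRadius ρ θ C₀ r (4 * ε) := by
  have ha := one_le_algConst ρ θ
  set a := algConst ρ θ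
  have hr1 : (1 : ℝ) ≤ r := by exact_mod_cast hr
  have hr0 : (0 : ℝ) < r := by linarith
  have hpow : ((r : ℝ) ^ (-(3 / 2) : ℝ)) ^ 2 * (r : ℝ) ^ 3 = 1 := by
    rw [← Real.rpow_natCast, ← Real.rpow_natCast, ← Real.rpow_mul hr0.le, ← Real.rpow_add hr0]
    norm_num
  have h1 : (64 * C₀ * a ^ 2 * ε) ^ 2 * (r : ℝ) ^ 3 ≤ 1 := by
    rw [← hpow]
    have : 64 * C₀ * a ^ 2 * ε ≤ (r : ℝ) ^ (-(3 / 2) : ℝ) := by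
      rw [one_div, inv_mul_eq_div, le_div_iff₀ (by positivity)] at h
      linarith
    gcongr
  have hCa : 1 ≤ C₀ * a ^ 2 := one_le_mul_of_one_le_of_one_le hC (one_le_pow₀ ha)
  have h2 : 4096 * (C₀ * a ^ 2 * ε ^ 2 * r ^ 3) ≤ 1 := by
    calc 4096 * (C₀ * a ^ 2 * ε ^ 2 * r ^ 3)
        ≤ 4096 * (C₀ * a ^ 2 * ε ^ 2 * r ^ 3) * (C₀ * a ^ 2) :=
          le_mul_of_one_le_right (by positivity) hCa
      _ = (64 * C₀ * a ^ 2 * ε) ^ 2 * (r : ℝ) ^ 3 := by ring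
      _ ≤ 1 := h1
  have hr3 : (1 : ℝ) ≤ r ^ 3 := one_le_pow₀ hr1
  constructor
  · change 24 * (r : ℝ) ^ 3 * C₀ * (a * (4 * ε)) ^ 2 ≤ 1 / 8
    nlinarith
  · change 192 * C₀ * a ^ 3 * (4 * ε) ^ 2 ≤ 1
    have hCa' : a ≤ C₀ * a ^ 2 := by
      have : a * 1 ≤ a * (C₀ * a) :=
        mul_le_mul_of_nonneg_left (one_le_mul_of_one_le_of_one_le hC ha) (by linarith)
      linarith
    calc 192 * C₀ * a ^ 3 * (4 * ε) ^ 2 = 3072 * (C₀ * a ^ 2 * ε ^ 2) * a := by ring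
      _ ≤ 3072 * (C₀ * a ^ 2 * ε ^ 2) * (C₀ * a ^ 2) * r ^ 3 := by
          rw [mul_assoc (3072 * (C₀ * a ^ 2 * ε ^ 2))]
          gcongr
          exact hCa'.trans (le_mul_of_one_le_right (by positivity) hr3)
      _ ≤ (64 * C₀ * a ^ 2 * ε) ^ 2 * (r : ℝ) ^ 3 := by
          have : 0 ≤ C₀ * a ^ 2 * ε ^ 2 * (C₀ * a ^ 2) * r ^ 3 := by positivity
          linarith
      _ ≤ 1 := h1

theorem exists_continuousOn_of_analyticAt {φ : ℝ → ℝ} (h : AnalyticAt ℝ φ 0) :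
    ∃ δ > 0, ContinuousOn φ (Set.Icc 0 δ) := by
  obtain ⟨δ, hδ, hb⟩ := Metric.eventually_nhds_iff.1 h.eventually_analyticAt
  refine ⟨δ / 2, by positivity, fun x hx => (hb ?_).continuousAt.continuousWithinAt⟩
  rw [Real.dist_eq, sub_zero, abs_of_nonneg hx.1]
  linarith [hx.2]

theorem remainder_bound_le {a C₀ y : ℝ} (ha : 1 ≤ a) (hC : 1 ≤ C₀) (hy : 0 ≤ y) {r : ℕ}
    (hr : r ≠ 0) :
    4 * (a * y) * (2 * (24 * (r : ℝ) ^ 3 * C₀ * (a * y) ^ 2)) ^ r ≤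
      4 * ((r : ℝ) ^ 3 * (48 * C₀ * a ^ 3)) ^ r * y ^ (2 * r + 1) := by
  -- the right-hand side has the power `a ^ (3 r)`, one factor `a ^ r` more than needed for `a ^ (2 r)`
  have h1 : a ≤ a ^ r := le_self_pow₀ ha hr
  calc 4 * (a * y) * (2 * (24 * (r : ℝ) ^ 3 * C₀ * (a * y) ^ 2)) ^ r
      ≤ 4 * (a ^ r * y) * (2 * (24 * (r : ℝ) ^ 3 * C₀ * (a * y) ^ 2)) ^ r := by gcongr
    _ = 4 * y * (a * (2 * (24 * (r : ℝ) ^ 3 * C₀ * (a * y) ^ 2))) ^ r := by rw [mul_pow a]; ring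
    _ = 4 * y * ((r : ℝ) ^ 3 * (48 * C₀ * a ^ 3) * y ^ 2) ^ r := by ring_nf
    _ = _ := by rw [mul_pow _ (y ^ 2), pow_succ y (2 * r), pow_mul y]; ring

end

end GevreyNLS

end

theorem theorem4p1 :
    -- the absolute constant behind `≲`
    ∃ K : ℝ, 0 < K ∧
    ∀ ρ θ C₀ : ℝ, 0 < ρ → 0 < θ → θ < 1 → 1 ≤ C₀ →
    ∃ C C₁ c : ℝ, 0 < C ∧ 0 < C₁ ∧ 0 < c ∧
    ∀ φ : ℝ → ℝ, AnalyticAt ℝ φ 0 → φ 0 = 0 → deriv φ 0 ≠ 0 →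
    (∀ l : ℕ, 2 ≤ l → |iteratedDeriv (l - 1) φ 0 / (l.factorial : ℝ)| < C₀ ^ (l - 1)) →
    ∃ ε₀ : ℝ, 0 < ε₀ ∧
    ∀ r : ℕ, 3 ≤ r → ∀ ε : ℝ, 0 < ε → ε ≤ ε₀ → ε ≤ c * (r : ℝ) ^ (-(3 / 2) : ℝ) →
    ∃ (Φ : OpenPartialHomeomorph (Gevrey ρ θ) (Gevrey ρ θ))
      (K₂ : ℕ → Gevrey ρ θ → ℝ)
      (coeff : (l : ℕ) → Idx l → ℂ)
      (𝓡 : Gevrey ρ θ → ℝ),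
      -- a canonical transformation from `B(3ε)` into `B(4ε)`
      Φ.source = Metric.ball 0 (3 * ε) ∧ Φ.target ⊆ Metric.ball 0 (4 * ε) ∧ IsCanonical Φ ∧
      -- the normal form
      (∀ z ∈ Metric.ball (0 : Gevrey ρ θ) (3 * ε),
        hamiltonian φ (Φ z) =
          H0 z + Z4 φ z + Z6 φ z + ∑ l ∈ Finset.Icc 3 r, K₂ l z + 𝓡 z
            + taylorRemainder φ r (Φ z)) ∧
      -- the estimates of the transformation and of its inverse
      NearIdentity Φ Φ.source C K ∧ NearIdentity Φ.symm Φ.target C K ∧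
      -- the resonant polynomials
      (∀ z : Gevrey ρ θ, HasSum
        (fun j : ↥(resonant 3 \ integrable 3) => coeff 3 j * monomial z j.1) (K₂ 3 z : ℂ)) ∧
      (∀ l ∈ Finset.Icc 4 r, ∀ z : Gevrey ρ θ, HasSum
        (fun j : ↥(resonant l) => coeff l j * monomial z j.1) (K₂ l z : ℂ)) ∧
      (∀ l ∈ Finset.Icc 3 r, ∀ j ∈ resonant l,
        ‖coeff l j‖ ≤ (8 * ((l : ℝ) - 1) ^ 3) ^ (l - 2) * C₀ ^ (l - 1)) ∧
      -- the remainder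
      (∀ z ∈ Metric.ball (0 : Gevrey ρ θ) (3 * ε), ∃ X : Gevrey ρ θ,
        IsHamVectorAt 𝓡 z X ∧
        ‖X‖ ≤ K * ((r : ℝ) ^ 3 * C₁) ^ r * ‖z‖ ^ (2 * r + 1)) := by
  refine ⟨4, by norm_num, fun ρ θ C₀ hρ hθ hθ1 hC => ?_⟩
  have : GevreyIndex ρ θ := ⟨hρ, hθ, hθ1⟩
  have ha1 := one_le_algConst ρ θ
  have ha := algConst_pos ρ θ
  have hC0 : 0 < C₀ := by linarith
  -- the constants come from the displacement of the flow, from the geometric growth `24 r³ C₀` of the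
  -- coefficients, and from the radius on which all the series converge
  refine ⟨512 * C₀ * algConst ρ θ ^ 3, 48 * C₀ * algConst ρ θ ^ 3,
    1 / (64 * C₀ * algConst ρ θ ^ 2), by positivity, by positivity, by positivity,
    fun φ hφ _ _ hφC => ?_⟩
  obtain ⟨δ, hδ, hcont⟩ := exists_continuousOn_of_analyticAt hφ
  -- `φ` is continuous at all the values `|u(x)|²` for `u` in the ball of radius `4 ε₀`
  refine ⟨Real.sqrt δ / (4 * algConst ρ θ), by positivity, fun r hr ε hε hε₀ hεr => ?_⟩
  have hR := isSmallRadius_of_le hC (by omega : 1 ≤ r) hε hεr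
  set P := nlsGraded φ r with hPdef
  have hP0 : P 0 = 0 := if_neg fun h => h.1 rfl
  have hP1 : P 1 = nlsCoef (2 * 1 + 1 + 1) (deriv φ 0 / 2) := by
    rw [hPdef, nlsGraded, if_pos ⟨one_ne_zero, by omega⟩, iteratedDeriv_one]
    norm_num
  have hP2 : P 2 = nlsCoef (2 * 2 + 1 + 1) (iteratedDeriv 2 φ 0 / 6) := by
    rw [hPdef, nlsGraded, if_pos ⟨two_ne_zero, by omega⟩]
    norm_num [Nat.factorial]
  have hP := fun k => isHamCoef_nlsGraded hC hφC r k
  obtain ⟨χ, h⟩ := exists_isNormalizing hC hP0 hP (m := r) (by omega)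
  have hWall := h.isHam_lieSeries_all hC (by omega) hP0 hP
  set W := lieSeries P χ with hW
  have hW0 : W 0 = 0 := lieSeries_zero h.zero hP0
  obtain ⟨Φ, hsrc, htgt, hcan, hΦ, hΦs, hpull⟩ := h.exists_transformation hC (by omega) hP0 hP hε hR
  have hT : 0 ≤ 24 * (r : ℝ) ^ 3 * C₀ := by positivity
  have hsmall : ∀ y : ℝ, 0 ≤ y → y ≤ 4 * ε →
      24 * (r : ℝ) ^ 3 * C₀ * (algConst ρ θ * y) ^ 2 ≤ 1 / 4 := by
    intro y hy hy'
    have h1 : 24 * (r : ℝ) ^ 3 * C₀ * (algConst ρ θ * y) ^ 2 ≤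
        24 * (r : ℝ) ^ 3 * C₀ * (algConst ρ θ * (4 * ε)) ^ 2 := by gcongr
    linarith [hR.ratio_le]
  have hres : ∀ k, k ≠ 0 → k < r → ∀ j : Idx (k + 1), dropIntegrable W k j ≠ 0 →
      j ∈ resonant (k + 1) := by
    intro k hk hkr j hj
    have hj' := ne_zero_of_dropIntegrable_ne_zero hj
    refine ⟨(hWall k).charge_eq j hj', (hWall k).mom_eq j hj', ?_⟩
    by_contra hf
    exact hj' (h.lieSeries_eq_zero k hk hkr j hf)
  refine ⟨Φ, fun l z => (evalC ρ θ (dropIntegrable W (l - 1)) z).re,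
    coeffFamily (dropIntegrable W), fun z => (evalGraded ρ θ (tail r W) z).re, hsrc, htgt, hcan,
    fun z hz => ?_, hΦ.mono (by norm_num), hΦs.mono (by norm_num), fun z => ?_,
    fun l hl z => ?_, fun l hl j _ => ?_, fun z hz => ?_⟩
  · have hz' : ‖z‖ < 3 * ε := mem_ball_zero_iff.1 hz
    have hΦz : ‖Φ z‖ < 4 * ε :=
      mem_ball_zero_iff.1 (htgt (Φ.map_source (by rw [hsrc]; exact hz)))
    have hδ' : (algConst ρ θ * ‖Φ z‖) ^ 2 ≤ δ := by
      rw [le_div_iff₀ (by positivity)] at hε₀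
      refine (Real.le_sqrt (by positivity) hδ.le).1 (le_trans ?_ hε₀)
      nlinarith
    have h1 := hamiltonian_eq hcont r hδ'
    rw [← hPdef, hpull z hz, evalGraded_eq_sum_add_tail (m := r) hT hWall
      ((hsmall _ (norm_nonneg z) (by linarith)).trans (by norm_num)),
      sum_evalC_eq hr (fun k _ => hWall k) hW0,
      evalC_lieSeries_one h (by omega) hP0 hP1,
      evalC_intPart_lieSeries_two h (by omega) hP0 hP1 hP2] at h1
    have h2 := congrArg Complex.re h1
    simp only [Complex.add_re, Complex.ofReal_re, Complex.re_sum] at h2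
    rw [h2, Z4, Z6]
    ring
  · refine hasSum_coeffFamily (s := resonant 3 \ integrable 3)
      (isHamCoef_dropIntegrable (hWall 2)) (fun j hj =>
        ⟨hres 2 two_ne_zero (by omega) j hj, fun hi => hj ?_⟩) z
    rw [dropIntegrable_two]
    exact nonintPart_of_matched _ (matched_of_mem_integrable hi)
  · rw [Finset.mem_Icc] at hl
    obtain ⟨k, rfl⟩ : ∃ k, l = k + 1 := ⟨l - 1, by omega⟩
    exact hasSum_coeffFamily (isHamCoef_dropIntegrable (hWall k))
      (hres k (by omega) (by omega)) z
  · rw [Finset.mem_Icc] at hl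
    obtain ⟨k, rfl⟩ : ∃ k, l = k + 1 := ⟨l - 1, by omega⟩
    have := (isHamCoef_dropIntegrable (h.isHam_lieSeries k (by omega) (by omega))).bound j
    rw [coefBound] at this
    rw [show k + 1 - 2 = k - 1 by omega, Nat.add_sub_cancel]
    push_cast
    rw [add_sub_cancel_right]
    exact this
  · obtain ⟨X, hX, hXn⟩ := exists_isHamVectorAt_tail (m := r) hT hWall
      (hsmall (3 * ε) (by positivity) (by linarith)) (mem_ball_zero_iff.1 hz)
    exact ⟨X, hX, hXn.trans (remainder_bound_le ha1 hC (norm_nonneg z) (by omega))⟩
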